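/- For real $a$ let $W(a,x)$ be Weber's parabolic cylinder function, that is, the real solution $y(x)=W(a,x)$, $x\in\mathbb R$, of Weber's equation $y''+\left(\tfrac14x^2-a\right)y=0$ with $$W(a,0)=2^{-3/4}\left|\frac{\Gamma(\frac14+\frac12 ia)}{\Gamma(\frac34+\frac12 ia)}\right|^{1/2},\qquad W'(a,0)=-2^{-1/4}\left|\frac{\Gamma(\frac34+\frac12 ia)}{\Gamma(\frac14+\frac12 ia)}\right|^{1/2}.$$ (Equivalently, it is the solution that satisfies, with $k_a=\sqrt{1+e^{2\pi a}}-e^{\pi a}$ and $\zeta(a,x)=\frac14x^2-a\ln x+\frac12\arg\Gamma(\frac12+ia)+\frac\pi4$, where $\arg\Gamma(\frac12+ia)$ is continuous in $a$ and vanishes at $a=0$, $W(a,x)=\sqrt{2k_a/x}\,[\cos\zeta(a,x)+O(1/x)]$ and $W(a,-x)=\sqrt{2/(k_ax)}\,[\sin\zeta(a,x)+O(1/x)]$ as $x\to+\infty$.) Call $\varphi:\mathbb R\to\mathbb R$ piecewise continuously differentiable if there is a set $S\subset\mathbb R$, with finitely many points in each bounded interval, such that $\varphi$ is continuously differentiable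 on $\mathbb R\setminus S$ and $\varphi$ and $\varphi'$ have finite one-sided limits at each point of $S$. **Theorem.** Let $a\in\mathbb R$ and let $\varphi:\mathbb R\to\mathbb R$ be piecewise continuously differentiable, such that the integrals $$\int_{-\infty}^{-1}|\varphi(x)|\,e^{\pi|x|/4}\,\frac{dx}{|x|}\qquad\text{and}\qquad\int_{1}^{\infty}|\varphi(x)|\,e^{5\pi x/4}\,\frac{dx}{x}$$ are finite. Then for every $R>0$ the function $b\mapsto\varphi(b)\int_{-R}^{R}W(a,x)W(b,x)\,dx$ is integrable on $\mathbb R$, and $$\lim_{R\to\infty}\int_{-\infty}^{\infty}\varphi(b)\int_{-R}^{R}W(a,x)W(b,x)\,dx\,db=\pi\sqrt{1+e^{2\pi a}}\,\bigl[\varphi(a^-)+\varphi(a^+)\bigr],$$ where $\varphi(a^-)$ and $\varphi(a^+)$ are the left and right limits of $\varphi$ at $a$. -/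

import Mathlib

open Real Set Filter Topology MeasureTheory

noncomputable section

/-- Coefficients of the even solution of `y'' + (x ^ 2 / 4 - a) y = 0` with `y 0 = 1`, `y' 0 = 0`:
the solution is `∑ weberEvenCoeff a n * x ^ (2 n) / (2 n)!`. -/
def weberEvenCoeff (a : ℝ) : ℕ → ℝ
  | 0 => 1
  | 1 => a
  | n + 2 => a * weberEvenCoeff a (n + 1)
      - ((n : ℝ) + 1) * (2 * (n : ℝ) + 1) / 2 * weberEvenCoeff a n

/-- Coefficients of the odd solution of `y'' + (x ^ 2 / 4 - a) y = 0` with `y 0 = 0`, `y' 0 = 1`: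
the solution is `∑ weberOddCoeff a n * x ^ (2 n + 1) / (2 n + 1)!`. -/
def weberOddCoeff (a : ℝ) : ℕ → ℝ
  | 0 => 1
  | 1 => a
  | n + 2 => a * weberOddCoeff a (n + 1)
      - ((n : ℝ) + 1) * (2 * (n : ℝ) + 3) / 2 * weberOddCoeff a n

/-- The even solution of Weber's equation `y'' + (x ^ 2 / 4 - a) y = 0` with `y 0 = 1`
(an everywhere convergent power series). -/
def weberEven (a x : ℝ) : ℝ :=
  ∑' n : ℕ, weberEvenCoeff a n * x ^ (2 * n) / ((2 * n).factorial : ℝ)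

/-- The odd solution of Weber's equation `y'' + (x ^ 2 / 4 - a) y = 0` with `y' 0 = 1`
(an everywhere convergent power series). -/
def weberOdd (a x : ℝ) : ℝ :=
  ∑' n : ℕ, weberOddCoeff a n * x ^ (2 * n + 1) / ((2 * n + 1).factorial : ℝ)

/-- `|Γ(1/4 + i a / 2)|`, the modulus that enters the initial values of `W(a, ·)`. -/
def weberG1 (a : ℝ) : ℝ := ‖Complex.Gamma (1 / 4 + Complex.I * (a : ℂ) / 2)‖

/-- `|Γ(3/4 + i a / 2)|`, the modulus that enters the initial values of `W(a, ·)`. -/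
def weberG3 (a : ℝ) : ℝ := ‖Complex.Gamma (3 / 4 + Complex.I * (a : ℂ) / 2)‖

/-- Weber's parabolic cylinder function `W(a, x)`: the solution of
`y'' + (x ^ 2 / 4 - a) y = 0` with initial values
`W(a, 0) = 2 ^ (-3/4) |Γ(1/4 + i a/2) / Γ(3/4 + i a/2)| ^ (1/2)` and
`W'(a, 0) = - 2 ^ (-1/4) |Γ(3/4 + i a/2) / Γ(1/4 + i a/2)| ^ (1/2)`. -/
def weberW (a x : ℝ) : ℝ :=
  (2 : ℝ) ^ (-(3 / 4) : ℝ) * √(weberG1 a / weberG3 a) * weberEven a x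
    - (2 : ℝ) ^ (-(1 / 4) : ℝ) * √(weberG3 a / weberG1 a) * weberOdd a x

/-- `φ` is piecewise continuously differentiable on `ℝ`: away from a set `S` that meets every
bounded interval in finitely many points, `φ` is continuously differentiable, and at the points
of `S` both `φ` and its derivative have finite one-sided limits. -/
def PiecewiseC1 (φ : ℝ → ℝ) : Prop :=
  ∃ S : Set ℝ, (∀ A B : ℝ, (S ∩ Icc A B).Finite) ∧
    (∀ x, x ∉ S → ContDiffAt ℝ 1 φ x) ∧
    ∀ s ∈ S,
      (∃ l, Tendsto φ (𝓝[<] s) (𝓝 l)) ∧ (∃ l, Tendsto φ (𝓝[>] s) (𝓝 l)) ∧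
      (∃ l, Tendsto (deriv φ) (𝓝[<] s) (𝓝 l)) ∧ (∃ l, Tendsto (deriv φ) (𝓝[>] s) (𝓝 l))

end

/-! Split `W(a, ·)` into its even and odd parts. On `[-R, R]` the mixed products integrate to zero,
so it suffices to treat integrals over `[0, R]` of `y z`, where `y` and `z` are the basic solutions
of one parity for the parameters `a` and `b`. By the Lagrange identity `(a - b) ∫₀ᴿ y z` is the
Wronskian `y' z - y z'` at `R`, so only the behaviour at infinity matters.

In the variable `g = √x y / 2 - i y' / √x` (`weberAmp`) the Wronskian is `2 Im (conj g_a · g_b)`,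
and `g_b = C_b e^{iθ_b} + O(x⁻²)` with `θ_b = x² / 4 - b log x`. The quadratic phases cancel in the
product and leave `e^{i (a - b) log R}`: up to a remainder, the truncated inner product is a
Dirichlet kernel of frequency `log R` with the amplitude `2 conj C_a · C_b`. Localization at a jump
(`tendsto_integral_dirichlet`) gives `π / 2` from each side of `a`, hence `π |C_a|²` times the sum
of the one-sided limits.

Three points need work. First, the constant `C_b` (`WeberSol.amplitude_mul_eq`): the transform `L(ε)
= ∫₀^∞ x^m e^{-(ε + i/2) x² / 2} y(x) dx` satisfies a first order equation in `ε`, so `ε^P (ε + i)^Q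
L(ε)` is constant. As `ε → ∞` only the initial value of `y` at `0` counts; as `ε → 0` only `C_b`
counts, through a Gamma integral. Comparing the two ends gives `C_b` as an explicit multiple of `1 /
Γ(P)`. The reflection formula then shows that, with the weights of `W`, both parities contribute the
same amount `√(1 + e^{2πa}) / 4` (`weberWeight_sq_mul_norm_connC_sq`).

Second, bounds explicit in `b` (`WeberSol.norm_sq_amp_le`): an energy estimate up to `x = 3 √(1 +
|b|)` and an averaged equation beyond. These bounds and the at most linear growth of the weights
(`exists_weberWeight_le`) are dominated by the exponential weights of the hypotheses on `φ`.

Third, the remainder carries a factor `1 / (a - b)`, and dominated convergence needs a bound uniform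
in `R` and in `b` near `a`. Its derivative in `R` has no such factor; after the addition of the
small term `2 y z' / R²` it is `O(R⁻³)` (`WeberSol.hasDerivAt_remainder_add`), so integration from
`R = 1` gives the bound (`WeberSol.abs_remainder_le`). -/

/-! ### The Riemann–Lebesgue lemma and the Dirichlet integral -/

/-- Riemann–Lebesgue for the character `e^{-2πi v w}`, taken at `w = -l / (2π)`. For non-integrable
`f` the integrals are zero by convention. -/
theorem tendsto_integral_mul_cexp_atTop (f : ℝ → ℂ) :
    Tendsto (fun l : ℝ => ∫ v : ℝ, f v * Complex.exp (Complex.I * ((l * v : ℝ) : ℂ))) atTop (𝓝 0) := by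
  have h := Real.tendsto_integral_exp_smul_cocompact f
  have h2 : Tendsto (fun l : ℝ => l * (-(1 / (2 * π)))) atTop (cocompact ℝ) := by
    have : Tendsto (fun l : ℝ => l * (-(1 / (2 * π)))) atTop atBot :=
      tendsto_id.atTop_mul_const_of_neg (by rw [neg_lt_zero]; positivity)
    exact this.mono_right atBot_le_cocompact
  refine (h.comp h2).congr fun l => ?_
  simp only [Function.comp]
  congr 1
  ext v
  rw [Circle.smul_def, Real.fourierChar_apply, smul_eq_mul, mul_comm]
  congr 2
  have hpi : (π : ℂ) ≠ 0 := by exact_mod_cast Real.pi_ne_zero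
  push_cast
  field_simp

theorem tendsto_integral_mul_sin_atTop (f : ℝ → ℝ) (hf : Integrable f) :
    Tendsto (fun l : ℝ => ∫ v : ℝ, f v * sin (l * v)) atTop (𝓝 0) := by
  have h := tendsto_integral_mul_cexp_atTop (fun v => (f v : ℂ))
  have h2 := (Complex.continuous_im.tendsto 0).comp h
  simp only [Complex.zero_im] at h2
  refine h2.congr fun l => ?_
  simp only [Function.comp]
  have hi : Integrable (fun v : ℝ => (f v : ℂ) * Complex.exp (Complex.I * ((l * v : ℝ) : ℂ))) := by
    refine hf.ofReal.mul_bdd (c := 1) ?_ ?_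
    · exact (by fun_prop : Continuous fun v : ℝ =>
        Complex.exp (Complex.I * ((l * v : ℝ) : ℂ))).aestronglyMeasurable
    · refine ae_of_all _ fun v => ?_
      rw [mul_comm Complex.I, Complex.norm_exp_ofReal_mul_I]
  have := integral_im hi
  simp only [RCLike.im_to_complex] at this
  rw [← this]
  congr 1
  ext v
  rw [Complex.im_ofReal_mul, mul_comm Complex.I, Complex.exp_ofReal_mul_I_im]

theorem integral_exp_neg_mul_cos (l : ℝ) :
    ∫ u in Ioi (0 : ℝ), exp (-u) * cos (l * u) = 1 / (1 + l ^ 2) := by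
  have hl : (1 + l ^ 2) ≠ 0 := by positivity
  have hd : ∀ u : ℝ, HasDerivAt
      (fun u => exp (-u) * (l * sin (l * u) - cos (l * u)) / (1 + l ^ 2))
      (exp (-u) * cos (l * u)) u := by
    intro u
    have h1 : HasDerivAt (fun u : ℝ => exp (-u)) (exp (-u) * (-1)) u := (hasDerivAt_neg u).exp
    have h0 : HasDerivAt (fun u : ℝ => l * u) l u := by simpa using (hasDerivAt_id u).const_mul l
    have h2 := (h0.sin.const_mul l).sub h0.cos
    refine ((h1.mul h2).div_const (1 + l ^ 2)).congr_deriv ?_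
    simp only [Pi.sub_apply]
    field_simp
    ring
  have hint : IntegrableOn (fun u : ℝ => exp (-u) * cos (l * u)) (Ioi 0) := by
    refine (integrableOn_exp_neg_Ioi 0).mul_bdd (c := 1) ?_ ?_
    · exact (by fun_prop : Continuous fun u : ℝ => cos (l * u)).aestronglyMeasurable
    · exact ae_of_all _ fun v => by simpa using abs_cos_le_one (l * v)
  have ht : Tendsto (fun u : ℝ => exp (-u) * (l * sin (l * u) - cos (l * u)) / (1 + l ^ 2))
      atTop (𝓝 0) := by
    have h1 : Tendsto (fun u : ℝ => exp (-u) * (l * sin (l * u) - cos (l * u))) atTop (𝓝 0) := by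
      refine bdd_le_mul_tendsto_zero' (|l| + 1) ?_ ?_ |>.congr fun u => mul_comm _ _
      · exact Eventually.of_forall fun u => by
          calc |l * sin (l * u) - cos (l * u)| ≤ |l * sin (l * u)| + |cos (l * u)| := abs_sub _ _
            _ ≤ |l| * 1 + 1 := by
              rw [abs_mul]; gcongr
              · exact abs_sin_le_one _
              · exact abs_cos_le_one _
            _ = _ := by ring
      · exact tendsto_exp_neg_atTop_nhds_zero
    simpa using h1.div_const (1 + l ^ 2)
  rw [integral_Ioi_of_hasDerivAt_of_tendsto' (fun u _ => hd u) hint ht]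
  simp
  field_simp

theorem abs_sin_mul_div_le (l : ℝ) {u : ℝ} (hu : 0 < u) : |sin (l * u) / u| ≤ |l| := by
  rw [abs_div, abs_of_pos hu, div_le_iff₀ hu]
  calc |sin (l * u)| ≤ |l * u| := abs_sin_le_abs
    _ = |l| * u := by rw [abs_mul, abs_of_pos hu]

theorem integrableOn_exp_neg_mul_sin_div (l : ℝ) :
    IntegrableOn (fun u : ℝ => exp (-u) * (sin (l * u) / u)) (Ioi 0) := by
  refine (integrableOn_exp_neg_Ioi 0).mul_bdd (c := |l|) ?_ ?_
  · exact (by fun_prop : Measurable fun u : ℝ => sin (l * u) / u).aestronglyMeasurable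
  · exact (ae_restrict_iff' measurableSet_Ioi).2 (ae_of_all _ fun v hv => abs_sin_mul_div_le l hv)

/-- Differentiation in `l` under the integral sign gives `1 / (1 + l²)`, the derivative of `arctan`;
both sides vanish at `l = 0`. -/
theorem integral_exp_neg_mul_sin_div (l : ℝ) :
    ∫ u in Ioi (0 : ℝ), exp (-u) * (sin (l * u) / u) = arctan l := by
  have hd : ∀ l : ℝ, HasDerivAt (fun l : ℝ => ∫ u in Ioi (0 : ℝ), exp (-u) * (sin (l * u) / u))
      (1 / (1 + l ^ 2)) l := by
    intro l
    rw [← integral_exp_neg_mul_cos l]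
    refine (hasDerivAt_integral_of_dominated_loc_of_deriv_le (s := univ)
      (μ := volume.restrict (Ioi 0)) (F := fun l u => exp (-u) * (sin (l * u) / u))
      (bound := fun u => exp (-u)) (F' := fun l u => exp (-u) * cos (l * u)) univ_mem ?_
      (integrableOn_exp_neg_mul_sin_div l) ?_ ?_ (integrableOn_exp_neg_Ioi 0) ?_).2
    · exact Eventually.of_forall fun l =>
        (by fun_prop : Measurable fun u : ℝ => exp (-u) * (sin (l * u) / u)).aestronglyMeasurable
    · exact (by fun_prop : Measurable fun u : ℝ => exp (-u) * cos (l * u)).aestronglyMeasurable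
    · refine ae_of_all _ fun u l _ => ?_
      rw [norm_mul, norm_of_nonneg (exp_pos _).le]
      exact mul_le_of_le_one_right (exp_pos _).le (abs_cos_le_one _)
    · refine (ae_restrict_iff' measurableSet_Ioi).2 (ae_of_all _ fun u hu l _ => ?_)
      have hu' : u ≠ 0 := ne_of_gt hu
      have h0 : HasDerivAt (fun l : ℝ => l * u) u l := by simpa using (hasDerivAt_id l).mul_const u
      refine ((h0.sin.div_const u).const_mul (exp (-u))).congr_deriv ?_
      field_simp
  have hc := is_const_of_deriv_eq_zero
    (f := fun l : ℝ => (∫ u in Ioi (0 : ℝ), exp (-u) * (sin (l * u) / u)) - arctan l)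
    (fun l => ((hd l).sub (hasDerivAt_arctan l)).differentiableAt)
    (fun l => by
      have := ((hd l).sub (hasDerivAt_arctan l)).deriv
      rw [sub_self] at this
      exact this)
  have := hc l 0
  simp at this
  linarith

/-- Replace the sharp cutoff at `1` by `e^{-u}`. The difference of the two cutoffs vanishes to first
order at `0`, so its quotient by `u` is integrable and Riemann–Lebesgue removes it. What is left is
`arctan l`. -/
theorem tendsto_integral_sin_mul_div :
    Tendsto (fun l : ℝ => ∫ u in Ioc (0 : ℝ) 1, sin (l * u) / u) atTop (𝓝 (π / 2)) := by
  let f : ℝ → ℝ := (Ioi (0 : ℝ)).indicator fun u => ((Ioc (0 : ℝ) 1).indicator 1 u - exp (-u)) / u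
  have hfm : Measurable f := by
    refine Measurable.indicator ?_ measurableSet_Ioi
    exact ((measurable_one.indicator measurableSet_Ioc).sub (by fun_prop)).div measurable_id
  have hf : Integrable f := by
    have h1 : Integrable ((Ioc (0 : ℝ) 1).indicator 1 : ℝ → ℝ) :=
      (integrable_indicator_iff measurableSet_Ioc).2 (by simp [IntegrableOn, Pi.one_def])
    have h2 : Integrable ((Ioi (0 : ℝ)).indicator fun u => exp (-u)) :=
      (integrable_indicator_iff measurableSet_Ioi).2 (integrableOn_exp_neg_Ioi 0)
    refine (h1.add h2).mono' hfm.aestronglyMeasurable (ae_of_all _ fun u => ?_)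
    by_cases hu : 0 < u
    · have hf : f u = ((Ioc (0 : ℝ) 1).indicator 1 u - exp (-u)) / u :=
        indicator_of_mem (show u ∈ Ioi 0 from hu) _
      rw [hf, Pi.add_apply, indicator_of_mem (show u ∈ Ioi 0 from hu), norm_div,
        Real.norm_eq_abs, Real.norm_eq_abs, abs_of_pos hu, div_le_iff₀ hu]
      by_cases h1 : u ≤ 1
      · rw [indicator_of_mem (show u ∈ Ioc 0 1 from ⟨hu, h1⟩), Pi.one_apply]
        have := add_one_le_exp (-u)
        have h3 : exp (-u) ≤ 1 := exp_le_one_iff.2 (by linarith)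
        rw [abs_of_nonneg (by linarith)]
        nlinarith [exp_pos (-u)]
      · rw [indicator_of_notMem (fun h => h1 h.2)]
        rw [zero_sub, abs_neg, abs_of_pos (exp_pos _), zero_add]
        nlinarith [exp_pos (-u)]
    · have h0 : f u = 0 := indicator_of_notMem (fun h => hu h) _
      rw [h0, norm_zero]
      exact add_nonneg (indicator_nonneg (fun _ _ => zero_le_one) u)
        (indicator_nonneg (fun _ _ => (exp_pos _).le) u)
  have h1 := tendsto_integral_mul_sin_atTop f hf
  have h2 : Tendsto arctan atTop (𝓝 (π / 2)) := tendsto_arctan_atTop.mono_right nhdsWithin_le_nhds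
  have h3 := h1.add h2
  rw [zero_add] at h3
  refine h3.congr fun l => ?_
  rw [← integral_exp_neg_mul_sin_div l, ← integral_indicator measurableSet_Ioc,
    ← integral_indicator measurableSet_Ioi, ← integral_add]
  · congr 1
    ext u
    by_cases hu : 0 < u
    · have hf : f u = ((Ioc (0 : ℝ) 1).indicator 1 u - exp (-u)) / u :=
        indicator_of_mem (show u ∈ Ioi 0 from hu) _
      rw [hf, indicator_of_mem (show u ∈ Ioi 0 from hu)]
      by_cases h1 : u ≤ 1
      · rw [indicator_of_mem (show u ∈ Ioc 0 1 from ⟨hu, h1⟩),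
          indicator_of_mem (show u ∈ Ioc 0 1 from ⟨hu, h1⟩), Pi.one_apply]
        ring
      · rw [indicator_of_notMem (fun h => h1 h.2), indicator_of_notMem (fun h => h1 h.2)]
        ring
    · rw [indicator_of_notMem (show u ∉ Ioi 0 from hu),
        indicator_of_notMem (show u ∉ Ioc 0 1 from fun h => hu h.1)]
      have h0 : f u = 0 := indicator_of_notMem (fun h => hu h) _
      simp [h0]
  · refine hf.mul_bdd (c := 1) ?_ ?_
    · exact (by fun_prop : Measurable fun u : ℝ => sin (l * u)).aestronglyMeasurable
    · exact ae_of_all _ fun u => by simpa using abs_sin_le_one _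
  · exact (integrable_indicator_iff measurableSet_Ioi).2 (integrableOn_exp_neg_mul_sin_div l)

/-! ### Regularity of piecewise continuously differentiable functions -/

namespace PiecewiseC1

/-- The exceptional set is countable, hence null, and `φ` is continuous on its complement. -/
theorem aestronglyMeasurable {φ : ℝ → ℝ} (hφ : PiecewiseC1 φ) :
    AEStronglyMeasurable φ volume := by
  obtain ⟨S, hS, hd, -⟩ := hφ
  have hc : S.Countable := by
    have : S = ⋃ n : ℕ, S ∩ Icc (-(n : ℝ)) n := by
      ext x
      simp only [mem_iUnion, mem_inter_iff, mem_Icc]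
      refine ⟨fun h => ?_, fun ⟨n, h, _⟩ => h⟩
      obtain ⟨n, hn⟩ := exists_nat_ge |x|
      exact ⟨n, h, abs_le.1 hn⟩
    rw [this]
    exact countable_iUnion fun n => (hS _ _).countable
  have hco : ContinuousOn φ Sᶜ := fun x hx => (hd x hx).continuousAt.continuousWithinAt
  have h := hco.aestronglyMeasurable (μ := volume) hc.measurableSet.compl
  rwa [Measure.restrict_eq_self_of_ae_mem (show ∀ᵐ x, x ∈ Sᶜ from hc.ae_notMem volume)] at h

theorem eventually_notMem {S : Set ℝ}
    (hS : ∀ A B : ℝ, (S ∩ Icc A B).Finite) (a : ℝ) : ∀ᶠ x in 𝓝[≠] a, x ∉ S := by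
  have h1 : IsClosed ((S ∩ Icc (a - 1) (a + 1)) \ {a}) := ((hS _ _).sdiff).isClosed
  have h2 : ((S ∩ Icc (a - 1) (a + 1)) \ {a})ᶜ ∈ 𝓝 a :=
    h1.isOpen_compl.mem_nhds (fun h => h.2 rfl)
  have h3 : Icc (a - 1) (a + 1) ∈ 𝓝 a := Icc_mem_nhds (by linarith) (by linarith)
  filter_upwards [mem_nhdsWithin_of_mem_nhds h2, mem_nhdsWithin_of_mem_nhds h3,
    self_mem_nhdsWithin] with x hx2 hx3 hx hxS
  exact hx2 ⟨⟨hxS, hx3⟩, hx⟩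

theorem one_sided {φ : ℝ → ℝ} (hφ : PiecewiseC1 φ) (a : ℝ) :
    (∃ l, Tendsto φ (𝓝[<] a) (𝓝 l)) ∧ (∃ l, Tendsto φ (𝓝[>] a) (𝓝 l)) ∧
      (∃ l, Tendsto (deriv φ) (𝓝[<] a) (𝓝 l)) ∧ (∃ l, Tendsto (deriv φ) (𝓝[>] a) (𝓝 l)) ∧
      ∀ᶠ x in 𝓝[≠] a, DifferentiableAt ℝ φ x := by
  obtain ⟨S, hS, hd, hl⟩ := hφ
  have he : ∀ᶠ x in 𝓝[≠] a, DifferentiableAt ℝ φ x :=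
    (eventually_notMem hS a).mono fun x hx => (hd x hx).differentiableAt one_ne_zero
  by_cases ha : a ∈ S
  · obtain ⟨h1, h2, h3, h4⟩ := hl a ha
    exact ⟨h1, h2, h3, h4, he⟩
  · have h1 := (hd a ha).continuousAt.tendsto
    have h2 : Tendsto (deriv φ) (𝓝 a) (𝓝 (deriv φ a)) :=
      (ContDiffAt.derivWithin (m := 0) (hd a ha) (by simp)).continuousAt.tendsto
    exact ⟨⟨_, h1.mono_left nhdsWithin_le_nhds⟩, ⟨_, h1.mono_left nhdsWithin_le_nhds⟩,
      ⟨_, h2.mono_left nhdsWithin_le_nhds⟩, ⟨_, h2.mono_left nhdsWithin_le_nhds⟩, he⟩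

/-- The one-sided limits bound `φ` on a punctured neighbourhood of each point, and the value at the
point itself is added to the bound; compactness does the rest. -/
theorem exists_bound {φ : ℝ → ℝ} (hφ : PiecewiseC1 φ) (A B : ℝ) :
    ∃ K, ∀ x ∈ Icc A B, |φ x| ≤ K := by
  have hloc : ∀ x : ℝ, ∃ K, ∀ᶠ y in 𝓝 x, |φ y| ≤ K := by
    intro x
    obtain ⟨⟨l1, h1⟩, ⟨l2, h2⟩, -⟩ := hφ.one_sided x
    have e1 := h1.abs.eventually_le_const (lt_add_one |l1|)
    have e2 := h2.abs.eventually_le_const (lt_add_one |l2|)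
    refine ⟨max (max (|l1| + 1) (|l2| + 1)) |φ x|, ?_⟩
    rw [← nhdsNE_sup_pure x, ← nhdsLT_sup_nhdsGT x]
    refine eventually_sup.2 ⟨eventually_sup.2 ⟨e1.mono fun y hy => ?_, e2.mono fun y hy => ?_⟩, ?_⟩
    · exact hy.trans ((le_max_left _ _).trans (le_max_left _ _))
    · exact hy.trans ((le_max_right _ _).trans (le_max_left _ _))
    · exact eventually_pure.2 (le_max_right _ _)
  refine isCompact_Icc.induction_on (p := fun s => ∃ K, ∀ x ∈ s, |φ x| ≤ K) ⟨0, by simp⟩ ?_ ?_ ?_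
  · rintro s t hst ⟨K, hK⟩
    exact ⟨K, fun x hx => hK x (hst hx)⟩
  · rintro s t ⟨K, hK⟩ ⟨L, hL⟩
    refine ⟨max K L, ?_⟩
    rintro x (hx | hx)
    · exact (hK x hx).trans (le_max_left _ _)
    · exact (hL x hx).trans (le_max_right _ _)
  · intro x _
    obtain ⟨K, hK⟩ := hloc x
    exact ⟨_, mem_nhdsWithin_of_mem_nhds hK, K, fun y hy => hy⟩

end PiecewiseC1

/-- The mean value inequality between two points of `s`, one of which then tends to `a`. The point
`a` need not lie in `s`, so the one-sided limit `l` takes the place of `f a`. -/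
theorem abs_sub_le_of_deriv_le_of_tendsto {f : ℝ → ℝ} {s : Set ℝ} (hs : Convex ℝ s) {a l K : ℝ}
    [(𝓝[s] a).NeBot] (hl : Tendsto f (𝓝[s] a) (𝓝 l)) (hd : ∀ x ∈ s, DifferentiableAt ℝ f x)
    (hK : ∀ x ∈ s, |deriv f x| ≤ K) {x : ℝ} (hx : x ∈ s) : |f x - l| ≤ K * |x - a| := by
  have h1 : Tendsto (fun y => |f x - f y|) (𝓝[s] a) (𝓝 |f x - l|) := (tendsto_const_nhds.sub hl).abs
  have h2 : Tendsto (fun y => K * |x - y|) (𝓝[s] a) (𝓝 (K * |x - a|)) :=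
    (by fun_prop : Continuous fun y : ℝ => K * |x - y|).continuousAt.tendsto.mono_left
      nhdsWithin_le_nhds
  refine le_of_tendsto_of_tendsto h1 h2 ?_
  filter_upwards [self_mem_nhdsWithin] with y hy
  exact hs.norm_image_sub_le_of_norm_deriv_le hd hK hy hx

namespace PiecewiseC1

/-- The derivative is bounded on some `(a, c)`, which gives the Lipschitz bound there. Farther away
the distance to `a` is at least `c - a`, and boundedness of `φ` suffices. This is the Dini condition
at the jump. -/
theorem exists_right {φ : ℝ → ℝ} (hφ : PiecewiseC1 φ) (a : ℝ) :
    ∃ K, ∀ x ∈ Ioc a (a + 1), |φ x - Function.rightLim φ a| ≤ K * |x - a| := by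
  obtain ⟨-, ⟨l, hl⟩, -, ⟨d, hd⟩, he⟩ := hφ.one_sided a
  rw [rightLim_eq_of_tendsto hl]
  have e1 := hd.abs.eventually_le_const (lt_add_one |d|)
  have e2 : ∀ᶠ x in 𝓝[>] a, DifferentiableAt ℝ φ x :=
    he.filter_mono (nhdsWithin_mono a fun x hx => ne_of_gt hx)
  obtain ⟨c, hac, hc⟩ := mem_nhdsGT_iff_exists_Ioo_subset.1 (e1.and e2)
  have hac' : a < c := hac
  obtain ⟨M, hM⟩ := hφ.exists_bound a (a + 1)
  have : (𝓝[Ioo a c] a).NeBot := by rw [nhdsWithin_Ioo_eq_nhdsGT hac']; infer_instance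
  have hca : 0 < c - a := by linarith
  have hM0 : 0 ≤ M := (abs_nonneg _).trans (hM a ⟨le_rfl, by linarith⟩)
  refine ⟨max (|d| + 1) ((M + |l|) / (c - a)), fun x hx => ?_⟩
  by_cases hxc : x < c
  · refine (abs_sub_le_of_deriv_le_of_tendsto (convex_Ioo a c)
      (by rwa [nhdsWithin_Ioo_eq_nhdsGT hac']) (fun y hy => (hc hy).2) (fun y hy => (hc hy).1)
      ⟨hx.1, hxc⟩).trans ?_
    gcongr
    exact le_max_left _ _
  · have hxa : c - a ≤ |x - a| := by rw [abs_of_pos (by linarith [hx.1])]; linarith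
    calc |φ x - l| ≤ |φ x| + |l| := abs_sub _ _
      _ ≤ M + |l| := by gcongr; exact hM x ⟨hx.1.le, hx.2⟩
      _ = (M + |l|) / (c - a) * (c - a) := by field_simp
      _ ≤ (M + |l|) / (c - a) * |x - a| := by gcongr
      _ ≤ _ := by gcongr; exact le_max_right _ _

theorem exists_left {φ : ℝ → ℝ} (hφ : PiecewiseC1 φ) (a : ℝ) :
    ∃ K, ∀ x ∈ Ico (a - 1) a, |φ x - Function.leftLim φ a| ≤ K * |x - a| := by
  obtain ⟨⟨l, hl⟩, -, ⟨d, hd⟩, -, he⟩ := hφ.one_sided a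
  rw [leftLim_eq_of_tendsto hl]
  have e1 := hd.abs.eventually_le_const (lt_add_one |d|)
  have e2 : ∀ᶠ x in 𝓝[<] a, DifferentiableAt ℝ φ x :=
    he.filter_mono (nhdsWithin_mono a fun x hx => ne_of_lt hx)
  obtain ⟨c, hac, hc⟩ := mem_nhdsLT_iff_exists_Ioo_subset.1 (e1.and e2)
  have hac' : c < a := hac
  obtain ⟨M, hM⟩ := hφ.exists_bound (a - 1) a
  have : (𝓝[Ioo c a] a).NeBot := by rw [nhdsWithin_Ioo_eq_nhdsLT hac']; infer_instance
  have hca : 0 < a - c := by linarith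
  have hM0 : 0 ≤ M := (abs_nonneg _).trans (hM a ⟨by linarith, le_rfl⟩)
  refine ⟨max (|d| + 1) ((M + |l|) / (a - c)), fun x hx => ?_⟩
  by_cases hxc : c < x
  · refine (abs_sub_le_of_deriv_le_of_tendsto (convex_Ioo c a)
      (by rwa [nhdsWithin_Ioo_eq_nhdsLT hac']) (fun y hy => (hc hy).2) (fun y hy => (hc hy).1)
      ⟨hxc, hx.2⟩).trans ?_
    gcongr
    exact le_max_left _ _
  · have hxa : a - c ≤ |x - a| := by rw [abs_of_neg (by linarith [hx.2])]; linarith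
    calc |φ x - l| ≤ |φ x| + |l| := abs_sub _ _
      _ ≤ M + |l| := by gcongr; exact hM x ⟨hx.1, hx.2.le⟩
      _ = (M + |l|) / (a - c) * (a - c) := by field_simp
      _ ≤ (M + |l|) / (a - c) * |x - a| := by gcongr
      _ ≤ _ := by gcongr; exact le_max_right _ _

end PiecewiseC1

/-! ### The Dirichlet kernel at a jump -/

theorem integral_indicator_right_mul_sin_div (a l : ℝ) :
    ∫ b, (Ioc a (a + 1)).indicator 1 b * (sin (l * (a - b)) / (a - b))
      = ∫ u in Ioc (0 : ℝ) 1, sin (l * u) / u := by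
  rw [← integral_indicator measurableSet_Ioc,
    ← integral_sub_right_eq_self ((Ioc (0 : ℝ) 1).indicator fun u => sin (l * u) / u) a]
  congr 1
  ext b
  by_cases h : b ∈ Ioc a (a + 1)
  · rw [indicator_of_mem h, indicator_of_mem (show b - a ∈ Ioc (0 : ℝ) 1 from
      ⟨by linarith [h.1], by linarith [h.2]⟩), ← neg_sub b a, mul_neg, sin_neg, neg_div_neg_eq]
    simp
  · rw [indicator_of_notMem h, indicator_of_notMem (show b - a ∉ Ioc (0 : ℝ) 1 from
      fun h' => h ⟨by linarith [h'.1], by linarith [h'.2]⟩)]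
    simp

theorem integral_indicator_left_mul_sin_div (a l : ℝ) :
    ∫ b, (Ico (a - 1) a).indicator 1 b * (sin (l * (a - b)) / (a - b))
      = ∫ u in Ioc (0 : ℝ) 1, sin (l * u) / u := by
  rw [← integral_indicator measurableSet_Ioc,
    ← integral_sub_left_eq_self ((Ioc (0 : ℝ) 1).indicator fun u => sin (l * u) / u) volume a]
  congr 1
  ext b
  by_cases h : b ∈ Ico (a - 1) a
  · rw [indicator_of_mem h, indicator_of_mem (show a - b ∈ Ioc (0 : ℝ) 1 from
      ⟨by linarith [h.2], by linarith [h.1]⟩)]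
    simp
  · rw [indicator_of_notMem h, indicator_of_notMem (show a - b ∉ Ioc (0 : ℝ) 1 from
      fun h' => h ⟨by linarith [h'.2], by linarith [h'.1]⟩)]
    simp

theorem integrable_indicator_mul_sin_div (a l : ℝ) {s : Set ℝ} (hs : MeasurableSet s)
    (hs' : s ⊆ Icc (a - 1) (a + 1)) :
    Integrable fun b => s.indicator 1 b * (sin (l * (a - b)) / (a - b)) := by
  have h : Integrable (s.indicator 1 : ℝ → ℝ) := (integrable_indicator_iff hs).2 (by
    simp only [Pi.one_def]
    exact integrableOn_const (ne_top_of_le_ne_top (by simp) (measure_mono hs')))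
  refine h.mul_bdd (c := |l|) ?_ (ae_of_all _ fun b => ?_)
  · exact (by fun_prop : Measurable fun b : ℝ => sin (l * (a - b)) / (a - b)).aestronglyMeasurable
  · rcases lt_trichotomy (a - b) 0 with h | h | h
    · rw [← neg_div_neg_eq, ← sin_neg, ← mul_neg]
      exact abs_sin_mul_div_le l (by linarith)
    · simp [h]
    · exact abs_sin_mul_div_le l h

/-- The difference quotient at `a`, completed by the derivative, is continuous on a compact
interval. -/
theorem exists_bound_sub_of_differentiableAt {V : ℝ → ℂ} {a : ℝ} (hV : Continuous V)
    (hVd : DifferentiableAt ℝ V a) :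
    ∃ M, ∀ b ∈ Icc (a - 1) (a + 1), ‖V b - V a‖ ≤ M * |b - a| := by
  have hnhds : Icc (a - 1) (a + 1) ∈ 𝓝 a := Icc_mem_nhds (by linarith) (by linarith)
  have hc : ContinuousOn (dslope V a) (Icc (a - 1) (a + 1)) :=
    (continuousOn_dslope hnhds).2 ⟨hV.continuousOn, hVd⟩
  obtain ⟨M, hM⟩ := isCompact_Icc.exists_bound_of_continuousOn hc
  refine ⟨M, fun b hb => ?_⟩
  rw [← sub_smul_dslope V a b, norm_smul, mul_comm, Real.norm_eq_abs]
  gcongr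
  exact hM b hb

/-- Localization of the Dirichlet kernel at a point where `φ` may jump and the amplitude `V` is
real. -/
theorem tendsto_integral_dirichlet {a : ℝ} {φ : ℝ → ℝ} (hφ : PiecewiseC1 φ) {V : ℝ → ℂ}
    (hV : Continuous V) (hVd : DifferentiableAt ℝ V a) (hVa : (V a).im = 0)
    (hint : Integrable fun b => |φ b| * ‖V b‖) :
    (∀ l : ℝ, Integrable fun b : ℝ =>
      φ b * ((V b * Complex.exp (Complex.I * ((l * (a - b) : ℝ) : ℂ))).im / (a - b))) ∧
    Tendsto (fun l : ℝ => ∫ b : ℝ,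
      φ b * ((V b * Complex.exp (Complex.I * ((l * (a - b) : ℝ) : ℂ))).im / (a - b))) atTop
      (𝓝 (π / 2 * (V a).re * (Function.leftLim φ a + Function.rightLim φ a))) := by
  obtain ⟨Kl, hKl⟩ := hφ.exists_left a
  obtain ⟨Kr, hKr⟩ := hφ.exists_right a
  obtain ⟨M, hM⟩ := exists_bound_sub_of_differentiableAt hV hVd
  obtain ⟨N, hN⟩ := isCompact_Icc.exists_bound_of_continuousOn
    (hV.continuousOn (s := Icc (a - 1) (a + 1)))
  set p := Function.leftLim φ a
  set q := Function.rightLim φ a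
  set c := (V a).re with hc
  have hVac : V a = (c : ℂ) := Complex.ext rfl (by simp [hVa])
  let X : ℝ → ℝ := (Ioc a (a + 1)).indicator 1
  let Z : ℝ → ℝ := (Ico (a - 1) a).indicator 1
  -- From `φ V` a step function is subtracted that equals `V(a)` times the one-sided limit of `φ` on
  -- each unit interval next to `a`. The numerator is then `O(|b - a|)` there, so `F` is integrable
  -- and Riemann–Lebesgue applies to it; the step function contributes two half Dirichlet integrals.
  let F : ℝ → ℂ := fun b => (φ b * V b - c * (q * X b + p * Z b)) / ((a - b : ℝ) : ℂ)
  have hXm : Measurable X := measurable_one.indicator measurableSet_Ioc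
  have hZm : Measurable Z := measurable_one.indicator measurableSet_Ico
  have hFm : AEStronglyMeasurable F volume := by
    refine AEStronglyMeasurable.div₀ ?_ (by fun_prop)
    refine ((Complex.continuous_ofReal.comp_aestronglyMeasurable hφ.aestronglyMeasurable).mul
      hV.aestronglyMeasurable).sub ?_
    exact (by fun_prop : Measurable fun b : ℝ =>
      (c : ℂ) * (q * X b + p * Z b)).aestronglyMeasurable
  have key : ∀ (K w b : ℝ), |φ b - w| ≤ K * |b - a| → b ∈ Icc (a - 1) (a + 1) → b ≠ a →
      ‖(φ b * V b - c * w) / ((a - b : ℝ) : ℂ)‖ ≤ |K| * N + |w| * M := by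
    intro K w b h1 hb hne
    have hpos : 0 < |b - a| := abs_pos.2 (sub_ne_zero.2 hne)
    rw [norm_div, Complex.norm_real, Real.norm_eq_abs, abs_sub_comm a b, div_le_iff₀ hpos]
    have e : (φ b * V b - c * w : ℂ) = ((φ b - w : ℝ) : ℂ) * V b + (w : ℂ) * (V b - V a) := by
      rw [hVac]; push_cast; ring
    rw [e]
    refine (norm_add_le _ _).trans ?_
    rw [norm_mul, norm_mul, Complex.norm_real, Complex.norm_real, Real.norm_eq_abs,
      Real.norm_eq_abs]
    have h2 : |φ b - w| ≤ |K| * |b - a| := h1.trans (by gcongr; exact le_abs_self K)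
    calc _ ≤ |K| * |b - a| * N + |w| * (M * |b - a|) := by
          gcongr
          · exact hN b hb
          · exact hM b hb
      _ = _ := by ring
  have hFint : Integrable F := by
    set D := |Kl| * N + |p| * M + (|Kr| * N + |q| * M) with hD
    have hM0 : 0 ≤ M := by
      have := hM (a + 1) ⟨by linarith, le_rfl⟩
      simp only [add_sub_cancel_left, abs_one, mul_one] at this
      exact (norm_nonneg _).trans this
    have hN0 : 0 ≤ N := (norm_nonneg _).trans (hN a ⟨by linarith, by linarith⟩)
    have h1 : Integrable ((Icc (a - 1) (a + 1)).indicator fun _ => D : ℝ → ℝ) :=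
      (integrable_indicator_iff measurableSet_Icc).2 (integrableOn_const (by simp))
    refine (h1.add hint).mono' hFm (ae_of_all _ fun b => ?_)
    have hn : 0 ≤ |φ b| * ‖V b‖ := by positivity
    rw [Pi.add_apply]
    by_cases hb : b ∈ Icc (a - 1) (a + 1)
    · rw [indicator_of_mem hb]
      refine le_trans ?_ (le_add_of_nonneg_right hn)
      rcases lt_trichotomy b a with h | h | h
      · have hx : X b = 0 := indicator_of_notMem (fun h' => by linarith [h'.1]) _
        have hz : Z b = 1 := indicator_of_mem (show b ∈ Ico (a - 1) a from ⟨hb.1, h⟩) _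
        have := key Kl p b (hKl b ⟨hb.1, h⟩) hb h.ne
        simp only [F, hx, hz]
        refine le_trans (le_of_eq ?_) (this.trans ?_)
        · congr 2; push_cast; ring
        · rw [hD]; exact le_add_of_nonneg_right (by positivity)
      -- At `b = a` the quotient is zero by the convention on division by zero.
      · simp only [F, h, sub_self, Complex.ofReal_zero, div_zero, norm_zero]
        positivity
      · have hx : X b = 1 := indicator_of_mem (show b ∈ Ioc a (a + 1) from ⟨h, hb.2⟩) _
        have hz : Z b = 0 := indicator_of_notMem (fun h' => by linarith [h'.2]) _
        have := key Kr q b (hKr b ⟨h, hb.2⟩) hb h.ne'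
        simp only [F, hx, hz]
        refine le_trans (le_of_eq ?_) (this.trans ?_)
        · congr 2; push_cast; ring
        · rw [hD]; exact le_add_of_nonneg_left (by positivity)
    · rw [indicator_of_notMem hb, zero_add]
      have hx : X b = 0 :=
        indicator_of_notMem (fun h' => hb ⟨by linarith [h'.1], by linarith [h'.2]⟩) _
      have hz : Z b = 0 :=
        indicator_of_notMem (fun h' => hb ⟨by linarith [h'.1], by linarith [h'.2]⟩) _
      have h1 : 1 ≤ |a - b| := by
        by_contra h'
        rw [not_le, abs_lt] at h'
        exact hb ⟨by linarith, by linarith⟩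
      simp only [F, hx, hz]
      rw [norm_div, Complex.norm_real, Real.norm_eq_abs, div_le_iff₀ (by linarith)]
      simp only [Complex.ofReal_zero, mul_zero, add_zero, sub_zero, norm_mul, Complex.norm_real,
        Real.norm_eq_abs]
      exact le_mul_of_one_le_right hn h1
  have hEint : ∀ l : ℝ, Integrable fun b : ℝ =>
      F b * Complex.exp (Complex.I * ((l * (a - b) : ℝ) : ℂ)) := by
    intro l
    refine hFint.mul_bdd (c := 1) ?_ (ae_of_all _ fun b => ?_)
    · exact (by fun_prop : Continuous fun b : ℝ =>
        Complex.exp (Complex.I * ((l * (a - b) : ℝ) : ℂ))).aestronglyMeasurable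
    · rw [mul_comm Complex.I, Complex.norm_exp_ofReal_mul_I]
  have hX : ∀ l : ℝ, Integrable fun b : ℝ => c * q * (X b * (sin (l * (a - b)) / (a - b))) :=
    fun l => (integrable_indicator_mul_sin_div a l measurableSet_Ioc
      (Ioc_subset_Icc_self.trans (Icc_subset_Icc (by linarith) le_rfl))).const_mul _
  have hZ : ∀ l : ℝ, Integrable fun b : ℝ => c * p * (Z b * (sin (l * (a - b)) / (a - b))) :=
    fun l => (integrable_indicator_mul_sin_div a l measurableSet_Ico
      (Ico_subset_Icc_self.trans (Icc_subset_Icc le_rfl (by linarith)))).const_mul _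
  have hEim : ∀ l : ℝ, Integrable fun b : ℝ =>
      (F b * Complex.exp (Complex.I * ((l * (a - b) : ℝ) : ℂ))).im := fun l => (hEint l).im
  -- Since `V(a) = c` is real, the imaginary part of the subtracted term is a pure sine; a non-real
  -- `V(a)` would leave a cosine over `a - b`, which is not integrable at `a`.
  have hdec : ∀ l : ℝ, (fun b : ℝ =>
      φ b * ((V b * Complex.exp (Complex.I * ((l * (a - b) : ℝ) : ℂ))).im / (a - b))) =
      fun b => (F b * Complex.exp (Complex.I * ((l * (a - b) : ℝ) : ℂ))).im
        + c * q * (X b * (sin (l * (a - b)) / (a - b)))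
        + c * p * (Z b * (sin (l * (a - b)) / (a - b))) := by
    intro l
    ext b
    set E := Complex.exp (Complex.I * ((l * (a - b) : ℝ) : ℂ)) with hE
    have hEi : E.im = sin (l * (a - b)) := by
      rw [hE, mul_comm Complex.I, Complex.exp_ofReal_mul_I_im]
    have e1 : F b * E = ((((φ b : ℝ) : ℂ) * (V b * E))
        - ((c * (q * X b + p * Z b) : ℝ) : ℂ) * E) / ((a - b : ℝ) : ℂ) := by
      simp only [F]; push_cast; ring
    rw [e1, Complex.div_ofReal_im, Complex.sub_im, Complex.im_ofReal_mul, Complex.im_ofReal_mul,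
      hEi]
    ring
  refine ⟨fun l => by rw [hdec l]; exact ((hEim l).add (hX l)).add (hZ l), ?_⟩
  have hlim : ∀ l : ℝ, ∫ b : ℝ,
      φ b * ((V b * Complex.exp (Complex.I * ((l * (a - b) : ℝ) : ℂ))).im / (a - b))
      = (∫ b, F b * Complex.exp (Complex.I * ((l * (a - b) : ℝ) : ℂ))).im
        + c * q * (∫ u in Ioc (0 : ℝ) 1, sin (l * u) / u)
        + c * p * (∫ u in Ioc (0 : ℝ) 1, sin (l * u) / u) := by
    intro l
    have hEX : Integrable fun b : ℝ =>
        (F b * Complex.exp (Complex.I * ((l * (a - b) : ℝ) : ℂ))).im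
          + c * q * (X b * (sin (l * (a - b)) / (a - b))) := (hEim l).add (hX l)
    rw [hdec l, integral_add hEX (hZ l), integral_add (hEim l) (hX l),
      integral_const_mul, integral_const_mul, integral_indicator_right_mul_sin_div,
      integral_indicator_left_mul_sin_div]
    congr 2
    exact integral_im (hEint l)
  simp_rw [hlim]
  have hF0 : Tendsto (fun l : ℝ => ∫ b, F b * Complex.exp (Complex.I * ((l * (a - b) : ℝ) : ℂ)))
      atTop (𝓝 0) := by
    refine (tendsto_integral_mul_cexp_atTop fun v => F (a - v)).congr fun l => ?_
    rw [← integral_sub_left_eq_self _ volume a]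
    simp
  have hs := tendsto_integral_sin_mul_div
  have := (((Complex.continuous_im.tendsto 0).comp hF0).add (hs.const_mul (c * q))).add
    (hs.const_mul (c * p))
  refine this.congr' (Eventually.of_forall fun l => rfl) |>.trans (le_of_eq ?_)
  congr 1
  simp only [Complex.zero_im]
  ring

/-! ### Power series of the even and odd solutions -/

noncomputable section

/-- With free coefficients the two families are closed under differentiation: odd series go to even
series with the same coefficients, even series to odd series with shifted coefficients. -/
def evenSeries (c : ℕ → ℝ) (x : ℝ) : ℝ := ∑' n : ℕ, c n * x ^ (2 * n) / ((2 * n).factorial : ℝ)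

def oddSeries (c : ℕ → ℝ) (x : ℝ) : ℝ :=
  ∑' n : ℕ, c n * x ^ (2 * n + 1) / ((2 * n + 1).factorial : ℝ)

theorem factorial_sq_le (n : ℕ) : (n.factorial : ℝ) * n.factorial ≤ ((2 * n).factorial : ℝ) := by
  have h := Nat.le_of_dvd (Nat.factorial_pos _) (Nat.factorial_mul_factorial_dvd_factorial_add n n)
  rw [← two_mul] at h
  exact_mod_cast h

/-- Since `(2n)! ≥ (n!)²`, one factor `n!` absorbs the growth of the coefficients and the other
leaves an exponential series. -/
theorem evenSeries_term_le {c : ℕ → ℝ} {M K : ℝ} (hc : ∀ n, |c n| ≤ M * K ^ n * n.factorial)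
    {x X : ℝ} (hx : |x| ≤ X) (n : ℕ) :
    ‖c n * x ^ (2 * n) / ((2 * n).factorial : ℝ)‖ ≤ M * ((K * X ^ 2) ^ n / n.factorial) := by
  have h1 : (0 : ℝ) < n.factorial := by positivity
  have h2 : (0 : ℝ) < (2 * n).factorial := by positivity
  have h0 : 0 ≤ M * K ^ n := by
    have := (abs_nonneg _).trans (hc n)
    exact nonneg_of_mul_nonneg_left this h1
  rw [norm_div, norm_mul, norm_pow, Real.norm_eq_abs, Real.norm_eq_abs, norm_natCast,
    div_le_iff₀ h2]
  calc |c n| * |x| ^ (2 * n) ≤ (M * K ^ n * n.factorial) * X ^ (2 * n) := by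
        gcongr
        exact hc n
    _ = M * K ^ n * X ^ (2 * n) / n.factorial * (n.factorial * n.factorial) := by
        field_simp
    _ ≤ M * K ^ n * X ^ (2 * n) / n.factorial * (2 * n).factorial := by
        refine mul_le_mul_of_nonneg_left (factorial_sq_le n) (div_nonneg (mul_nonneg h0 ?_) h1.le)
        exact pow_nonneg ((abs_nonneg x).trans hx) _
    _ = _ := by rw [mul_pow, ← pow_mul]; ring

theorem oddSeries_term_le {c : ℕ → ℝ} {M K : ℝ} (hc : ∀ n, |c n| ≤ M * K ^ n * n.factorial)
    {x X : ℝ} (hx : |x| ≤ X) (n : ℕ) :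
    ‖c n * x ^ (2 * n + 1) / ((2 * n + 1).factorial : ℝ)‖ ≤
      M * ((K * X ^ 2) ^ n / n.factorial) * X := by
  have h := evenSeries_term_le hc hx n
  have h2 : (0 : ℝ) < (2 * n).factorial := by positivity
  have h3 : ((2 * n).factorial : ℝ) ≤ (2 * n + 1).factorial := by
    exact_mod_cast Nat.factorial_le (Nat.le_succ _)
  have e : ‖c n * x ^ (2 * n + 1) / ((2 * n + 1).factorial : ℝ)‖ ≤
      ‖c n * x ^ (2 * n) / ((2 * n).factorial : ℝ)‖ * |x| := by
    rw [norm_div, norm_div, norm_mul, norm_mul, norm_pow, norm_pow, Real.norm_eq_abs,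
      Real.norm_eq_abs, norm_natCast, norm_natCast, pow_succ]
    calc |c n| * (|x| ^ (2 * n) * |x|) / ((2 * n + 1).factorial : ℝ)
        ≤ |c n| * (|x| ^ (2 * n) * |x|) / ((2 * n).factorial : ℝ) := by gcongr
      _ = _ := by ring
  exact e.trans (mul_le_mul h hx (abs_nonneg _) ((norm_nonneg _).trans h))

theorem summable_seriesBound (M K X : ℝ) :
    Summable fun n : ℕ => M * ((K * X ^ 2) ^ n / n.factorial) :=
  (Real.summable_pow_div_factorial _).mul_left M

theorem summable_evenSeries {c : ℕ → ℝ} (hc : ∃ M K, ∀ n, |c n| ≤ M * K ^ n * n.factorial)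
    (x : ℝ) : Summable fun n : ℕ => c n * x ^ (2 * n) / ((2 * n).factorial : ℝ) := by
  obtain ⟨M, K, h⟩ := hc
  exact (summable_seriesBound M K |x|).of_norm_bounded fun n => evenSeries_term_le h le_rfl n

theorem summable_oddSeries {c : ℕ → ℝ} (hc : ∃ M K, ∀ n, |c n| ≤ M * K ^ n * n.factorial)
    (x : ℝ) : Summable fun n : ℕ => c n * x ^ (2 * n + 1) / ((2 * n + 1).factorial : ℝ) := by
  obtain ⟨M, K, h⟩ := hc
  exact ((summable_seriesBound M K |x|).mul_right |x|).of_norm_bounded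
    fun n => oddSeries_term_le h le_rfl n

/-- The extra factor `n + 1` of `(n + 1)!` is at most `2 ^ n`, which doubles `K`. -/
theorem exists_coeffBound_succ {c : ℕ → ℝ} (hc : ∃ M K, ∀ n, |c n| ≤ M * K ^ n * n.factorial) :
    ∃ M K, ∀ n, |c (n + 1)| ≤ M * K ^ n * n.factorial := by
  obtain ⟨M, K, h⟩ := hc
  refine ⟨|M * K|, |2 * K|, fun n => (h (n + 1)).trans ?_⟩
  have h2 : ((n : ℝ) + 1) ≤ 2 ^ n := by exact_mod_cast Nat.lt_two_pow_self
  rw [Nat.factorial_succ]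
  push_cast
  calc M * K ^ (n + 1) * ((n + 1) * n.factorial) ≤ |M * K ^ (n + 1)| * ((n + 1) * n.factorial) := by
        gcongr; exact le_abs_self _
    _ ≤ |M * K ^ (n + 1)| * (2 ^ n * n.factorial) := by gcongr
    _ = _ := by rw [abs_mul, abs_mul, abs_mul, abs_pow, abs_two]; ring

theorem hasDerivAt_oddSeries {c : ℕ → ℝ} (hc : ∃ M K, ∀ n, |c n| ≤ M * K ^ n * n.factorial)
    (x : ℝ) : HasDerivAt (oddSeries c) (evenSeries c x) x := by
  have hs := summable_oddSeries hc 0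
  obtain ⟨M, K, h⟩ := hc
  refine hasDerivAt_tsum_of_isPreconnected (summable_seriesBound M K (|x| + 1))
    (t := Metric.ball 0 (|x| + 1)) Metric.isOpen_ball (convex_ball _ _).isPreconnected
    (g := fun n x => c n * x ^ (2 * n + 1) / ((2 * n + 1).factorial : ℝ))
    (g' := fun n x => c n * x ^ (2 * n) / ((2 * n).factorial : ℝ)) (y₀ := 0)
    (fun n y _ => ?_) (fun n y hy => ?_) (by simp; positivity) hs (by simp)
  · refine (((hasDerivAt_pow (2 * n + 1) y).const_mul (c n)).div_const _).congr_deriv ?_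
    rw [Nat.factorial_succ]
    push_cast
    field_simp
  · exact evenSeries_term_le h (by simpa using (mem_ball_zero_iff.1 hy).le) n

theorem evenSeries_eq {c : ℕ → ℝ} (hc : ∃ M K, ∀ n, |c n| ≤ M * K ^ n * n.factorial) (x : ℝ) :
    evenSeries c x =
      c 0 + ∑' n : ℕ, c (n + 1) * x ^ (2 * (n + 1)) / ((2 * (n + 1)).factorial : ℝ) := by
  rw [evenSeries, (summable_evenSeries hc x).tsum_eq_zero_add]
  simp

theorem oddSeries_eq {c : ℕ → ℝ} (hc : ∃ M K, ∀ n, |c n| ≤ M * K ^ n * n.factorial) (x : ℝ) :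
    oddSeries c x =
      c 0 * x + ∑' n : ℕ, c (n + 1) * x ^ (2 * (n + 1) + 1) / ((2 * (n + 1) + 1).factorial : ℝ) := by
  rw [oddSeries, (summable_oddSeries hc x).tsum_eq_zero_add]
  simp

theorem hasDerivAt_evenSeries {c : ℕ → ℝ} (hc : ∃ M K, ∀ n, |c n| ≤ M * K ^ n * n.factorial)
    (x : ℝ) : HasDerivAt (evenSeries c) (oddSeries (fun n => c (n + 1)) x) x := by
  have hs := (summable_nat_add_iff 1).2 (summable_evenSeries hc 0)
  rw [funext (evenSeries_eq hc)]
  obtain ⟨M, K, h⟩ := exists_coeffBound_succ hc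
  refine HasDerivAt.const_add (c 0) ?_
  refine hasDerivAt_tsum_of_isPreconnected
    ((summable_seriesBound M K (|x| + 1)).mul_right (|x| + 1))
    (t := Metric.ball 0 (|x| + 1)) Metric.isOpen_ball (convex_ball _ _).isPreconnected
    (g := fun n x => c (n + 1) * x ^ (2 * (n + 1)) / ((2 * (n + 1)).factorial : ℝ))
    (g' := fun n x => c (n + 1) * x ^ (2 * n + 1) / ((2 * n + 1).factorial : ℝ)) (y₀ := 0)
    (fun n y _ => ?_) (fun n y hy => ?_) (by simp; positivity) hs (by simp)
  · refine (((hasDerivAt_pow (2 * (n + 1)) y).const_mul (c (n + 1))).div_const _).congr_deriv ?_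
    rw [show 2 * (n + 1) = 2 * n + 1 + 1 by ring, Nat.factorial_succ (2 * n + 1)]
    push_cast
    field_simp
  · exact oddSeries_term_le h (by simpa using (mem_ball_zero_iff.1 hy).le) n

/-- This is Weber's equation read off coefficientwise: multiplying `x^{2n} / (2n)!` by `x² / 4`
gives `(2n + 1)(2n + 2) / 4 = (n + 1)(2n + 1) / 2` times `x^{2n+2} / (2n + 2)!`. -/
theorem evenSeries_succ_eq {a : ℝ} {c : ℕ → ℝ}
    (hc : ∃ M K, ∀ n, |c n| ≤ M * K ^ n * n.factorial) (h1 : c 1 = a * c 0)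
    (hr : ∀ n : ℕ, c (n + 2) = a * c (n + 1) - ((n : ℝ) + 1) * (2 * (n : ℝ) + 1) / 2 * c n)
    (x : ℝ) : evenSeries (fun n => c (n + 1)) x = (a - x ^ 2 / 4) * evenSeries c x := by
  rw [evenSeries_eq (exists_coeffBound_succ hc)]
  have s1 := (summable_nat_add_iff 1).2 (summable_evenSeries hc x)
  have s0 := summable_evenSeries hc x
  have e : ∀ n : ℕ, c (n + 1 + 1) * x ^ (2 * (n + 1)) / ((2 * (n + 1)).factorial : ℝ)
      = a * (c (n + 1) * x ^ (2 * (n + 1)) / ((2 * (n + 1)).factorial : ℝ))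
        - x ^ 2 / 4 * (c n * x ^ (2 * n) / ((2 * n).factorial : ℝ)) := by
    intro n
    rw [hr, show 2 * (n + 1) = 2 * n + 1 + 1 by ring, Nat.factorial_succ (2 * n + 1),
      Nat.factorial_succ (2 * n)]
    push_cast
    field_simp
    ring
  rw [tsum_congr e, (s1.mul_left a).tsum_sub (s0.mul_left _), tsum_mul_left, tsum_mul_left,
    sub_mul, ← evenSeries.eq_1 c x]
  conv_rhs => rw [evenSeries_eq hc]
  simp only [zero_add, h1]
  rw [evenSeries_eq hc]
  ring

theorem oddSeries_succ_eq {a : ℝ} {c : ℕ → ℝ}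
    (hc : ∃ M K, ∀ n, |c n| ≤ M * K ^ n * n.factorial) (h1 : c 1 = a * c 0)
    (hr : ∀ n : ℕ, c (n + 2) = a * c (n + 1) - ((n : ℝ) + 1) * (2 * (n : ℝ) + 3) / 2 * c n)
    (x : ℝ) : oddSeries (fun n => c (n + 1)) x = (a - x ^ 2 / 4) * oddSeries c x := by
  rw [oddSeries_eq (exists_coeffBound_succ hc)]
  have s1 := (summable_nat_add_iff 1).2 (summable_oddSeries hc x)
  have s0 := summable_oddSeries hc x
  have e : ∀ n : ℕ, c (n + 1 + 1) * x ^ (2 * (n + 1) + 1) / ((2 * (n + 1) + 1).factorial : ℝ)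
      = a * (c (n + 1) * x ^ (2 * (n + 1) + 1) / ((2 * (n + 1) + 1).factorial : ℝ))
        - x ^ 2 / 4 * (c n * x ^ (2 * n + 1) / ((2 * n + 1).factorial : ℝ)) := by
    intro n
    rw [hr, show 2 * (n + 1) + 1 = 2 * n + 1 + 1 + 1 by ring, Nat.factorial_succ (2 * n + 1 + 1),
      Nat.factorial_succ (2 * n + 1)]
    push_cast
    field_simp
    ring
  rw [tsum_congr e, (s1.mul_left a).tsum_sub (s0.mul_left _), tsum_mul_left, tsum_mul_left,
    sub_mul, ← oddSeries.eq_1 c x]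
  conv_rhs => rw [oddSeries_eq hc]
  simp only [zero_add, h1]
  rw [oddSeries_eq hc]
  ring

/-- The bound is uniform over `|a| ≤ B`; this makes the series continuous jointly in `(a, x)`. The
induction carries two consecutive terms and closes because `B (1 + B) + (n + 2) ≤ (1 + B)² (n + 2)`.
-/
theorem coeff_le_of_recurrence {a B : ℝ} (ha : |a| ≤ B) {c : ℕ → ℝ} {r : ℕ → ℝ} (h0 : c 0 = 1)
    (h1 : c 1 = a) (hr : ∀ n : ℕ, c (n + 2) = a * c (n + 1) - r n * c n)
    (hr' : ∀ n : ℕ, |r n| ≤ ((n : ℝ) + 1) * (n + 2)) (n : ℕ) :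
    |c n| ≤ 1 * (1 + B) ^ n * n.factorial := by
  have hB : 0 ≤ B := (abs_nonneg a).trans ha
  suffices h : |c n| ≤ 1 * (1 + B) ^ n * n.factorial ∧
      |c (n + 1)| ≤ 1 * (1 + B) ^ (n + 1) * (n + 1).factorial from h.1
  induction n with
  | zero => simp [h0, h1]; linarith
  | succ n ih =>
    refine ⟨ih.2, ?_⟩
    rw [hr]
    have hn : (0 : ℝ) ≤ n := Nat.cast_nonneg n
    calc |a * c (n + 1) - r n * c n| ≤ |a| * |c (n + 1)| + |r n| * |c n| := by
          rw [← abs_mul, ← abs_mul]; exact abs_sub _ _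
      _ ≤ B * (1 * (1 + B) ^ (n + 1) * (n + 1).factorial)
          + (((n : ℝ) + 1) * (n + 2)) * (1 * (1 + B) ^ n * n.factorial) := by
          gcongr
          · exact ih.2
          · exact hr' n
          · exact ih.1
      _ = (B * (1 + B) + (n + 2)) * ((1 + B) ^ n * ((n + 1) * n.factorial)) := by
          rw [Nat.factorial_succ]; push_cast; ring
      _ ≤ ((1 + B) ^ 2 * (n + 2)) * ((1 + B) ^ n * ((n + 1) * n.factorial)) := by
          gcongr
          nlinarith [mul_nonneg hB hn, mul_nonneg (mul_nonneg hB hB) hn, mul_nonneg hB hB]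
      _ = _ := by
          rw [show n + 1 + 1 = n + 2 from rfl, Nat.factorial_succ (n + 1), Nat.factorial_succ n]
          push_cast; ring

theorem weberEvenCoeff_le {a B : ℝ} (ha : |a| ≤ B) (n : ℕ) :
    |weberEvenCoeff a n| ≤ 1 * (1 + B) ^ n * n.factorial := by
  refine coeff_le_of_recurrence ha (by rw [weberEvenCoeff]) (by rw [weberEvenCoeff])
    (fun n => by rw [weberEvenCoeff]) (fun n => ?_) n
  have hn : (0 : ℝ) ≤ n := Nat.cast_nonneg n
  rw [abs_of_nonneg (by positivity)]
  nlinarith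

theorem weberOddCoeff_le {a B : ℝ} (ha : |a| ≤ B) (n : ℕ) :
    |weberOddCoeff a n| ≤ 1 * (1 + B) ^ n * n.factorial := by
  refine coeff_le_of_recurrence ha (by rw [weberOddCoeff]) (by rw [weberOddCoeff])
    (fun n => by rw [weberOddCoeff]) (fun n => ?_) n
  have hn : (0 : ℝ) ≤ n := Nat.cast_nonneg n
  rw [abs_of_nonneg (by positivity)]
  nlinarith

/-- `y` solves `y'' = (b - x ^ 2 / 4) y` and has derivative `y'`. -/
def WeberSol (b : ℝ) (y y' : ℝ → ℝ) : Prop :=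
  (∀ x, HasDerivAt y (y' x) x) ∧ ∀ x, HasDerivAt y' ((b - x ^ 2 / 4) * y x) x

def weberEvenDeriv (a : ℝ) : ℝ → ℝ := oddSeries fun n => weberEvenCoeff a (n + 1)

def weberOddDeriv (a : ℝ) : ℝ → ℝ := evenSeries (weberOddCoeff a)

theorem weberSol_even (a : ℝ) : WeberSol a (weberEven a) (weberEvenDeriv a) := by
  have hc : ∃ M K, ∀ n, |weberEvenCoeff a n| ≤ M * K ^ n * n.factorial :=
    ⟨1, 1 + |a|, weberEvenCoeff_le le_rfl⟩
  refine ⟨fun x => hasDerivAt_evenSeries hc x, fun x => ?_⟩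
  have := hasDerivAt_oddSeries (exists_coeffBound_succ hc) x
  rwa [evenSeries_succ_eq (a := a) hc (by simp [weberEvenCoeff])
    (fun n => by rw [weberEvenCoeff])] at this

theorem weberSol_odd (a : ℝ) : WeberSol a (weberOdd a) (weberOddDeriv a) := by
  have hc : ∃ M K, ∀ n, |weberOddCoeff a n| ≤ M * K ^ n * n.factorial :=
    ⟨1, 1 + |a|, weberOddCoeff_le le_rfl⟩
  refine ⟨fun x => hasDerivAt_oddSeries hc x, fun x => ?_⟩
  have := hasDerivAt_evenSeries hc x
  rwa [oddSeries_succ_eq (a := a) hc (by simp [weberOddCoeff])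
    (fun n => by rw [weberOddCoeff])] at this

theorem evenSeries_zero (c : ℕ → ℝ) : evenSeries c 0 = c 0 := by
  rw [evenSeries, tsum_eq_single 0]
  · simp
  · intro n hn; simp [hn]

theorem oddSeries_zero (c : ℕ → ℝ) : oddSeries c 0 = 0 := by simp [oddSeries]

theorem weberEven_zero (a : ℝ) : weberEven a 0 = 1 := by
  change evenSeries (weberEvenCoeff a) 0 = 1
  rw [evenSeries_zero, weberEvenCoeff]

theorem weberEvenDeriv_zero (a : ℝ) : weberEvenDeriv a 0 = 0 := oddSeries_zero _

theorem weberOdd_zero (a : ℝ) : weberOdd a 0 = 0 := oddSeries_zero _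

theorem weberOddDeriv_zero (a : ℝ) : weberOddDeriv a 0 = 1 := by
  rw [weberOddDeriv, evenSeries_zero, weberOddCoeff]

theorem weberEven_neg (a x : ℝ) : weberEven a (-x) = weberEven a x := by
  simp [weberEven, pow_mul]

theorem weberOdd_neg (a x : ℝ) : weberOdd a (-x) = -weberOdd a x := by
  simp [weberOdd, pow_succ, pow_mul, ← tsum_neg, neg_div]

theorem continuous_weberEvenCoeff (n : ℕ) : Continuous fun a => weberEvenCoeff a n := by
  induction n using Nat.twoStepInduction with
  | zero => simpa only [weberEvenCoeff] using continuous_const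
  | one => simpa only [weberEvenCoeff] using continuous_id'
  | more n h1 h2 => simp only [weberEvenCoeff]; fun_prop

theorem continuous_weberOddCoeff (n : ℕ) : Continuous fun a => weberOddCoeff a n := by
  induction n using Nat.twoStepInduction with
  | zero => simpa only [weberOddCoeff] using continuous_const
  | one => simpa only [weberOddCoeff] using continuous_id'
  | more n h1 h2 => simp only [weberOddCoeff]; fun_prop

theorem continuous_of_continuousOn_ball {f : ℝ × ℝ → ℝ}
    (h : ∀ X : ℝ, ContinuousOn f (Metric.ball 0 X)) : Continuous f :=
  continuous_iff_continuousAt.2 fun p => (h (‖p‖ + 1)).continuousAt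
    (Metric.isOpen_ball.mem_nhds (mem_ball_zero_iff.2 (lt_add_one _)))

theorem continuous_weberEven : Continuous fun p : ℝ × ℝ => weberEven p.1 p.2 := by
  refine continuous_of_continuousOn_ball fun X => ?_
  unfold weberEven
  refine continuousOn_tsum
    (f := fun n (p : ℝ × ℝ) => weberEvenCoeff p.1 n * p.2 ^ (2 * n) / ((2 * n).factorial : ℝ))
    (u := fun n => 1 * (((1 + X) * X ^ 2) ^ n / n.factorial)) (fun n => ?_)
    (summable_seriesBound _ _ _) fun n p hp => ?_
  · have := continuous_weberEvenCoeff n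
    exact Continuous.continuousOn (by fun_prop)
  · have hp' := (mem_ball_zero_iff.1 hp).le
    exact evenSeries_term_le (weberEvenCoeff_le ((norm_fst_le p).trans hp'))
      ((norm_snd_le p).trans hp') n

theorem continuous_weberOdd : Continuous fun p : ℝ × ℝ => weberOdd p.1 p.2 := by
  refine continuous_of_continuousOn_ball fun X => ?_
  unfold weberOdd
  refine continuousOn_tsum
    (f := fun n (p : ℝ × ℝ) =>
      weberOddCoeff p.1 n * p.2 ^ (2 * n + 1) / ((2 * n + 1).factorial : ℝ))
    (u := fun n => 1 * (((1 + X) * X ^ 2) ^ n / n.factorial) * X)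
    (fun n => ?_) ((summable_seriesBound _ _ _).mul_right X) fun n p hp => ?_
  · have := continuous_weberOddCoeff n
    exact Continuous.continuousOn (by fun_prop)
  · have hp' := (mem_ball_zero_iff.1 hp).le
    exact oddSeries_term_le (weberOddCoeff_le ((norm_fst_le p).trans hp'))
      ((norm_snd_le p).trans hp') n


/-! ### Explicit growth bounds and asymptotics at infinity -/

/-- Grönwall: `S e^{-K}` is nonincreasing. -/
theorem le_mul_exp_of_deriv_le {S S' K k : ℝ → ℝ} {s x : ℝ} (hsx : s ≤ x)
    (hS : ∀ t ∈ Icc s x, HasDerivAt S (S' t) t) (hK : ∀ t ∈ Icc s x, HasDerivAt K (k t) t)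
    (h : ∀ t ∈ Icc s x, S' t ≤ k t * S t) : S x ≤ S s * exp (K x - K s) := by
  have hd : ∀ t ∈ Icc s x, HasDerivAt (fun t => S t * exp (-K t))
      (S' t * exp (-K t) + S t * (exp (-K t) * (-k t))) t :=
    fun t ht => (hS t ht).mul (hK t ht).neg.exp
  have hanti : AntitoneOn (fun t => S t * exp (-K t)) (Icc s x) := by
    refine antitoneOn_of_deriv_nonpos (convex_Icc s x)
      (fun t ht => (hd t ht).continuousAt.continuousWithinAt)
      (fun t ht => (hd t (interior_subset ht)).differentiableAt.differentiableWithinAt)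
      fun t ht => ?_
    rw [(hd t (interior_subset ht)).deriv]
    nlinarith [h t (interior_subset ht), exp_pos (-K t)]
  have := hanti ⟨le_rfl, hsx⟩ ⟨hsx, le_rfl⟩ hsx
  simp only at this
  calc S x = S x * exp (-K x) * exp (K x) := by rw [mul_assoc, ← exp_add]; simp
    _ ≤ S s * exp (-K s) * exp (K x) := by gcongr
    _ = _ := by rw [mul_assoc, ← exp_add]; ring_nf

theorem norm_sub_le_of_deriv_le_inv_cube {H H' : ℝ → ℂ} {M : ℝ}
    (hd : ∀ x, 1 ≤ x → HasDerivAt H (H' x) x) (hM : ∀ x, 1 ≤ x → ‖H' x‖ ≤ 2 * M / x ^ 3)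
    {x z : ℝ} (hx : 1 ≤ x) (hxz : x ≤ z) : ‖H z - H x‖ ≤ M / x ^ 2 - M / z ^ 2 := by
  have hB : ∀ t : ℝ, 1 ≤ t → HasDerivAt (fun t => M / x ^ 2 - M / t ^ 2) (2 * M / t ^ 3) t := by
    intro t ht
    have ht0 : t ≠ 0 := by positivity
    have h1 := ((hasDerivAt_pow 2 t).fun_inv (pow_ne_zero 2 ht0)).const_mul M
    refine (h1.const_sub (M / x ^ 2)).congr_deriv ?_
    field_simp
    ring
  refine image_norm_le_of_norm_deriv_right_le_deriv_boundary' (f := fun t => H t - H x)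
    (f' := H') (a := x) (b := z) (B := fun t => M / x ^ 2 - M / t ^ 2)
    (B' := fun t => 2 * M / t ^ 3) ?_ ?_ ?_ ?_ ?_ ?_ ⟨hxz, le_rfl⟩
  · exact fun t ht =>
      ((hd t (hx.trans ht.1)).sub_const _).continuousAt.continuousWithinAt
  · exact fun t ht => ((hd t (hx.trans ht.1)).sub_const _).hasDerivWithinAt
  · simp
  · exact fun t ht => (hB t (hx.trans ht.1)).continuousAt.continuousWithinAt
  · exact fun t ht => (hB t (hx.trans ht.1)).hasDerivWithinAt
  · exact fun t ht => hM t (hx.trans ht.1)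

theorem exists_limit_of_deriv_le_inv_cube {H H' : ℝ → ℂ} {M : ℝ}
    (hd : ∀ x, 1 ≤ x → HasDerivAt H (H' x) x) (hM : ∀ x, 1 ≤ x → ‖H' x‖ ≤ 2 * M / x ^ 3) :
    ∃ C, ∀ x, 1 ≤ x → ‖H x - C‖ ≤ M / x ^ 2 := by
  have hM0 : 0 ≤ M := by
    have := (norm_nonneg _).trans (hM 1 le_rfl)
    norm_num at this
    exact this
  have hle : ∀ x z : ℝ, 1 ≤ x → x ≤ z → ‖H z - H x‖ ≤ M / x ^ 2 := fun x z hx hxz =>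
    (norm_sub_le_of_deriv_le_inv_cube hd hM hx hxz).trans (sub_le_self _ (by positivity))
  have hlim : Tendsto (fun x : ℝ => M / x ^ 2) atTop (𝓝 0) :=
    tendsto_const_nhds.div_atTop (tendsto_pow_atTop two_ne_zero)
  have hmax : Tendsto (fun x : ℝ => max x 1) atTop atTop :=
    tendsto_atTop_mono (fun x => le_max_left x 1) tendsto_id
  -- Nothing is known about `H` to the left of `1`, so it is frozen there.
  have hc : CauchySeq fun x : ℝ => H (max x 1) := by
    refine cauchySeq_of_le_tendsto_0 (fun N => M / (max N 1) ^ 2 + M / (max N 1) ^ 2) ?_ ?_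
    · intro n m N hn hm
      have h1 := hle (max N 1) (max n 1) (le_max_right _ _) (max_le_max_right 1 hn)
      have h2 := hle (max N 1) (max m 1) (le_max_right _ _) (max_le_max_right 1 hm)
      refine (dist_triangle_right _ _ (H (max N 1))).trans ?_
      rw [dist_eq_norm, dist_eq_norm]
      exact add_le_add h1 h2
    · simpa using (hlim.comp hmax).add (hlim.comp hmax)
  obtain ⟨C, hC⟩ := cauchySeq_tendsto_of_complete hc
  refine ⟨C, fun x hx => ?_⟩
  have h1 : Tendsto (fun z : ℝ => ‖H x - H (max z 1)‖) atTop (𝓝 ‖H x - C‖) :=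
    (tendsto_const_nhds.sub hC).norm
  refine le_of_tendsto h1 ?_
  filter_upwards [eventually_ge_atTop x] with z hz
  rw [norm_sub_rev]
  exact hle x _ hx (hz.trans (le_max_left _ _))

/-- The complex amplitude with real part `√x y / 2` and imaginary part `-y' / √x`. -/
def weberAmp (y y' : ℝ → ℝ) (x : ℝ) : ℂ := ⟨√x * y x / 2, -(y' x / √x)⟩

/-- The phase `x ^ 2 / 4 - b log x` of the solutions at infinity. -/
def weberPhase (b x : ℝ) : ℝ := x ^ 2 / 4 - b * log x

/-- Put `β = 1 + |b|`. The energy estimate up to `x = 3 √β` produces `β`, `3 (b + β)` and `9 / 4`;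
the averaged equation beyond it produces `3 β / 8`. The factor `2` covers the loss in passing
between `weberAmp` and `slowAmp`. -/
def weberGrowth (b : ℝ) : ℝ :=
  2 * (1 + |b|) * exp (3 * (b + (1 + |b|)) + 3 / 8 * (1 + |b|) + 9 / 4)

theorem weberGrowth_pos (b : ℝ) : 0 < weberGrowth b := by unfold weberGrowth; positivity

theorem continuous_weberGrowth : Continuous weberGrowth := by unfold weberGrowth; fun_prop

theorem norm_sq_weberAmp (y y' : ℝ → ℝ) {x : ℝ} (hx : 0 < x) :
    ‖weberAmp y y' x‖ ^ 2 = x * y x ^ 2 / 4 + y' x ^ 2 / x := by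
  rw [← Complex.normSq_eq_norm_sq, Complex.normSq_apply, weberAmp]
  have h := Real.mul_self_sqrt hx.le
  have h0 : √x ≠ 0 := (Real.sqrt_pos.2 hx).ne'
  calc _ = (√x * √x) * y x ^ 2 / 4 + y' x ^ 2 / (√x * √x) := by simp only; field_simp; ring
    _ = _ := by rw [h]

namespace WeberSol

variable {b : ℝ} {y y' : ℝ → ℝ}

/-- The energy `S = y'² + (x² / 4 + β) y²`, with `β = 1 + |b|`, has derivative `2 (b + β) y y' + x
y² / 2`, and `2 √β |y y'| ≤ S`. The rate of growth is thus `(b + β) / √β + x / (2β)`, which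
integrates to at most `3 (b + β) + 9 / 4` on the range. For `b ≤ 0` one has `b + β = 1`, so negative
parameters cost no exponential here. -/
theorem energy_le (h : WeberSol b y y') (h0 : y 0 ^ 2 + y' 0 ^ 2 ≤ 1) {x : ℝ} (hx : 0 ≤ x)
    (hx' : x ≤ 3 * √(1 + |b|)) :
    y' x ^ 2 + (x ^ 2 / 4 + (1 + |b|)) * y x ^ 2
      ≤ (1 + |b|) * exp (3 * (b + (1 + |b|)) + 9 / 4) := by
  set β := 1 + |b| with hβ
  have hb0 := abs_nonneg b
  have hβ1 : 1 ≤ β := by linarith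
  have hbβ : 0 ≤ b + β := by linarith [neg_abs_le b]
  have hs : 0 < √β := Real.sqrt_pos.2 (by linarith)
  have hss : √β * √β = β := Real.mul_self_sqrt (by linarith)
  have key := le_mul_exp_of_deriv_le (S := fun x => y' x ^ 2 + (x ^ 2 / 4 + β) * y x ^ 2)
    (S' := fun x => 2 * (b + β) * (y x * y' x) + x / 2 * y x ^ 2)
    (K := fun x => (b + β) / √β * x + x ^ 2 / (4 * β))
    (k := fun x => (b + β) / √β + x / (2 * β)) hx ?_ ?_ ?_
  · refine key.trans ?_
    have e1 : y' 0 ^ 2 + ((0 : ℝ) ^ 2 / 4 + β) * y 0 ^ 2 ≤ β := by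
      nlinarith [sq_nonneg (y' 0), sq_nonneg (y 0)]
    have e2 : (b + β) / √β * x ≤ 3 * (b + β) := by
      rw [div_mul_eq_mul_div, div_le_iff₀ hs]
      nlinarith
    have e3 : x ^ 2 / (4 * β) ≤ 9 / 4 := by
      rw [div_le_iff₀ (by linarith)]
      nlinarith
    refine mul_le_mul e1 (exp_le_exp.2 ?_) (exp_pos _).le (by linarith)
    norm_num
    linarith
  · intro t _
    have h1 := (((hasDerivAt_pow 2 t).div_const 4).add_const β).mul ((h.1 t).pow 2)
    refine (((h.2 t).pow 2).add h1).congr_deriv ?_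
    simp
    ring
  · intro t _
    have h1 := ((hasDerivAt_id t).const_mul ((b + β) / √β)).add
      ((hasDerivAt_pow 2 t).div_const (4 * β))
    refine h1.congr_deriv ?_
    field_simp
    ring
  · intro t ht
    have ht0 : 0 ≤ t := ht.1
    have e1 : 2 * (y t * y' t) ≤ (y' t ^ 2 + (t ^ 2 / 4 + β) * y t ^ 2) / √β := by
      rw [le_div_iff₀ hs]
      have : 0 ≤ t ^ 2 / 4 * y t ^ 2 := by positivity
      nlinarith [sq_nonneg (y' t - √β * y t)]
    have e2 : t / 2 * y t ^ 2 ≤ t / (2 * β) * (y' t ^ 2 + (t ^ 2 / 4 + β) * y t ^ 2) := by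
      have : t / 2 * y t ^ 2 = t / (2 * β) * (β * y t ^ 2) := by field_simp
      rw [this]
      refine mul_le_mul_of_nonneg_left ?_ (by positivity)
      have : 0 ≤ t ^ 2 / 4 * y t ^ 2 := by positivity
      nlinarith [sq_nonneg (y' t)]
    calc 2 * (b + β) * (y t * y' t) + t / 2 * y t ^ 2
        = (b + β) * (2 * (y t * y' t)) + t / 2 * y t ^ 2 := by ring
      _ ≤ (b + β) * ((y' t ^ 2 + (t ^ 2 / 4 + β) * y t ^ 2) / √β) +
          t / (2 * β) * (y' t ^ 2 + (t ^ 2 / 4 + β) * y t ^ 2) := by gcongr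
      _ = _ := by ring

/-- The diagonal coefficient is `i` times the derivative of `weberPhase`. The coupling to the
conjugate has size `1 / x` only, and the conjugate rotates in the opposite sense, so the coupling
averages out. -/
theorem hasDerivAt_amp (h : WeberSol b y y') {x : ℝ} (hx : 0 < x) :
    HasDerivAt (weberAmp y y')
      (Complex.I * ((x / 2 - b / x : ℝ) : ℂ) * weberAmp y y' x
        + (((1 / 2 : ℝ) : ℂ) - Complex.I * b) / x * star (weberAmp y y' x)) x := by
  have hs0 : √x ≠ 0 := (Real.sqrt_pos.2 hx).ne'
  have hss : √x ^ 2 = x := Real.sq_sqrt hx.le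
  have hsq := hasDerivAt_sqrt hx.ne'
  have hre : HasDerivAt (fun x => √x * y x / 2) (√x * y' x / 2 + y x / (4 * √x)) x := by
    refine ((hsq.mul (h.1 x)).div_const 2).congr_deriv ?_
    field_simp
    ring
  have him : HasDerivAt (fun x => -(y' x / √x))
      (-((b - x ^ 2 / 4) * y x / √x) + y' x / (2 * x * √x)) x := by
    refine ((h.2 x).div hsq hs0).neg.congr_deriv ?_
    generalize y x = Y
    generalize y' x = Y'
    generalize √x = s at hs0 hss
    subst hss
    field_simp
    ring
  have h1 := hre.ofReal_comp.add (him.ofReal_comp.mul_const Complex.I)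
  have e : weberAmp y y' =
      fun x => ((√x * y x / 2 : ℝ) : ℂ) + ((-(y' x / √x) : ℝ) : ℂ) * Complex.I := by
    ext t
    rw [← Complex.mk_eq_add_mul_I, weberAmp]
  rw [e]
  refine h1.congr_deriv ?_
  beta_reduce
  rw [← Complex.mk_eq_add_mul_I, ← Complex.mk_eq_add_mul_I]
  generalize y x = Y
  generalize y' x = Y'
  generalize √x = s at hs0 hss
  subst hss
  apply Complex.ext
  · simp [div_eq_mul_inv, ← Complex.ofReal_inv, -Complex.ofReal_pow, -Complex.inv_re,
      -Complex.inv_im, -one_div]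
    field_simp
    ring
  · simp [div_eq_mul_inv, ← Complex.ofReal_inv, -Complex.ofReal_pow, -Complex.inv_re,
      -Complex.inv_im, -one_div]
    field_simp
    ring

theorem norm_weberKappa_le (b : ℝ) : ‖(b : ℂ) + Complex.I * ((1 / 2 : ℝ) : ℂ)‖ ≤ 1 + |b| := by
  refine (norm_add_le _ _).trans ?_
  rw [norm_mul, Complex.norm_I, Complex.norm_real, Complex.norm_real]
  norm_num
  linarith

/-- The amplitude after one averaging step and removal of the phase. -/
def slowAmp (b : ℝ) (y y' : ℝ → ℝ) (x : ℝ) : ℂ :=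
  Complex.exp (-(Complex.I * (weberPhase b x : ℂ))) *
    (weberAmp y y' x - ((b : ℂ) + Complex.I * ((1 / 2 : ℝ) : ℂ)) / (x : ℂ) ^ 2 *
      star (weberAmp y y' x))

theorem norm_exp_neg_phase (r : ℝ) : ‖Complex.exp (-(Complex.I * (r : ℂ)))‖ = 1 := by
  rw [← mul_neg, mul_comm, ← Complex.ofReal_neg, Complex.norm_exp_ofReal_mul_I]

/-- Write `κ = b + i / 2`, so that the coupling is `-(i κ / x) conj g`. To leading order `conj g`
rotates at the rate `-i x / 2`, and so does the removed phase factor; the derivative of `-(κ / x²)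
conj g` therefore supplies `+(i κ / x) conj g`. The `1 / x` terms cancel, and what remains carries
`x⁻³`. -/
theorem hasDerivAt_slowAmp (h : WeberSol b y y') {x : ℝ} (hx : 0 < x) :
    ∃ d, HasDerivAt (slowAmp b y y') d x ∧
      ‖d‖ ≤ 3 * (1 + |b|) ^ 2 * ‖weberAmp y y' x‖ / x ^ 3 := by
  have hx0 : (x : ℂ) ≠ 0 := by exact_mod_cast hx.ne'
  obtain ⟨κ, hκ⟩ : ∃ κ, κ = (b : ℂ) + Complex.I * ((1 / 2 : ℝ) : ℂ) := ⟨_, rfl⟩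
  obtain ⟨m, hm⟩ : ∃ m, m = star (((1 / 2 : ℝ) : ℂ) - Complex.I * b) := ⟨_, rfl⟩
  have hmκ : ((1 / 2 : ℝ) : ℂ) - Complex.I * b = -(Complex.I * κ) := by
    rw [hκ, mul_add, ← mul_assoc, Complex.I_mul_I]; ring
  have hκn : ‖κ‖ ≤ 1 + |b| := hκ ▸ norm_weberKappa_le b
  have hmn : ‖m‖ ≤ 1 + |b| := by
    rw [hm, norm_star, hmκ, norm_neg, norm_mul, Complex.norm_I, one_mul]; exact hκn
  have hθ : HasDerivAt (weberPhase b) (x / 2 - b / x) x := by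
    refine (((hasDerivAt_pow 2 x).div_const 4).sub
      ((hasDerivAt_log hx.ne').const_mul b)).congr_deriv ?_
    simp
    ring
  have hE : HasDerivAt (fun x : ℝ => Complex.exp (-(Complex.I * (weberPhase b x : ℂ))))
      (Complex.exp (-(Complex.I * (weberPhase b x : ℂ))) *
        (-(Complex.I * ((x / 2 - b / x : ℝ) : ℂ)))) x :=
    (hθ.ofReal_comp.const_mul Complex.I).neg.cexp
  have hg := h.hasDerivAt_amp hx
  have hgs := hg.star
  have hx2 : HasDerivAt (fun x : ℝ => κ / (x : ℂ) ^ 2) (-(2 * κ / (x : ℂ) ^ 3)) x := by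
    have h1 := (((hasDerivAt_id x).ofReal_comp.pow 2).fun_inv (pow_ne_zero 2 hx0)).const_mul κ
    refine h1.congr_deriv ?_
    simp
    field_simp
  have hd := hE.mul (hg.sub (hx2.mul hgs))
  refine ⟨Complex.exp (-(Complex.I * (weberPhase b x : ℂ))) *
    ((2 * (1 - Complex.I * b) * κ * star (weberAmp y y' x) - κ * m * weberAmp y y' x)
      / (x : ℂ) ^ 3), ?_, ?_⟩
  · have e : slowAmp b y y' = fun x : ℝ => Complex.exp (-(Complex.I * (weberPhase b x : ℂ))) *
        (weberAmp y y' x - κ / (x : ℂ) ^ 2 * star (weberAmp y y' x)) := by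
      rw [hκ]; rfl
    rw [e]
    refine hd.congr_deriv ?_
    have e2 : star (Complex.I * ((x / 2 - b / x : ℝ) : ℂ) * weberAmp y y' x
        + (((1 / 2 : ℝ) : ℂ) - Complex.I * b) / x * star (weberAmp y y' x))
        = -(Complex.I * ((x / 2 - b / x : ℝ) : ℂ)) * star (weberAmp y y' x)
          + m / x * weberAmp y y' x := by
      rw [star_add, star_mul', star_mul', star_mul', star_star, star_div₀, ← hm]
      simp
    rw [e2, hmκ]
    simp only [Pi.sub_apply, Pi.mul_apply]
    push_cast
    generalize star (weberAmp y y' x) = G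
    generalize weberAmp y y' x = g
    field_simp
    ring
  · rw [norm_mul, norm_exp_neg_phase, one_mul, norm_div, norm_pow, Complex.norm_real,
      Real.norm_eq_abs, abs_of_pos hx]
    gcongr
    refine (norm_sub_le _ _).trans ?_
    have h1 : ‖1 - Complex.I * (b : ℂ)‖ ≤ 1 + |b| := by
      refine (norm_sub_le _ _).trans ?_
      simp
    rw [norm_mul, norm_mul, norm_mul, norm_mul, norm_mul, norm_star, Complex.norm_two]
    calc _ ≤ 2 * (1 + |b|) * (1 + |b|) * ‖weberAmp y y' x‖
          + (1 + |b|) * (1 + |b|) * ‖weberAmp y y' x‖ := by gcongr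
      _ = _ := by ring

theorem norm_slowAmp (b : ℝ) (y y' : ℝ → ℝ) (x : ℝ) : ‖slowAmp b y y' x‖ =
    ‖weberAmp y y' x - ((b : ℂ) + Complex.I * ((1 / 2 : ℝ) : ℂ)) / (x : ℂ) ^ 2 *
      star (weberAmp y y' x)‖ := by
  rw [slowAmp, norm_mul, norm_exp_neg_phase, one_mul]

theorem norm_correction_le (b : ℝ) (y y' : ℝ → ℝ) (x : ℝ) :
    ‖((b : ℂ) + Complex.I * ((1 / 2 : ℝ) : ℂ)) / (x : ℂ) ^ 2 * star (weberAmp y y' x)‖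
      ≤ (1 + |b|) / x ^ 2 * ‖weberAmp y y' x‖ := by
  rw [norm_mul, norm_star, norm_div, norm_pow, Complex.norm_real, Real.norm_eq_abs, sq_abs]
  gcongr
  exact norm_weberKappa_le b

theorem norm_sq_amp_le_near (h : WeberSol b y y') (h0 : y 0 ^ 2 + y' 0 ^ 2 ≤ 1) {x : ℝ}
    (hx : 1 ≤ x) (hx' : x ≤ 3 * √(1 + |b|)) : ‖weberAmp y y' x‖ ^ 2
      ≤ (1 + |b|) * exp (3 * (b + (1 + |b|)) + 9 / 4) := by
  refine le_trans ?_ (h.energy_le h0 (by linarith) hx')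
  rw [norm_sq_weberAmp y y' (by linarith)]
  have h1 : y' x ^ 2 / x ≤ y' x ^ 2 := div_le_self (sq_nonneg _) hx
  have h2 : x * y x ^ 2 / 4 ≤ x ^ 2 / 4 * y x ^ 2 := by
    have : x ≤ x ^ 2 := by nlinarith
    nlinarith [sq_nonneg (y x)]
  have h3 : 0 ≤ (1 + |b|) * y x ^ 2 := by positivity
  linarith

/-- With `β = 1 + |b|`, the energy dominates the squared amplitude on `[1, 3 √β]`. Beyond `3 √β` the
averaging correction is at most `1 / 9` of the amplitude, so `weberAmp` and `slowAmp` have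
comparable size and Grönwall applies to the latter. -/
theorem norm_sq_amp_le (h : WeberSol b y y') (h0 : y 0 ^ 2 + y' 0 ^ 2 ≤ 1) {x : ℝ}
    (hx : 1 ≤ x) : ‖weberAmp y y' x‖ ^ 2 ≤ weberGrowth b := by
  set β := 1 + |b| with hβ
  have hb0 := abs_nonneg b
  have hβ1 : 1 ≤ β := by linarith
  have hs1 : 1 ≤ √β := Real.one_le_sqrt.2 hβ1
  have hss : √β * √β = β := Real.mul_self_sqrt (by linarith)
  have hA : β * exp (3 * (b + β) + 9 / 4) * (2 * exp (3 / 8 * β)) = weberGrowth b := by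
    rw [weberGrowth, ← hβ, show 3 * (b + β) + 3 / 8 * β + 9 / 4 =
      (3 * (b + β) + 9 / 4) + 3 / 8 * β by ring, exp_add _ (3 / 8 * β)]
    ring
  have hpos : 0 < β * exp (3 * (b + β) + 9 / 4) := by positivity
  rcases le_total x (3 * √β) with hx' | hx'
  · refine (h.norm_sq_amp_le_near h0 hx hx').trans ?_
    rw [← hA]
    refine le_mul_of_one_le_right hpos.le ?_
    have : 1 ≤ exp (3 / 8 * β) := one_le_exp (by positivity)
    linarith
  -- `9 / 8 = 1 / (1 - 1 / 9)`, from `β / t² ≤ 1 / 9`; the opposite comparison at the left endpoint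
  -- uses `10 / 9 = 1 + 1 / 9`. Together the squares lose `100 / 64 ≤ 2`.
  · have h1 : ∀ t, 3 * √β ≤ t → ‖weberAmp y y' t‖ ≤ 9 / 8 * ‖slowAmp b y y' t‖ := by
      intro t ht
      have h2 := norm_correction_le b y y' t
      have h3 := norm_sub_norm_le (weberAmp y y' t)
        (((b : ℂ) + Complex.I * ((1 / 2 : ℝ) : ℂ)) / (t : ℂ) ^ 2 * star (weberAmp y y' t))
      rw [← norm_slowAmp] at h3
      have h4 : β / t ^ 2 ≤ 1 / 9 := by
        rw [div_le_div_iff₀ (by nlinarith) (by norm_num)]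
        nlinarith
      have h5 : β / t ^ 2 * ‖weberAmp y y' t‖ ≤ 1 / 9 * ‖weberAmp y y' t‖ := by gcongr
      linarith
    have hd : ∀ t, ∃ d, 0 < t → HasDerivAt (slowAmp b y y') d t ∧
        ‖d‖ ≤ 3 * β ^ 2 * ‖weberAmp y y' t‖ / t ^ 3 := fun t => by
      by_cases ht : 0 < t
      · obtain ⟨d, h1⟩ := h.hasDerivAt_slowAmp ht
        exact ⟨d, fun _ => h1⟩
      · exact ⟨0, fun h => absurd h ht⟩
    choose d hd using hd
    -- The rate is `2 · 3 β² · (9 / 8) / t³`; its integral from `3 √β` to infinity is `3 β / 8`.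
    have key := le_mul_exp_of_deriv_le (S := fun t => ‖slowAmp b y y' t‖ ^ 2)
      (S' := fun t => 2 * inner ℝ (slowAmp b y y' t) (d t))
      (K := fun t => -(27 / 8 * β ^ 2 / t ^ 2)) (k := fun t => 27 / 4 * β ^ 2 / t ^ 3) hx'
      ?_ ?_ ?_
    · have e0 : ‖slowAmp b y y' (3 * √β)‖ ≤ 10 / 9 * ‖weberAmp y y' (3 * √β)‖ := by
        rw [norm_slowAmp]
        refine (norm_sub_le _ _).trans ?_
        have h2 := norm_correction_le b y y' (3 * √β)
        have h4 : β / (3 * √β) ^ 2 = 1 / 9 := by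
          rw [mul_pow, sq √β, hss]; field_simp; norm_num
        rw [← hβ, h4] at h2
        linarith
      have e1 := h.norm_sq_amp_le_near h0 (x := 3 * √β) (by linarith) le_rfl
      rw [← hβ] at e1
      have e2 : 27 / 8 * β ^ 2 / (3 * √β) ^ 2 = 3 / 8 * β := by
        rw [mul_pow, sq √β, hss]; field_simp; norm_num
      have e3 : exp (-(27 / 8 * β ^ 2 / x ^ 2) - -(27 / 8 * β ^ 2 / (3 * √β) ^ 2))
          ≤ exp (3 / 8 * β) := by
        rw [e2]
        refine exp_le_exp.2 ?_
        have : 0 ≤ 27 / 8 * β ^ 2 / x ^ 2 := by positivity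
        linarith
      rw [← hA]
      calc ‖weberAmp y y' x‖ ^ 2 ≤ (9 / 8 * ‖slowAmp b y y' x‖) ^ 2 := by
            gcongr; exact h1 x hx'
        _ = 81 / 64 * ‖slowAmp b y y' x‖ ^ 2 := by ring
        _ ≤ 81 / 64 * ((10 / 9 * ‖weberAmp y y' (3 * √β)‖) ^ 2 * exp (3 / 8 * β)) := by
            gcongr
            refine key.trans ?_
            gcongr
        _ = 100 / 64 * (‖weberAmp y y' (3 * √β)‖ ^ 2 * exp (3 / 8 * β)) := by ring
        _ ≤ 2 * (β * exp (3 * (b + β) + 9 / 4) * exp (3 / 8 * β)) := by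
            gcongr
            norm_num
        _ = _ := by ring
    · intro t ht
      exact (hd t (by linarith [ht.1])).1.norm_sq
    · intro t ht
      have ht0 : t ≠ 0 := by linarith [ht.1]
      have h1 := (((hasDerivAt_pow 2 t).fun_inv (pow_ne_zero 2 ht0)).const_mul
        (27 / 8 * β ^ 2)).neg
      refine h1.congr_deriv ?_
      field_simp
      ring
    · intro t ht
      have ht0 : 0 < t := by linarith [ht.1]
      have h2 := (real_inner_le_norm (slowAmp b y y' t) (d t))
      calc 2 * inner ℝ (slowAmp b y y' t) (d t)
          ≤ 2 * (‖slowAmp b y y' t‖ * (3 * β ^ 2 * (9 / 8 * ‖slowAmp b y y' t‖) / t ^ 3)) := by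
            refine mul_le_mul_of_nonneg_left (h2.trans ?_) (by norm_num)
            refine mul_le_mul_of_nonneg_left ((hd t ht0).2.trans ?_) (norm_nonneg _)
            gcongr
            exact h1 t ht.1
        _ = _ := by ring

theorem norm_amp_le (h : WeberSol b y y') (h0 : y 0 ^ 2 + y' 0 ^ 2 ≤ 1) {x : ℝ}
    (hx : 1 ≤ x) : ‖weberAmp y y' x‖ ≤ √(weberGrowth b) :=
  Real.le_sqrt_of_sq_le (h.norm_sq_amp_le h0 hx)

theorem sq_le (h : WeberSol b y y') (h0 : y 0 ^ 2 + y' 0 ^ 2 ≤ 1) {x : ℝ}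
    (hx : 0 ≤ x) : y x ^ 2 ≤ 4 * weberGrowth b := by
  rcases le_total 1 x with h1 | h1
  · have h2 := h.norm_sq_amp_le h0 h1
    rw [norm_sq_weberAmp y y' (by linarith)] at h2
    have h3 : 0 ≤ y' x ^ 2 / x := by positivity
    nlinarith [sq_nonneg (y x)]
  · have hb0 := abs_nonneg b
    have hs1 : 1 ≤ √(1 + |b|) := Real.one_le_sqrt.2 (by linarith)
    have h2 := h.energy_le h0 hx (by linarith)
    have h3 : (1 + |b|) * exp (3 * (b + (1 + |b|)) + 9 / 4) ≤ 4 * weberGrowth b := by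
      rw [weberGrowth]
      have : exp (3 * (b + (1 + |b|)) + 9 / 4) ≤
          exp (3 * (b + (1 + |b|)) + 3 / 8 * (1 + |b|) + 9 / 4) := exp_le_exp.2 (by linarith)
      have h4 : (1 + |b|) * exp (3 * (b + (1 + |b|)) + 9 / 4) ≤ (1 + |b|) *
          exp (3 * (b + (1 + |b|)) + 3 / 8 * (1 + |b|) + 9 / 4) := by gcongr
      have h5 : 0 ≤ (1 + |b|) *
          exp (3 * (b + (1 + |b|)) + 3 / 8 * (1 + |b|) + 9 / 4) := by positivity
      linarith
    have h4 : y x ^ 2 ≤ (1 + |b|) * y x ^ 2 := le_mul_of_one_le_left (sq_nonneg _) (by linarith)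
    have h5 : 0 ≤ x ^ 2 / 4 * y x ^ 2 := by positivity
    linarith [sq_nonneg (y' x)]

/-- `slowAmp` has a derivative of order `x⁻³`, hence a limit `C` with error of order `x⁻²`. Undoing
the averaging adds a term of the same order; the constant `3` covers `3 / 2 + 1`. -/
theorem exists_amplitude (h : WeberSol b y y') (h0 : y 0 ^ 2 + y' 0 ^ 2 ≤ 1) :
    ∃ C : ℂ, ∀ x, 1 ≤ x → ‖weberAmp y y' x - C * Complex.exp (Complex.I * (weberPhase b x : ℂ))‖
      ≤ 3 * (1 + |b|) ^ 2 * √(weberGrowth b) / x ^ 2 := by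
  have hd : ∀ t, ∃ d, 1 ≤ t → HasDerivAt (slowAmp b y y') d t ∧
      ‖d‖ ≤ 2 * (3 / 2 * (1 + |b|) ^ 2 * √(weberGrowth b)) / t ^ 3 := fun t => by
    by_cases ht : 1 ≤ t
    · obtain ⟨d, h1, h2⟩ := h.hasDerivAt_slowAmp (x := t) (by linarith)
      refine ⟨d, fun _ => ⟨h1, h2.trans ?_⟩⟩
      rw [← mul_assoc, ← mul_assoc]
      norm_num
      gcongr
      exact h.norm_amp_le h0 ht
    · exact ⟨0, fun h => absurd h ht⟩
  choose d hd using hd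
  obtain ⟨C, hC⟩ := exists_limit_of_deriv_le_inv_cube (fun x hx => (hd x hx).1)
    (fun x hx => (hd x hx).2)
  refine ⟨C, fun x hx => ?_⟩
  have hE : Complex.exp (Complex.I * (weberPhase b x : ℂ)) *
      Complex.exp (-(Complex.I * (weberPhase b x : ℂ))) = 1 := by
    rw [← Complex.exp_add]; simp
  have e : weberAmp y y' x - C * Complex.exp (Complex.I * (weberPhase b x : ℂ)) =
      Complex.exp (Complex.I * (weberPhase b x : ℂ)) * (slowAmp b y y' x - C) +
      ((b : ℂ) + Complex.I * ((1 / 2 : ℝ) : ℂ)) / (x : ℂ) ^ 2 * star (weberAmp y y' x) := by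
    rw [slowAmp, mul_sub, ← mul_assoc, hE]; ring
  rw [e]
  refine (norm_add_le _ _).trans ?_
  rw [norm_mul, mul_comm Complex.I, Complex.norm_exp_ofReal_mul_I, one_mul]
  have hb0 := abs_nonneg b
  calc _ ≤ 3 / 2 * (1 + |b|) ^ 2 * √(weberGrowth b) / x ^ 2
        + (1 + |b|) / x ^ 2 * √(weberGrowth b) := by
        refine add_le_add (hC x hx) ((norm_correction_le b y y' x).trans ?_)
        gcongr
        exact h.norm_amp_le h0 hx
    _ = (3 / 2 * (1 + |b|) ^ 2 + (1 + |b|)) * √(weberGrowth b) / x ^ 2 := by ring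
    _ ≤ _ := by
        gcongr
        nlinarith

end WeberSol


/-! ### The Gaussian transform of a solution -/

/-- The Gaussian weight `x ^ k exp (-(ε + i / 2) x ^ 2 / 2)`. -/
def weberKernel (k : ℕ) (ε x : ℝ) : ℂ :=
  (x : ℂ) ^ k * Complex.exp (-(((ε : ℂ) + Complex.I / 2) * (x : ℂ) ^ 2 / 2))

/-- The damping `ε` gives convergence. The fixed factor `e^{-i x² / 4}` cancels the quadratic phase
of `e^{iθ}`, so the amplitude of that component shows up as a singularity at `ε = 0`. -/
def weberLaplace (y : ℝ → ℝ) (k : ℕ) (ε : ℝ) : ℂ :=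
  ∫ x in Ioi (0 : ℝ), weberKernel k ε x * (y x : ℂ)

theorem norm_cexp_gauss (ε τ x : ℝ) :
    ‖Complex.exp (-(((ε : ℂ) + Complex.I * τ) * (x : ℂ) ^ 2 / 2))‖ = exp (-(ε / 2) * x ^ 2) := by
  rw [Complex.norm_exp]
  congr 1
  have : -(((ε : ℂ) + Complex.I * τ) * (x : ℂ) ^ 2 / 2) =
      ((-(ε / 2) * x ^ 2 : ℝ) : ℂ) + ((-(τ / 2) * x ^ 2 : ℝ) : ℂ) * Complex.I := by
    push_cast; ring
  rw [this]
  simp [-Complex.ofReal_mul, -Complex.ofReal_neg, -Complex.ofReal_pow, -Complex.ofReal_div]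

theorem norm_weberKernel (k : ℕ) (ε : ℝ) {x : ℝ} (hx : 0 ≤ x) :
    ‖weberKernel k ε x‖ = x ^ k * exp (-(ε / 2) * x ^ 2) := by
  have := norm_cexp_gauss ε (1 / 2) x
  rw [weberKernel, norm_mul, norm_pow, Complex.norm_real, Real.norm_eq_abs, abs_of_nonneg hx,
    ← this]
  congr 3
  push_cast
  ring_nf

theorem continuous_weberKernel (k : ℕ) (ε : ℝ) : Continuous (weberKernel k ε) := by
  unfold weberKernel; fun_prop

theorem integrableOn_pow_mul_exp_neg_sq (k : ℕ) {ε : ℝ} (hε : 0 < ε) :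
    IntegrableOn (fun x : ℝ => x ^ k * exp (-(ε / 2) * x ^ 2)) (Ioi 0) := by
  have := integrable_rpow_mul_exp_neg_mul_sq (half_pos hε) (s := k)
    (by have : (0 : ℝ) ≤ k := Nat.cast_nonneg k; linarith)
  simpa only [rpow_natCast] using this.integrableOn

theorem integrableOn_weberKernel_mul {y : ℝ → ℝ} (hy : Continuous y) {K : ℝ}
    (hK : ∀ x, 0 ≤ x → |y x| ≤ K) (k : ℕ) {ε : ℝ} (hε : 0 < ε) :
    IntegrableOn (fun x => weberKernel k ε x * (y x : ℂ)) (Ioi 0) := by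
  refine ((integrableOn_pow_mul_exp_neg_sq k hε).mul_const K).mono' ?_ ?_
  · have := continuous_weberKernel k ε
    exact (by fun_prop : Continuous fun x => weberKernel k ε x * (y x : ℂ)).aestronglyMeasurable
  · refine (ae_restrict_iff' measurableSet_Ioi).2 (ae_of_all _ fun x hx => ?_)
    have hx0 : 0 ≤ x := le_of_lt hx
    rw [norm_mul, norm_weberKernel k ε hx0, Complex.norm_real]
    gcongr
    exact hK x hx0

theorem hasDerivAt_weberLaplace {y : ℝ → ℝ} (hy : Continuous y) {K : ℝ}
    (hK : ∀ x, 0 ≤ x → |y x| ≤ K) (k : ℕ) {ε : ℝ} (hε : 0 < ε) :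
    HasDerivAt (weberLaplace y k) (-(1 / 2) * weberLaplace y (k + 2) ε) ε := by
  have e : -(1 / 2) * weberLaplace y (k + 2) ε =
      ∫ x in Ioi (0 : ℝ), -(1 / 2) * (weberKernel (k + 2) ε x * (y x : ℂ)) := by
    rw [weberLaplace, integral_const_mul]
  rw [e]
  have hc : ∀ k ε, AEStronglyMeasurable (fun x => weberKernel k ε x * (y x : ℂ))
      (volume.restrict (Ioi 0)) := fun k ε => by
    have := continuous_weberKernel k ε
    exact (by fun_prop : Continuous fun x => weberKernel k ε x * (y x : ℂ)).aestronglyMeasurable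
  have hK0 : 0 ≤ K := (abs_nonneg _).trans (hK 0 le_rfl)
  refine (hasDerivAt_integral_of_dominated_loc_of_deriv_le
    (μ := volume.restrict (Ioi 0)) (F := fun ε x => weberKernel k ε x * (y x : ℂ))
    (bound := fun x => x ^ (k + 2) * exp (-(ε / 2 / 2) * x ^ 2) * K)
    (F' := fun ε x => -(1 / 2) * (weberKernel (k + 2) ε x * (y x : ℂ)))
    (Ioi_mem_nhds (half_lt_self hε)) (Eventually.of_forall fun ε => hc k ε)
    (integrableOn_weberKernel_mul hy hK k hε) ((hc _ _).const_mul _) ?_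
    ((integrableOn_pow_mul_exp_neg_sq (k + 2) (half_pos hε)).mul_const K) ?_).2
  · refine (ae_restrict_iff' measurableSet_Ioi).2 (ae_of_all _ fun x hx η hη => ?_)
    have hx0 : 0 ≤ x := le_of_lt hx
    have hη' : ε / 2 < η := hη
    rw [norm_mul, norm_mul, norm_weberKernel _ η hx0, Complex.norm_real]
    have h2 : ‖(-(1 / 2) : ℂ)‖ ≤ 1 := by norm_num
    have h3 : exp (-(η / 2) * x ^ 2) ≤ exp (-(ε / 2 / 2) * x ^ 2) :=
      exp_le_exp.2 (by nlinarith [sq_nonneg x])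
    calc _ ≤ 1 * (x ^ (k + 2) * exp (-(ε / 2 / 2) * x ^ 2) * K) := by
          gcongr
          exact hK x hx0
      _ = _ := one_mul _
  · refine ae_of_all _ fun x η _ => ?_
    have h1 : HasDerivAt (fun ε : ℝ => -(((ε : ℂ) + Complex.I / 2) * (x : ℂ) ^ 2 / 2))
        (-(1 * (x : ℂ) ^ 2 / 2)) η :=
      ((((hasDerivAt_id η).ofReal_comp.add_const (Complex.I / 2)).mul_const _).div_const 2).neg
    refine ((h1.cexp.const_mul ((x : ℂ) ^ k)).mul_const (y x : ℂ)).congr_deriv ?_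
    rw [weberKernel]
    ring

namespace WeberSol

variable {b : ℝ} {y y' : ℝ → ℝ}

theorem continuous (h : WeberSol b y y') : Continuous y :=
  continuous_iff_continuousAt.2 fun x => (h.1 x).continuousAt

theorem continuous_deriv (h : WeberSol b y y') : Continuous y' :=
  continuous_iff_continuousAt.2 fun x => (h.2 x).continuousAt

theorem abs_le (h : WeberSol b y y') (h0 : y 0 ^ 2 + y' 0 ^ 2 ≤ 1) {x : ℝ} (hx : 0 ≤ x) :
    |y x| ≤ 2 * √(weberGrowth b) := by
  rw [← Real.sqrt_sq_eq_abs]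
  refine (Real.sqrt_le_sqrt (h.sq_le h0 hx)).trans ?_
  rw [Real.sqrt_mul (by norm_num), show √4 = 2 by rw [Real.sqrt_eq_iff_mul_self_eq] <;> norm_num]

theorem abs_deriv_le (h : WeberSol b y y') (h0 : y 0 ^ 2 + y' 0 ^ 2 ≤ 1) {x : ℝ} (hx : 1 ≤ x) :
    |y' x| ≤ √(weberGrowth b) * √x := by
  have h2 := h.norm_sq_amp_le h0 hx
  have hx0 : 0 < x := by linarith
  rw [norm_sq_weberAmp y y' hx0] at h2
  rw [← Real.sqrt_sq_eq_abs, ← Real.sqrt_mul (weberGrowth_pos b).le]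
  refine Real.sqrt_le_sqrt ?_
  have h3 : 0 ≤ x * y x ^ 2 / 4 := by positivity
  rw [← div_le_iff₀ hx0]
  linarith

/-- Initial values of the even (`m = 0`) and the odd (`m = 1`) solution. -/
def IsBasic (m : ℕ) (y y' : ℝ → ℝ) : Prop :=
  (m = 0 ∧ y 0 = 1 ∧ y' 0 = 0) ∨ (m = 1 ∧ y 0 = 0 ∧ y' 0 = 1)

theorem IsBasic.le_one {m : ℕ} (hm : IsBasic m y y') : y 0 ^ 2 + y' 0 ^ 2 ≤ 1 := by
  rcases hm with ⟨-, h, h'⟩ | ⟨-, h, h'⟩ <;> simp [h, h']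

theorem hasDerivAt_gauss (s : ℂ) (x : ℝ) :
    HasDerivAt (fun x : ℝ => Complex.exp (-(s * (x : ℂ) ^ 2 / 2)))
      (-(s * x) * Complex.exp (-(s * (x : ℂ) ^ 2 / 2))) x := by
  have h1 : HasDerivAt (fun x : ℝ => (x : ℂ) ^ 2) (2 * x) x := by
    simpa using (hasDerivAt_id x).ofReal_comp.fun_pow 2
  refine (((h1.const_mul s).div_const 2).fun_neg.cexp).congr_deriv ?_
  ring

theorem tendsto_exp_neg_sq_mul_pow (k : ℕ) {ε : ℝ} (hε : 0 < ε) :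
    Tendsto (fun x : ℝ => x ^ k * exp (-(ε / 2) * x ^ 2)) atTop (𝓝 0) := by
  have h := tendsto_rpow_mul_exp_neg_mul_atTop_nhds_zero k (ε / 2) (half_pos hε)
  refine squeeze_zero' (g := fun x : ℝ => x ^ (k : ℝ) * exp (-(ε / 2) * x)) ?_ ?_ h
  · filter_upwards [eventually_ge_atTop 0] with x hx
    positivity
  · filter_upwards [eventually_ge_atTop 1] with x hx
    rw [rpow_natCast]
    have : exp (-(ε / 2) * x ^ 2) ≤ exp (-(ε / 2) * x) := by
      have h2 : x ≤ x ^ 2 := by nlinarith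
      exact exp_le_exp.2 (by nlinarith)
    gcongr

/-- Integrate the derivative of `k y' - k' y`, where `k = weberKernel m ε`. The boundary term at `0`
vanishes by parity and the one at infinity by Gaussian decay. With `s = ε + i / 2`, the coefficient
of the moment of order `m + 2` is `s² + 1 / 4 = ε (ε + i)`. -/
theorem weberLaplace_recurrence (h : WeberSol b y y') {m : ℕ} (hm : IsBasic m y y') {ε : ℝ}
    (hε : 0 < ε) :
    (ε : ℂ) * (ε + Complex.I) * weberLaplace y (m + 2) ε
      = (b + (2 * m + 1) * (ε + Complex.I / 2)) * weberLaplace y m ε := by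
  have h0 := hm.le_one
  set s : ℂ := (ε : ℂ) + Complex.I / 2 with hs
  have hss : (ε : ℂ) * (ε + Complex.I) = s ^ 2 + 1 / 4 := by
    rw [hs]; linear_combination -(1 / 4 : ℂ) * Complex.I_sq
  have hint := fun k => integrableOn_weberKernel_mul h.continuous (fun x hx => h.abs_le h0 hx) k hε
  let f : ℝ → ℂ := fun x => weberKernel m ε x * (y' x : ℂ)
    - ((m : ℂ) * weberKernel 0 ε x - s * weberKernel (m + 1) ε x) * (y x : ℂ)
  -- Only `m = 0` and `m = 1` occur, so `m x^{m-1}` is the constant `m` and no term `m (m - 1)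
  -- x^{m-2}` arises.
  have hmm : ∀ x : ℝ, (m : ℂ) * x = m * (x : ℂ) ^ m := by
    rcases hm with ⟨rfl, -⟩ | ⟨rfl, -⟩ <;> simp
  have hd : ∀ x : ℝ, HasDerivAt f
      ((b + (2 * m + 1) * s) * (weberKernel m ε x * (y x : ℂ))
        - (s ^ 2 + 1 / 4) * (weberKernel (m + 2) ε x * (y x : ℂ))) x := by
    intro x
    have hk : ∀ k : ℕ, HasDerivAt (weberKernel k ε)
        ((k : ℂ) * (x : ℂ) ^ (k - 1) * Complex.exp (-(s * (x : ℂ) ^ 2 / 2))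
          - s * weberKernel (k + 1) ε x) x := by
      intro k
      have h1 : HasDerivAt (fun x : ℝ => (x : ℂ) ^ k) ((k : ℂ) * (x : ℂ) ^ (k - 1)) x := by
        simpa using (hasDerivAt_id x).ofReal_comp.fun_pow k
      refine (h1.mul (hasDerivAt_gauss s x)).congr_deriv ?_
      rw [weberKernel, ← hs]
      ring
    have hy := (h.1 x).ofReal_comp
    have hy' := (h.2 x).ofReal_comp
    refine (((hk m).mul hy').sub ((((hk 0).const_mul (m : ℂ)).sub
      ((hk (m + 1)).const_mul s)).mul hy)).congr_deriv ?_
    simp only [weberKernel, ← hs, Pi.sub_apply]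
    have h1 : (m : ℂ) * (x : ℂ) ^ (m - 1) = m := by
      rcases hm with ⟨rfl, -⟩ | ⟨rfl, -⟩ <;> simp
    rw [h1]
    generalize Complex.exp (-(s * (x : ℂ) ^ 2 / 2)) = E
    push_cast
    linear_combination (s * E * (y x : ℂ)) * (hmm x)
  have hT : Tendsto f atTop (𝓝 0) := by
    have hb1 : ∀ (k : ℕ) (z : ℝ → ℝ) (K : ℝ), (∀ x, 1 ≤ x → |z x| ≤ K * x) →
        Tendsto (fun x => weberKernel k ε x * (z x : ℂ)) atTop (𝓝 0) := by
      intro k z K hz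
      have h2 := (tendsto_exp_neg_sq_mul_pow (k + 1) hε).mul_const K
      rw [zero_mul] at h2
      refine squeeze_zero_norm' ?_ h2
      filter_upwards [eventually_ge_atTop 1] with x hx
      rw [norm_mul, norm_weberKernel k ε (by linarith), Complex.norm_real, Real.norm_eq_abs]
      calc _ ≤ x ^ k * exp (-(ε / 2) * x ^ 2) * (K * x) := by gcongr; exact hz x hx
        _ = _ := by ring
    have hyb : ∀ x, 1 ≤ x → |y x| ≤ 2 * √(weberGrowth b) * x := fun x hx =>
      (h.abs_le h0 (by linarith)).trans (le_mul_of_one_le_right (by positivity) hx)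
    have hy'b : ∀ x, 1 ≤ x → |y' x| ≤ √(weberGrowth b) * x := fun x hx => by
      refine (h.abs_deriv_le h0 hx).trans ?_
      gcongr
      exact Real.sqrt_le_left (by linarith) |>.2 (by nlinarith)
    have := (hb1 m y' _ hy'b).sub (((hb1 0 y _ hyb).const_mul (m : ℂ)).sub
      ((hb1 (m + 1) y _ hyb).const_mul s))
    simp only [mul_zero, sub_zero] at this
    refine this.congr fun x => ?_
    simp only [f]
    ring
  have key := integral_Ioi_of_hasDerivAt_of_tendsto' (fun x _ => hd x)
    (((hint m).const_mul _).sub ((hint (m + 2)).const_mul _)) hT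
  have hf0 : f 0 = 0 := by
    simp only [f, weberKernel]
    rcases hm with ⟨rfl, h1, h2⟩ | ⟨rfl, h1, h2⟩ <;> simp [h1, h2]
  rw [integral_sub ((hint m).const_mul _) ((hint (m + 2)).const_mul _), integral_const_mul,
    integral_const_mul, hf0, sub_zero] at key
  rw [hss]
  exact (sub_eq_zero.1 key).symm

end WeberSol


/-! ### The first integral in `ε` and its value at infinity -/

/-- Since the `ε`-derivative of the transform of order `m` is `-1/2` times that of order `m + 2`,
the recurrence becomes a first order equation with logarithmic derivative `-P / ε - Q / (ε + i)`.
Partial fractions give `P` here and `Q` in `connQ`. -/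
def connP (m : ℕ) (b : ℝ) : ℂ := (2 * m + 1) / 4 - Complex.I * b / 2

def connQ (m : ℕ) (b : ℝ) : ℂ := (2 * m + 1) / 4 + Complex.I * b / 2

/-- The first integral of the differential equation satisfied by `weberLaplace`. -/
def laplaceInvariant (b : ℝ) (y : ℝ → ℝ) (m : ℕ) (ε : ℝ) : ℂ :=
  Complex.exp (connP m b * (log ε : ℝ)) * Complex.exp (connQ m b * Complex.log (ε + Complex.I)) *
    weberLaplace y m ε

theorem add_I_mem_slitPlane (ε : ℝ) : (ε : ℂ) + Complex.I ∈ Complex.slitPlane :=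
  Complex.mem_slitPlane_iff.2 (Or.inr (by simp))

theorem connP_re (m : ℕ) (b : ℝ) : (connP m b).re = (2 * m + 1) / 4 := by
  have : connP m b = (((2 * m + 1) / 4 : ℝ) : ℂ) - ((b / 2 : ℝ) : ℂ) * Complex.I := by
    rw [connP]; push_cast; ring
  rw [this, Complex.sub_re, Complex.ofReal_re, Complex.re_ofReal_mul, Complex.I_re]
  ring

namespace WeberSol

variable {b : ℝ} {y y' : ℝ → ℝ}

theorem hasDerivAt_laplaceInvariant (h : WeberSol b y y') {m : ℕ} (hm : IsBasic m y y') {ε : ℝ}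
    (hε : 0 < ε) : HasDerivAt (laplaceInvariant b y m) 0 ε := by
  have hL := hasDerivAt_weberLaplace h.continuous (fun x hx => h.abs_le hm.le_one hx) m hε
  have hrec := h.weberLaplace_recurrence hm hε
  have hε0 : (ε : ℂ) ≠ 0 := by exact_mod_cast hε.ne'
  have hεI : (ε : ℂ) + Complex.I ≠ 0 := Complex.slitPlane_ne_zero (add_I_mem_slitPlane ε)
  have h1 : HasDerivAt (fun ε : ℝ => Complex.exp (connP m b * (log ε : ℝ)))
      (Complex.exp (connP m b * (log ε : ℝ)) * (connP m b * (ε⁻¹ : ℝ))) ε :=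
    ((hasDerivAt_log hε.ne').ofReal_comp.const_mul _).cexp
  have h2 : HasDerivAt (fun ε : ℝ => Complex.exp (connQ m b * Complex.log (ε + Complex.I)))
      (Complex.exp (connQ m b * Complex.log (ε + Complex.I)) *
        (connQ m b * (1 / (ε + Complex.I)))) ε :=
    ((((hasDerivAt_id ε).ofReal_comp.add_const Complex.I).clog_real
      (add_I_mem_slitPlane ε)).const_mul _).cexp.congr_deriv (by simp)
  refine ((h1.mul h2).mul hL).congr_deriv ?_
  simp only [Pi.mul_apply]
  generalize Complex.exp (connP m b * (log ε : ℝ)) = E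
  generalize Complex.exp (connQ m b * Complex.log (ε + Complex.I)) = F
  have hr : weberLaplace y (m + 2) ε =
      (b + (2 * m + 1) * (ε + Complex.I / 2)) * weberLaplace y m ε / (ε * (ε + Complex.I)) := by
    rw [← hrec]; field_simp
  rw [hr, connP, connQ]
  push_cast
  field_simp
  linear_combination (-8 * E * F * weberLaplace y m ε * b) * Complex.I_sq

theorem laplaceInvariant_eq (h : WeberSol b y y') {m : ℕ} (hm : IsBasic m y y') :
    ∃ c, ∀ ε, 0 < ε → laplaceInvariant b y m ε = c := by
  obtain ⟨c, hc⟩ := isOpen_Ioi.exists_is_const_of_deriv_eq_zero (s := Ioi (0 : ℝ))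
    isPreconnected_Ioi (f := laplaceInvariant b y m)
    (fun ε hε => (h.hasDerivAt_laplaceInvariant hm hε).differentiableAt.differentiableWithinAt)
    (fun ε hε => (h.hasDerivAt_laplaceInvariant hm hε).deriv)
  exact ⟨c, fun ε hε => hc ε hε⟩

/-- This dominates `y (δ u) / δ ^ m` uniformly in `δ`. In the odd case the mean value inequality
works on `[0, 1]`, and boundedness of `y` beyond. -/
theorem exists_abs_le_pow (h : WeberSol b y y') {m : ℕ} (hm : IsBasic m y y') :
    ∃ M, ∀ x, 0 ≤ x → |y x| ≤ M * x ^ m := by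
  have hb := fun x hx => h.abs_le hm.le_one (x := x) hx
  rcases hm with ⟨rfl, h1, h2⟩ | ⟨rfl, h1, h2⟩
  · exact ⟨_, fun x hx => by simpa using hb x hx⟩
  · obtain ⟨D, hD⟩ := isCompact_Icc.exists_bound_of_continuousOn
      (h.continuous_deriv.continuousOn (s := Icc (0 : ℝ) 1))
    refine ⟨max D (2 * √(weberGrowth b)), fun x hx => ?_⟩
    rw [pow_one]
    rcases le_total x 1 with hx1 | hx1
    · have := (convex_Icc (0 : ℝ) 1).norm_image_sub_le_of_norm_hasDerivWithin_le
        (fun t _ => (h.1 t).hasDerivWithinAt) hD (left_mem_Icc.2 zero_le_one) ⟨hx, hx1⟩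
      rw [h1, sub_zero, sub_zero, Real.norm_eq_abs, Real.norm_eq_abs, abs_of_nonneg hx] at this
      exact this.trans (by gcongr; exact le_max_left _ _)
    · refine (hb x hx).trans ?_
      calc 2 * √(weberGrowth b) ≤ 2 * √(weberGrowth b) * x :=
            le_mul_of_one_le_right (by positivity) hx1
        _ ≤ _ := by gcongr; exact le_max_right _ _

theorem tendsto_scaled (h : WeberSol b y y') {m : ℕ} (hm : IsBasic m y y') (u : ℝ) :
    Tendsto (fun δ : ℝ => y (δ * u) / δ ^ m) (𝓝[>] 0) (𝓝 (u ^ m)) := by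
  rcases hm with ⟨rfl, h1, h2⟩ | ⟨rfl, h1, h2⟩
  · have : Tendsto (fun δ : ℝ => y (δ * u)) (𝓝 0) (𝓝 (y (0 * u))) :=
      (h.continuous.comp (continuous_mul_const u)).tendsto 0
    rw [zero_mul, h1] at this
    simpa using this.mono_left nhdsWithin_le_nhds
  · have h3 : HasDerivAt (fun δ => y (δ * u)) u 0 := by
      have h4 : HasDerivAt (fun δ => y (δ * u)) (y' (0 * u) * u) 0 :=
        HasDerivAt.comp (0 : ℝ) (h.1 (0 * u)) (hasDerivAt_mul_const u)
      simpa [h2] using h4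
    have h5 := (hasDerivAt_iff_tendsto_slope.1 h3).mono_left
      (nhdsWithin_mono (0 : ℝ) (fun x (hx : 0 < x) => ne_of_gt hx) : 𝓝[>] (0 : ℝ) ≤ _)
    rw [pow_one]
    refine h5.congr fun δ => ?_
    simp [slope_def_field, h1]

theorem integral_pow_mul_exp_neg_half_sq {m : ℕ} (hm : m = 0 ∨ m = 1) :
    ∫ u in Ioi (0 : ℝ), u ^ (2 * m) * exp (-(1 / 2) * u ^ 2) = √(π / 2) := by
  rcases hm with rfl | rfl
  · simp only [mul_zero, pow_zero, one_mul]
    rw [integral_gaussian_Ioi, show π / (1 / 2) = 2 ^ 2 * (π / 2) by ring,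
      Real.sqrt_mul (by positivity), Real.sqrt_sq (by norm_num)]
    ring
  · have h1 := integral_rpow_mul_exp_neg_mul_rpow (p := 2) (q := 2) (b := 1 / 2) (by norm_num)
      (by norm_num) (by norm_num)
    simp only [rpow_ofNat] at h1
    rw [mul_one, h1, show ((2 : ℝ) + 1) / 2 = 1 / 2 + 1 by norm_num,
      Real.Gamma_add_one (by norm_num), Real.Gamma_one_half_eq, show -((2 : ℝ) + 1) / 2 = -1 - 1 / 2
      by norm_num, Real.rpow_sub (by norm_num), Real.rpow_neg_one, ← Real.sqrt_eq_rpow,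
      Real.sqrt_div (by positivity), Real.sqrt_div (by positivity)]
    have := Real.sqrt_pos.2 (show (0 : ℝ) < 2 by norm_num)
    have hs := Real.mul_self_sqrt (show (0 : ℝ) ≤ 2 by norm_num)
    have hs' : √2 ^ 2 = 2 := by rw [sq]; exact hs
    simp
    field_simp
    exact hs'

/-- Put `ε = δ⁻²` and `x = δ u`. As `δ → 0` the weight concentrates at the origin, where `y` behaves
like `x ^ m`, and the oscillating factor tends to `1`. The limit `∫ u^{2m} e^{-u²/2}` has the same
value for both parities. -/
theorem tendsto_weberLaplace_scaled (h : WeberSol b y y') {m : ℕ} (hm : IsBasic m y y') :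
    Tendsto (fun δ : ℝ => weberLaplace y m ((δ ^ 2)⁻¹) / ((δ ^ (2 * m + 1) : ℝ) : ℂ)) (𝓝[>] 0)
      (𝓝 (√(π / 2) : ℝ)) := by
  obtain ⟨M, hM⟩ := h.exists_abs_le_pow hm
  have hm' : m = 0 ∨ m = 1 := hm.imp (fun h => h.1) fun h => h.1
  let F : ℝ → ℝ → ℂ := fun δ u => (u : ℂ) ^ m *
    Complex.exp (-((((1 : ℝ) : ℂ) + Complex.I * ((δ ^ 2 / 2 : ℝ) : ℂ)) * (u : ℂ) ^ 2 / 2)) *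
    ((y (δ * u) / δ ^ m : ℝ) : ℂ)
  have hscale : ∀ δ : ℝ, 0 < δ →
      weberLaplace y m ((δ ^ 2)⁻¹) / ((δ ^ (2 * m + 1) : ℝ) : ℂ) = ∫ u in Ioi (0 : ℝ), F δ u := by
    intro δ hδ
    have hδ0 : (δ : ℂ) ≠ 0 := by exact_mod_cast hδ.ne'
    have h1 := integral_comp_mul_left_Ioi'
      (fun x => weberKernel m ((δ ^ 2)⁻¹) x * (y x : ℂ)) 0 hδ
    rw [mul_zero] at h1
    rw [weberLaplace, ← h1, Complex.real_smul, ← integral_const_mul, ← integral_div]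
    refine setIntegral_congr_fun measurableSet_Ioi fun u _ => ?_
    simp only [F, weberKernel]
    have e : (((((δ ^ 2)⁻¹ : ℝ) : ℂ) + Complex.I / 2) * ((δ * u : ℝ) : ℂ) ^ 2 / 2) =
      ((((1 : ℝ) : ℂ) + Complex.I * ((δ ^ 2 / 2 : ℝ) : ℂ)) * (u : ℂ) ^ 2 / 2) := by
      push_cast
      field_simp
    rw [e]
    generalize Complex.exp (-((((1 : ℝ) : ℂ) + Complex.I * ((δ ^ 2 / 2 : ℝ) : ℂ)) *
      (u : ℂ) ^ 2 / 2)) = E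
    push_cast
    field_simp
    ring
  have hint : ((√(π / 2) : ℝ) : ℂ) = ∫ u in Ioi (0 : ℝ),
      ((u ^ (2 * m) * exp (-(1 / 2) * u ^ 2) : ℝ) : ℂ) := by
    rw [integral_complex_ofReal, integral_pow_mul_exp_neg_half_sq hm']
  rw [hint]
  have hcongr : Tendsto (fun δ : ℝ => ∫ u in Ioi (0 : ℝ), F δ u) (𝓝[>] 0)
      (𝓝 (∫ u in Ioi (0 : ℝ), ((u ^ (2 * m) * exp (-(1 / 2) * u ^ 2) : ℝ) : ℂ))) := by
    refine tendsto_integral_filter_of_dominated_convergence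
      (fun u => u ^ (2 * m) * exp (-(1 / 2) * u ^ 2) * M) ?_ ?_ ?_ ?_
    · refine Eventually.of_forall fun δ => ?_
      have := h.continuous
      exact (by fun_prop : Continuous (F δ)).aestronglyMeasurable
    · filter_upwards [self_mem_nhdsWithin] with δ hδ
      have hδ0 : 0 < δ := hδ
      refine (ae_restrict_iff' measurableSet_Ioi).2 (ae_of_all _ fun u hu => ?_)
      have hu0 : 0 < u := hu
      rw [norm_mul, norm_mul, norm_cexp_gauss, norm_pow, Complex.norm_real, Complex.norm_real,
        Real.norm_eq_abs, Real.norm_eq_abs, abs_of_pos hu0, abs_div, abs_of_pos (pow_pos hδ0 m)]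
      have h2 : |y (δ * u)| / δ ^ m ≤ M * u ^ m := by
        rw [div_le_iff₀ (pow_pos hδ0 m)]
        refine (hM _ (by positivity)).trans (le_of_eq ?_)
        rw [mul_pow]; ring
      calc _ ≤ u ^ m * exp (-(1 / 2) * u ^ 2) * (M * u ^ m) := by gcongr
        _ = _ := by rw [pow_mul']; ring
    · have := integrableOn_pow_mul_exp_neg_sq (2 * m) one_pos
      exact this.mul_const M
    · refine (ae_restrict_iff' measurableSet_Ioi).2 (ae_of_all _ fun u _ => ?_)
      have h1 := h.tendsto_scaled hm u
      have h2 : Tendsto (fun δ : ℝ => (u : ℂ) ^ m *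
          Complex.exp (-((((1 : ℝ) : ℂ) + Complex.I * ((δ ^ 2 / 2 : ℝ) : ℂ)) * (u : ℂ) ^ 2 / 2)))
          (𝓝[>] 0) (𝓝 ((u : ℂ) ^ m * Complex.exp (-((((1 : ℝ) : ℂ) + Complex.I *
          (((0 : ℝ) ^ 2 / 2 : ℝ) : ℂ)) * (u : ℂ) ^ 2 / 2)))) :=
        ((by fun_prop : Continuous fun δ : ℝ => (u : ℂ) ^ m *
          Complex.exp (-((((1 : ℝ) : ℂ) + Complex.I * ((δ ^ 2 / 2 : ℝ) : ℂ)) *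
          (u : ℂ) ^ 2 / 2))).tendsto 0).mono_left nhdsWithin_le_nhds
      have h3 := h2.mul ((Complex.continuous_ofReal.tendsto _).comp h1)
      refine h3.trans (le_of_eq ?_)
      congr 1
      push_cast
      rw [pow_mul']
      have : -(((1 : ℂ) + Complex.I * (0 ^ 2 / 2)) * (u : ℂ) ^ 2 / 2) = -(1 / 2) * (u : ℂ) ^ 2 := by
        ring
      rw [this]
      ring
  refine hcongr.congr' ?_
  filter_upwards [self_mem_nhdsWithin] with δ hδ
  exact (hscale δ hδ).symm

/-- Evaluate the constant along `ε = δ⁻² → ∞`. Because `P + Q = (2m + 1) / 2`, the prefactor is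
`δ^{-(2m+1)} (1 + i δ²)^Q`, whose power of `δ` is exactly that of the scaling limit. -/
theorem laplaceInvariant_eq_sqrt (h : WeberSol b y y') {m : ℕ} (hm : IsBasic m y y') {ε : ℝ}
    (hε : 0 < ε) : laplaceInvariant b y m ε = (√(π / 2) : ℝ) := by
  obtain ⟨c, hc⟩ := h.laplaceInvariant_eq hm
  rw [hc ε hε]
  have h1 := h.tendsto_weberLaplace_scaled hm
  have h2 : Tendsto (fun δ : ℝ => Complex.exp (connQ m b *
      Complex.log (1 + Complex.I * ((δ ^ 2 : ℝ) : ℂ)))) (𝓝[>] 0) (𝓝 1) := by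
    have : ContinuousAt (fun δ : ℝ => Complex.exp (connQ m b *
        Complex.log (1 + Complex.I * ((δ ^ 2 : ℝ) : ℂ)))) 0 := by
      have h3 : ContinuousAt (fun δ : ℝ => Complex.log (1 + Complex.I * ((δ ^ 2 : ℝ) : ℂ))) 0 := by
        refine ContinuousAt.clog (by fun_prop) ?_
        simp
      exact (h3.const_mul _).cexp
    have h4 := this.tendsto
    simp at h4
    refine (Tendsto.congr (fun δ => ?_) h4).mono_left nhdsWithin_le_nhds
    simp
  have h3 := h2.mul h1
  rw [one_mul] at h3
  refine tendsto_nhds_unique (tendsto_const_nhds.congr' ?_) h3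
  filter_upwards [self_mem_nhdsWithin] with δ hδ
  have hδ0 : 0 < δ := hδ
  have hδC : (δ : ℂ) ≠ 0 := by exact_mod_cast hδ0.ne'
  rw [← hc ((δ ^ 2)⁻¹) (by positivity), laplaceInvariant, ← Complex.exp_add]
  have e1 : Complex.log ((((δ ^ 2)⁻¹ : ℝ) : ℂ) + Complex.I) =
      ((-(2 * log δ) : ℝ) : ℂ) + Complex.log (1 + Complex.I * ((δ ^ 2 : ℝ) : ℂ)) := by
    have : (((δ ^ 2)⁻¹ : ℝ) : ℂ) + Complex.I =
        (((δ ^ 2)⁻¹ : ℝ) : ℂ) * (1 + Complex.I * ((δ ^ 2 : ℝ) : ℂ)) := by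
      push_cast; field_simp
    rw [this, Complex.log_ofReal_mul (by positivity)]
    · rw [Real.log_inv, Real.log_pow]; push_cast; ring
    · intro h0
      have := congrArg Complex.re h0
      simp [-Complex.ofReal_pow] at this
  have e2 : ((δ ^ (2 * m + 1) : ℝ) : ℂ) = Complex.exp ((2 * m + 1) * (log δ : ℝ)) := by
    rw [← Real.rpow_natCast, Real.rpow_def_of_pos hδ0, Complex.ofReal_exp]
    congr 1; push_cast; ring
  rw [e1, e2, Real.log_inv, Real.log_pow, mul_div_assoc', div_eq_mul_inv, ← Complex.exp_neg,
    mul_right_comm, ← Complex.exp_add]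
  congr 2
  rw [connP, connQ]
  push_cast
  ring

end WeberSol


/-! ### The transform as `ε → 0` and the connection formula -/

/-- The substitution `t = x²` turns the integral into Euler's integral for `Γ(p)`. -/
theorem integral_cpow_mul_exp_neg_sq {p : ℂ} (hp : 0 < p.re) {ε : ℝ} (hε : 0 < ε) :
    ∫ x in Ioi (0 : ℝ), (x : ℂ) ^ (2 * p - 1) * (exp (-(ε / 2) * x ^ 2) : ℝ)
      = 1 / 2 * (Complex.exp (p * (log (2 / ε) : ℝ)) * Complex.Gamma p) := by
  have h1 := integral_comp_rpow_Ioi_of_pos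
    (g := fun t : ℝ => (t : ℂ) ^ (p - 1) * Complex.exp (-(((ε / 2 : ℝ) : ℂ) * t))) (p := 2) two_pos
  rw [Complex.integral_cpow_mul_exp_neg_mul_Ioi hp (half_pos hε)] at h1
  have e : (1 / ((ε / 2 : ℝ) : ℂ)) ^ p = Complex.exp (p * (log (2 / ε) : ℝ)) := by
    have h2 : (1 / ((ε / 2 : ℝ) : ℂ)) = ((2 / ε : ℝ) : ℂ) := by push_cast; field_simp
    rw [h2, Complex.cpow_def_of_ne_zero, ← Complex.ofReal_log (by positivity), mul_comm]
    have : 2 / ε ≠ 0 := by positivity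
    exact_mod_cast this
  rw [← e, ← h1, ← integral_const_mul]
  refine setIntegral_congr_fun measurableSet_Ioi fun x hx => ?_
  have hx0 : 0 < x := hx
  have hxC : (x : ℂ) ≠ 0 := by exact_mod_cast hx0.ne'
  have e1 : (2 : ℝ) - 1 = 1 := by norm_num
  simp only [rpow_ofNat, e1, rpow_one, Complex.real_smul]
  have e2 : (((x ^ 2 : ℝ) : ℂ)) ^ (p - 1) = (x : ℂ) ^ (2 * (p - 1)) := by
    rw [Complex.cpow_def_of_ne_zero (by exact_mod_cast (pow_pos hx0 2).ne'),
      Complex.cpow_def_of_ne_zero hxC, ← Complex.ofReal_log (by positivity),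
      ← Complex.ofReal_log hx0.le, Real.log_pow]
    congr 1; push_cast; ring
  have e3 : (x : ℂ) ^ (2 * p - 1) = x * (x : ℂ) ^ (2 * (p - 1)) := by
    rw [show 2 * p - 1 = 1 + 2 * (p - 1) by ring, Complex.cpow_add _ _ hxC, Complex.cpow_one]
  rw [e2, e3, Complex.ofReal_exp]
  have e4 : ((-(ε / 2) * x ^ 2 : ℝ) : ℂ) = -(((ε / 2 : ℝ) : ℂ) * ((x ^ 2 : ℝ) : ℂ)) := by
    push_cast; ring
  rw [e4]
  push_cast
  ring

theorem integrableOn_cpow_mul_exp_neg_sq {μ : ℂ} (hμ : -1 < μ.re) {ε : ℝ} (hε : 0 < ε) :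
    IntegrableOn (fun x : ℝ => (x : ℂ) ^ μ * (exp (-(ε / 2) * x ^ 2) : ℝ)) (Ioi 0) := by
  refine (integrable_rpow_mul_exp_neg_mul_sq (half_pos hε) hμ).integrableOn.mono' ?_ ?_
  · refine ContinuousOn.aestronglyMeasurable ?_ measurableSet_Ioi
    intro x hx
    have hx0 : 0 < x := hx
    exact ((Complex.continuousAt_ofReal_cpow_const x μ (Or.inr hx0.ne')).mul
      (by fun_prop)).continuousWithinAt
  · refine (ae_restrict_iff' measurableSet_Ioi).2 (ae_of_all _ fun x hx => ?_)
    rw [norm_mul, Complex.norm_cpow_eq_rpow_re_of_pos hx, Complex.norm_real,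
      Real.norm_of_nonneg (exp_pos _).le]

/-- Uniform bound for the oscillatory part of the Laplace integral, by one integration by parts. -/
theorem norm_integral_cpow_mul_cexp_le {μ : ℂ} (hμ : -1 < μ.re) (hμ' : μ.re < 1) {ε : ℝ}
    (hε : 0 < ε) :
    IntegrableOn (fun x : ℝ => (x : ℂ) ^ μ *
      Complex.exp (-(((ε : ℂ) + Complex.I * (1 : ℝ)) * (x : ℂ) ^ 2 / 2))) (Ioi 1) ∧
    ‖∫ x in Ioi (1 : ℝ), (x : ℂ) ^ μ *
      Complex.exp (-(((ε : ℂ) + Complex.I * (1 : ℝ)) * (x : ℂ) ^ 2 / 2))‖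
      ≤ ‖μ - 1‖ * (∫ x in Ioi (1 : ℝ), x ^ (μ.re - 2)) + 1 := by
  set s : ℂ := (ε : ℂ) + Complex.I * (1 : ℝ) with hs
  -- The imaginary part of `s` is `1`, so division by `s` after the integration by parts is harmless
  -- uniformly in `ε`.
  have hs1 : 1 ≤ ‖s‖ := by
    have := Complex.abs_im_le_norm s
    simpa [hs] using this
  have hnorm : ∀ (ν : ℂ) (x : ℝ), 0 < x →
      ‖(x : ℂ) ^ ν * Complex.exp (-(s * (x : ℂ) ^ 2 / 2))‖ = x ^ ν.re * exp (-(ε / 2) * x ^ 2) :=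
    fun ν x hx => by
      rw [norm_mul, Complex.norm_cpow_eq_rpow_re_of_pos hx, hs, norm_cexp_gauss]
  have hcont : ∀ ν : ℂ, ContinuousOn (fun x : ℝ => (x : ℂ) ^ ν *
      Complex.exp (-(s * (x : ℂ) ^ 2 / 2))) (Ioi 1) := by
    intro ν x hx
    have hx0 : 0 < x := one_pos.trans hx
    exact ((Complex.continuousAt_ofReal_cpow_const x ν (Or.inr hx0.ne')).mul
      (by fun_prop)).continuousWithinAt
  have hI0 : IntegrableOn (fun x : ℝ => (x : ℂ) ^ μ * Complex.exp (-(s * (x : ℂ) ^ 2 / 2)))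
      (Ioi 1) := by
    refine ((integrable_rpow_mul_exp_neg_mul_sq (half_pos hε) hμ).integrableOn).mono'
      ((hcont μ).aestronglyMeasurable measurableSet_Ioi) ?_
    refine (ae_restrict_iff' measurableSet_Ioi).2 (ae_of_all _ fun x hx => ?_)
    rw [hnorm μ x (one_pos.trans hx)]
  have hJ : IntegrableOn (fun x : ℝ => x ^ (μ.re - 2)) (Ioi 1) :=
    integrableOn_Ioi_rpow_of_lt (by linarith) one_pos
  have hle : ∀ x ∈ Ioi (1 : ℝ), ‖(x : ℂ) ^ (μ - 2) * Complex.exp (-(s * (x : ℂ) ^ 2 / 2))‖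
      ≤ x ^ (μ.re - 2) := by
    intro x hx
    have hx0 : (0 : ℝ) < x := one_pos.trans hx
    rw [hnorm _ x hx0, Complex.sub_re]
    refine mul_le_of_le_one_right (by positivity) (exp_le_one_iff.2 ?_)
    nlinarith [sq_nonneg x]
  have hI2 : IntegrableOn (fun x : ℝ => (x : ℂ) ^ (μ - 2) *
      Complex.exp (-(s * (x : ℂ) ^ 2 / 2))) (Ioi 1) :=
    hJ.mono' ((hcont _).aestronglyMeasurable measurableSet_Ioi)
      ((ae_restrict_iff' measurableSet_Ioi).2 (ae_of_all _ hle))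
  refine ⟨hI0, ?_⟩
  have hμ1 : μ - 1 ≠ 0 := fun h => by
    have := congrArg Complex.re h
    simp at this
    linarith
  have hd : ∀ x ∈ Ici (1 : ℝ), HasDerivAt
      (fun x : ℝ => (x : ℂ) ^ (μ - 1) * Complex.exp (-(s * (x : ℂ) ^ 2 / 2)))
      ((μ - 1) * ((x : ℂ) ^ (μ - 2) * Complex.exp (-(s * (x : ℂ) ^ 2 / 2)))
        - s * ((x : ℂ) ^ μ * Complex.exp (-(s * (x : ℂ) ^ 2 / 2)))) x := by
    intro x hx
    have hx0 : x ≠ 0 := (one_pos.trans_le hx).ne'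
    have hxC : (x : ℂ) ≠ 0 := by exact_mod_cast hx0
    refine ((hasDerivAt_ofReal_cpow_const hx0 hμ1).mul
      (WeberSol.hasDerivAt_gauss s x)).congr_deriv ?_
    have e : (x : ℂ) ^ μ = (x : ℂ) ^ (μ - 1) * x := by
      have := Complex.cpow_add (μ - 1) 1 hxC
      rwa [sub_add_cancel, Complex.cpow_one] at this
    rw [e, show μ - 1 - 1 = μ - 2 by ring]
    ring
  have ht : Tendsto (fun x : ℝ => (x : ℂ) ^ (μ - 1) * Complex.exp (-(s * (x : ℂ) ^ 2 / 2)))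
      atTop (𝓝 0) := by
    have h1 := WeberSol.tendsto_exp_neg_sq_mul_pow 0 hε
    refine squeeze_zero_norm' ?_ h1
    filter_upwards [eventually_ge_atTop 1] with x hx
    rw [hnorm _ x (by linarith), pow_zero]
    gcongr
    refine Real.rpow_le_one_of_one_le_of_nonpos hx ?_
    simp
    linarith
  have key := integral_Ioi_of_hasDerivAt_of_tendsto' hd ((hI2.const_mul _).sub (hI0.const_mul _)) ht
  rw [integral_sub (hI2.const_mul _) (hI0.const_mul _), integral_const_mul, integral_const_mul]
    at key
  set B := ∫ x in Ioi (1 : ℝ), (x : ℂ) ^ μ * Complex.exp (-(s * (x : ℂ) ^ 2 / 2))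
  set D := ∫ x in Ioi (1 : ℝ), (x : ℂ) ^ (μ - 2) * Complex.exp (-(s * (x : ℂ) ^ 2 / 2))
  have hD : ‖D‖ ≤ ∫ x in Ioi (1 : ℝ), x ^ (μ.re - 2) :=
    norm_integral_le_of_norm_le hJ ((ae_restrict_iff' measurableSet_Ioi).2 (ae_of_all _ hle))
  set Z := ((1 : ℝ) : ℂ) ^ (μ - 1) * Complex.exp (-(s * ((1 : ℝ) : ℂ) ^ 2 / 2))
  have hZ : ‖Z‖ ≤ 1 := by
    rw [hnorm _ 1 one_pos]
    simp
    linarith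
  have e : s * B = (μ - 1) * D + Z := by linear_combination -key
  calc ‖B‖ ≤ ‖s‖ * ‖B‖ := le_mul_of_one_le_left (norm_nonneg _) hs1
    _ = ‖(μ - 1) * D + Z‖ := by rw [← norm_mul, e]
    _ ≤ ‖μ - 1‖ * ‖D‖ + ‖Z‖ := by
      refine (norm_add_le _ _).trans ?_
      rw [norm_mul]
    _ ≤ _ := by gcongr


theorem cpow_half_eq (m : ℕ) (b : ℝ) {x : ℝ} (hx : 0 < x) :
    (x : ℂ) ^ ((m : ℂ) - 1 / 2 - Complex.I * b) =
      (x : ℂ) ^ m / (√x : ℝ) * Complex.exp (-(Complex.I * b * (log x : ℝ))) := by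
  have hxC : (x : ℂ) ≠ 0 := by exact_mod_cast hx.ne'
  rw [Complex.cpow_sub _ _ hxC, Complex.cpow_sub _ _ hxC, Complex.cpow_natCast,
    Real.sqrt_eq_rpow, Complex.ofReal_cpow hx.le,
    Complex.cpow_def_of_ne_zero hxC (Complex.I * b), ← Complex.ofReal_log hx.le,
    Complex.exp_neg, div_eq_mul_inv _ (Complex.exp _)]
  push_cast
  ring_nf

namespace WeberSol

variable {b : ℝ} {y y' : ℝ → ℝ}

/-- Insert `y = (g + conj g) / √x`. The kernel turns `C e^{iθ}` into the non-oscillating power `x^{m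
- 1/2 - ib}` with Gaussian damping, and its conjugate into a term that oscillates like `e^{-i x² /
2}`; the rest contains only the error of the asymptotic form. -/
theorem kernel_mul_sub_eq (y y' : ℝ → ℝ) (b ε : ℝ) (C : ℂ) (m : ℕ) {x : ℝ} (hx : 0 < x) :
    weberKernel m ε x * (y x : ℂ)
      - C * ((x : ℂ) ^ ((m : ℂ) - 1 / 2 - Complex.I * b) * (exp (-(ε / 2) * x ^ 2) : ℝ))
      - star C * ((x : ℂ) ^ ((m : ℂ) - 1 / 2 - Complex.I * ((-b : ℝ) : ℂ)) *
        Complex.exp (-(((ε : ℂ) + Complex.I * (1 : ℝ)) * (x : ℂ) ^ 2 / 2)))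
      = weberKernel m ε x / (√x : ℝ) *
        ((weberAmp y y' x - C * Complex.exp (Complex.I * (weberPhase b x : ℂ)))
          + star (weberAmp y y' x - C * Complex.exp (Complex.I * (weberPhase b x : ℂ)))) := by
  have hs : ((√x : ℝ) : ℂ) ≠ 0 := by exact_mod_cast (Real.sqrt_pos.2 hx).ne'
  have hy : (y x : ℂ) = (weberAmp y y' x + star (weberAmp y y' x)) / (√x : ℝ) := by
    rw [eq_div_iff hs, Complex.star_def, Complex.add_conj, weberAmp]
    push_cast
    ring
  have hst : star (C * Complex.exp (Complex.I * (weberPhase b x : ℂ))) =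
      star C * Complex.exp (-(Complex.I * (weberPhase b x : ℂ))) := by
    rw [star_mul', Complex.star_def, ← Complex.exp_conj]
    simp
  rw [cpow_half_eq m b hx, cpow_half_eq m (-b) hx, hy, star_sub, hst, weberKernel]
  have e1 : Complex.exp (-(((ε : ℂ) + Complex.I / 2) * (x : ℂ) ^ 2 / 2)) *
      Complex.exp (Complex.I * (weberPhase b x : ℂ)) =
      Complex.exp (-(Complex.I * b * (log x : ℝ))) * (exp (-(ε / 2) * x ^ 2) : ℝ) := by
    rw [Complex.ofReal_exp, ← Complex.exp_add, ← Complex.exp_add, weberPhase]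
    congr 1; push_cast; ring
  have e2 : Complex.exp (-(((ε : ℂ) + Complex.I / 2) * (x : ℂ) ^ 2 / 2)) *
      Complex.exp (-(Complex.I * (weberPhase b x : ℂ))) =
      Complex.exp (-(Complex.I * ((-b : ℝ) : ℂ) * (log x : ℝ))) *
        Complex.exp (-(((ε : ℂ) + Complex.I * (1 : ℝ)) * (x : ℂ) ^ 2 / 2)) := by
    rw [← Complex.exp_add, ← Complex.exp_add, weberPhase]
    congr 1; push_cast; ring
  linear_combination (C * (x : ℂ) ^ m / (√x : ℝ)) * e1 + (star C * (x : ℂ) ^ m / (√x : ℝ)) * e2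

/-- Only the non-oscillating part can be unbounded as `ε → 0`. On `(0, 1]` everything has an
integrable majorant. Beyond `1` the oscillating part is controlled by one integration by parts, and
the error is at most a multiple of `x^{1 - 1/2 - 2} = x^{-3/2}`. -/
theorem exists_laplace_sub_le (h : WeberSol b y y') {m : ℕ} (hm : IsBasic m y y') {C : ℂ} {K : ℝ}
    (hC : ∀ x, 1 ≤ x → ‖weberAmp y y' x - C * Complex.exp (Complex.I * (weberPhase b x : ℂ))‖
      ≤ K / x ^ 2) :
    ∃ N, ∀ ε, 0 < ε → ‖weberLaplace y m ε - C * ∫ x in Ioi (0 : ℝ),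
      (x : ℂ) ^ ((m : ℂ) - 1 / 2 - Complex.I * b) * (exp (-(ε / 2) * x ^ 2) : ℝ)‖ ≤ N := by
  have hm1 : m ≤ 1 := by rcases hm with ⟨rfl, -⟩ | ⟨rfl, -⟩ <;> simp
  have hm1' : (m : ℝ) ≤ 1 := by exact_mod_cast hm1
  have hm0 : (0 : ℝ) ≤ m := Nat.cast_nonneg m
  have hK0 : 0 ≤ K := by have := (norm_nonneg _).trans (hC 1 le_rfl); simpa using this
  have hre : ∀ b : ℝ, ((m : ℂ) - 1 / 2 - Complex.I * b).re = m - 1 / 2 := by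
    intro b
    rw [Complex.sub_re, Complex.sub_re, Complex.natCast_re, mul_comm, Complex.re_ofReal_mul]
    norm_num
  set M := 2 * √(weberGrowth b) with hM
  have hyM : ∀ x, 0 ≤ x → |y x| ≤ M := fun x hx => h.abs_le hm.le_one hx
  set μ : ℂ := (m : ℂ) - 1 / 2 - Complex.I * b with hμ
  set ν : ℂ := (m : ℂ) - 1 / 2 - Complex.I * ((-b : ℝ) : ℂ) with hν
  have hμre : μ.re = m - 1 / 2 := hre b
  have hνre : ν.re = m - 1 / 2 := hre (-b)
  have hJ : IntegrableOn (fun x : ℝ => 2 * K * x ^ (-(3 / 2) : ℝ)) (Ioi 1) :=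
    (integrableOn_Ioi_rpow_of_lt (by norm_num) one_pos).const_mul _
  have hJ0 : IntegrableOn (fun x : ℝ => M + ‖C‖ * x ^ (-(1 / 2) : ℝ)) (Ioc 0 1) := by
    refine Integrable.add (integrableOn_const (by simp)) (Integrable.const_mul ?_ _)
    exact (intervalIntegrable_iff_integrableOn_Ioc_of_le zero_le_one).1
      (intervalIntegral.intervalIntegrable_rpow' (by norm_num))
  refine ⟨(∫ x in Ioc (0 : ℝ) 1, (M + ‖C‖ * x ^ (-(1 / 2) : ℝ))) +
    (‖star C‖ * (‖ν - 1‖ * (∫ x in Ioi (1 : ℝ), x ^ (ν.re - 2)) + 1)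
      + ∫ x in Ioi (1 : ℝ), 2 * K * x ^ (-(3 / 2) : ℝ)), fun ε hε => ?_⟩
  have hexp : ∀ x : ℝ, exp (-(ε / 2) * x ^ 2) ≤ 1 := fun x =>
    exp_le_one_iff.2 (by nlinarith [sq_nonneg x])
  have hI1 := integrableOn_weberKernel_mul h.continuous hyM m hε
  have hI2 := integrableOn_cpow_mul_exp_neg_sq (μ := μ) (by rw [hμre]; linarith) hε
  obtain ⟨hB, hBle⟩ := norm_integral_cpow_mul_cexp_le (μ := ν) (by rw [hνre]; linarith)
    (by rw [hνre]; linarith) hε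
  rw [weberLaplace, ← integral_const_mul, ← integral_sub hI1 (hI2.const_mul C),
    ← Ioc_union_Ioi_eq_Ioi (zero_le_one' ℝ)]
  have hI : IntegrableOn (fun x : ℝ => weberKernel m ε x * (y x : ℂ) -
      C * ((x : ℂ) ^ μ * (exp (-(ε / 2) * x ^ 2) : ℝ))) (Ioi 0) := hI1.sub (hI2.const_mul C)
  rw [← Ioc_union_Ioi_eq_Ioi (zero_le_one' ℝ)] at hI
  rw [setIntegral_union (Ioc_disjoint_Ioi le_rfl) measurableSet_Ioi hI.left_of_union
    hI.right_of_union]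
  refine (norm_add_le _ _).trans (add_le_add ?_ ?_)
  · refine norm_integral_le_of_norm_le hJ0 ((ae_restrict_iff' measurableSet_Ioc).2
      (ae_of_all _ fun x hx => ?_))
    refine (norm_sub_le _ _).trans (add_le_add ?_ ?_)
    · rw [norm_mul, norm_weberKernel m ε hx.1.le, Complex.norm_real, Real.norm_eq_abs]
      calc x ^ m * exp (-(ε / 2) * x ^ 2) * |y x| ≤ 1 * 1 * M := by
            gcongr
            · exact pow_le_one₀ hx.1.le hx.2
            · exact hexp x
            · exact hyM x hx.1.le
        _ = M := by ring
    · rw [norm_mul, norm_mul, Complex.norm_cpow_eq_rpow_re_of_pos hx.1, Complex.norm_real,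
        Real.norm_of_nonneg (exp_pos _).le, hμre]
      gcongr
      calc x ^ ((m : ℝ) - 1 / 2) * exp (-(ε / 2) * x ^ 2) ≤ x ^ (-(1 / 2) : ℝ) * 1 := by
            exact mul_le_mul (Real.rpow_le_rpow_of_exponent_ge hx.1 hx.2 (by linarith)) (hexp x)
              (exp_pos _).le (Real.rpow_nonneg hx.1.le _)
        _ = _ := mul_one _
  · have hB' := hB.const_mul (star C)
    have hR := hI.right_of_union.sub hB'
    have e : ∫ x in Ioi (1 : ℝ), (weberKernel m ε x * (y x : ℂ) -
        C * ((x : ℂ) ^ μ * (exp (-(ε / 2) * x ^ 2) : ℝ))) =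
        star C * (∫ x in Ioi (1 : ℝ), (x : ℂ) ^ ν *
          Complex.exp (-(((ε : ℂ) + Complex.I * (1 : ℝ)) * (x : ℂ) ^ 2 / 2))) +
        ∫ x in Ioi (1 : ℝ), ((weberKernel m ε x * (y x : ℂ) -
          C * ((x : ℂ) ^ μ * (exp (-(ε / 2) * x ^ 2) : ℝ))) - star C * ((x : ℂ) ^ ν *
          Complex.exp (-(((ε : ℂ) + Complex.I * (1 : ℝ)) * (x : ℂ) ^ 2 / 2)))) := by
      have h1 := integral_sub hI.right_of_union hB'
      rw [integral_const_mul] at h1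
      refine (sub_eq_iff_eq_add'.1 h1.symm)
    rw [e]
    refine (norm_add_le _ _).trans (add_le_add ?_ ?_)
    · rw [norm_mul]
      gcongr
    · refine norm_integral_le_of_norm_le hJ ((ae_restrict_iff' measurableSet_Ioi).2
        (ae_of_all _ fun x hx => ?_))
      have hx1 : (1 : ℝ) < x := hx
      have hx0 : (0 : ℝ) < x := one_pos.trans hx
      have hs : 0 < √x := Real.sqrt_pos.2 hx0
      rw [hμ, hν, kernel_mul_sub_eq y y' b ε C m hx0, norm_mul, norm_div,
        norm_weberKernel m ε hx0.le, Complex.norm_real, Real.norm_of_nonneg hs.le]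
      have hd := hC x hx1.le
      set d := weberAmp y y' x - C * Complex.exp (Complex.I * (weberPhase b x : ℂ))
      have hdd : ‖d + star d‖ ≤ 2 * (K / x ^ 2) := by
        refine (norm_add_le _ _).trans ?_
        rw [norm_star]; linarith
      calc x ^ m * exp (-(ε / 2) * x ^ 2) / √x * ‖d + star d‖
          ≤ x ^ 1 * 1 / √x * (2 * (K / x ^ 2)) := by
            gcongr
            · exact hx1.le
            · exact hexp x
        _ = 2 * K * x ^ (-(3 / 2) : ℝ) := by
            rw [show (-(3 / 2) : ℝ) = -1 - 1 / 2 by norm_num, Real.rpow_sub hx0, Real.rpow_neg_one,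
              ← Real.sqrt_eq_rpow]
            field_simp

/-- The connection formula: the amplitude at infinity in terms of the Gamma function. -/
theorem amplitude_mul_eq (h : WeberSol b y y') {m : ℕ} (hm : IsBasic m y y') {C : ℂ} {K : ℝ}
    (hC : ∀ x, 1 ≤ x → ‖weberAmp y y' x - C * Complex.exp (Complex.I * (weberPhase b x : ℂ))‖
      ≤ K / x ^ 2) :
    C * (1 / 2 * (Complex.exp (connP m b * (log 2 : ℝ)) * Complex.Gamma (connP m b))) *
      Complex.exp (connQ m b * (π / 2 * Complex.I)) = (√(π / 2) : ℝ) := by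
  obtain ⟨N, hN⟩ := h.exists_laplace_sub_le hm hC
  have hp : 0 < (connP m b).re := by rw [connP_re]; positivity
  have hA : ∀ ε : ℝ, 0 < ε → ∫ x in Ioi (0 : ℝ),
      (x : ℂ) ^ ((m : ℂ) - 1 / 2 - Complex.I * b) * (exp (-(ε / 2) * x ^ 2) : ℝ) =
      1 / 2 * (Complex.exp (connP m b * (log (2 / ε) : ℝ)) * Complex.Gamma (connP m b)) := by
    intro ε hε
    rw [← integral_cpow_mul_exp_neg_sq hp hε]
    congr 3
    ext x
    congr 2
    rw [connP]; ring
  -- The modulus of `ε^P` is `ε^{(2m+1)/4}`, which tends to zero and removes the bounded error.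
  have hlim : Tendsto (fun ε : ℝ => Complex.exp (connP m b * (log ε : ℝ)) *
      (weberLaplace y m ε - C * ∫ x in Ioi (0 : ℝ),
        (x : ℂ) ^ ((m : ℂ) - 1 / 2 - Complex.I * b) * (exp (-(ε / 2) * x ^ 2) : ℝ)))
      (𝓝[>] 0) (𝓝 0) := by
    have h1 : Tendsto (fun ε : ℝ => ε ^ (connP m b).re * N) (𝓝[>] 0) (𝓝 0) := by
      have := (Real.continuousAt_rpow_const (0 : ℝ) (connP m b).re (Or.inr hp.le)).tendsto
      rw [Real.zero_rpow hp.ne'] at this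
      simpa using (this.mono_left nhdsWithin_le_nhds).mul_const N
    refine squeeze_zero_norm' ?_ h1
    filter_upwards [self_mem_nhdsWithin] with ε hε
    have hε0 : 0 < ε := hε
    rw [norm_mul, Complex.norm_exp, Complex.re_mul_ofReal, Real.rpow_def_of_pos hε0, mul_comm (log ε)]
    gcongr
    exact hN ε hε0
  have hlog : Tendsto (fun ε : ℝ => Complex.exp (connQ m b * Complex.log (ε + Complex.I))) (𝓝[>] 0)
      (𝓝 (Complex.exp (connQ m b * (π / 2 * Complex.I)))) := by
    have hc : ContinuousAt (fun ε : ℝ => Complex.exp (connQ m b * Complex.log (ε + Complex.I))) 0 := by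
      have h3 : ContinuousAt (fun ε : ℝ => Complex.log (ε + Complex.I)) 0 :=
        ContinuousAt.clog (by fun_prop) (add_I_mem_slitPlane 0)
      exact (h3.const_mul _).cexp
    have := hc.tendsto
    rw [Complex.ofReal_zero, zero_add, Complex.log_I] at this
    exact this.mono_left nhdsWithin_le_nhds
  have h2 := (hlim.add_const
    (C * (1 / 2 * (Complex.exp (connP m b * (log 2 : ℝ)) * Complex.Gamma (connP m b))))).mul hlog
  rw [zero_add] at h2
  refine (tendsto_nhds_unique (tendsto_const_nhds.congr' ?_) h2).symm
  filter_upwards [self_mem_nhdsWithin] with ε hε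
  have hε0 : 0 < ε := hε
  rw [← h.laplaceInvariant_eq_sqrt hm hε0, laplaceInvariant, hA ε hε0]
  have e : Complex.exp (connP m b * (log ε : ℝ)) * Complex.exp (connP m b * (log (2 / ε) : ℝ)) =
      Complex.exp (connP m b * (log 2 : ℝ)) := by
    rw [← Complex.exp_add, Real.log_div two_ne_zero hε0.ne']
    congr 1; push_cast; ring
  linear_combination (-C * (1 / 2) * Complex.Gamma (connP m b) *
    Complex.exp (connQ m b * Complex.log (ε + Complex.I))) * (-e)

end WeberSol


/-! ### Connection coefficients and the normalization of `W` -/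

/-- The amplitude at infinity of the even (`m = 0`) and odd (`m = 1`) solution. -/
def connC (m : ℕ) (b : ℝ) : ℂ :=
  2 * (√(π / 2) : ℝ) * Complex.exp (-(connP m b * (log 2 : ℝ))) *
    Complex.exp (-(connQ m b * (π / 2 * Complex.I))) * (Complex.Gamma (connP m b))⁻¹

theorem Gamma_connP_ne_zero (m : ℕ) (b : ℝ) : Complex.Gamma (connP m b) ≠ 0 :=
  Complex.Gamma_ne_zero_of_re_pos (by rw [connP_re]; positivity)

theorem WeberSol.norm_amp_sub_connC_le {b : ℝ} {y y' : ℝ → ℝ} (h : WeberSol b y y') {m : ℕ}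
    (hm : IsBasic m y y') {x : ℝ} (hx : 1 ≤ x) :
    ‖weberAmp y y' x - connC m b * Complex.exp (Complex.I * (weberPhase b x : ℂ))‖
      ≤ 3 * (1 + |b|) ^ 2 * √(weberGrowth b) / x ^ 2 := by
  obtain ⟨C, hC⟩ := h.exists_amplitude hm.le_one
  have h1 := h.amplitude_mul_eq hm hC
  have : C = connC m b := by
    rw [connC, Complex.exp_neg, Complex.exp_neg, ← h1]
    have := Gamma_connP_ne_zero m b
    have h2 := Complex.exp_ne_zero (connP m b * (log 2 : ℝ))
    have h3 := Complex.exp_ne_zero (connQ m b * (π / 2 * Complex.I))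
    field_simp
  rw [← this]
  exact hC x hx

theorem differentiable_connC (m : ℕ) : Differentiable ℝ (connC m) := by
  have hp : Differentiable ℝ (connP m) := by
    unfold connP
    exact fun b => ((differentiableAt_const _).sub
      ((Complex.ofRealCLM.differentiableAt.const_mul _).div_const _))
  have hq : Differentiable ℝ (connQ m) := by
    unfold connQ
    exact fun b => ((differentiableAt_const _).add
      ((Complex.ofRealCLM.differentiableAt.const_mul _).div_const _))
  have hG : Differentiable ℝ fun b => (Complex.Gamma (connP m b))⁻¹ := fun b => by
    refine DifferentiableAt.inv ?_ (Gamma_connP_ne_zero m b)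
    refine DifferentiableAt.comp b (DifferentiableAt.restrictScalars ℝ
      (Complex.differentiableAt_Gamma _ fun k hk => ?_)) (hp b)
    have h1 := congrArg Complex.re hk
    rw [connP_re] at h1
    simp at h1
    have : (0 : ℝ) ≤ k := Nat.cast_nonneg k
    have : (0 : ℝ) ≤ m := Nat.cast_nonneg m
    linarith
  unfold connC
  exact ((((differentiable_const _).mul ((hp.mul_const _).neg.cexp)).mul
    ((hq.mul_const _).neg.cexp))).mul hG

theorem norm_connC_sq (m : ℕ) (b : ℝ) : ‖connC m b‖ ^ 2 =
    2 * π * (2 : ℝ) ^ (-((2 * m + 1) / 2) : ℝ) * exp (π * b / 2) /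
      ‖Complex.Gamma (connP m b)‖ ^ 2 := by
  have e1 : (-(connP m b * (log 2 : ℝ))).re = log 2 * (-((2 * m + 1) / 4)) := by
    rw [Complex.neg_re, Complex.re_mul_ofReal, connP_re]; ring
  have e2 : (-(connQ m b * (π / 2 * Complex.I))).re = π * b / 4 := by
    have : -(connQ m b * (π / 2 * Complex.I)) =
        ((π * b / 4 : ℝ) : ℂ) + ((-(π * (2 * m + 1) / 8) : ℝ) : ℂ) * Complex.I := by
      rw [connQ]; push_cast; linear_combination (-(π * b / 4 : ℂ)) * Complex.I_sq
    rw [this, Complex.add_re, Complex.ofReal_re, Complex.re_ofReal_mul, Complex.I_re]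
    ring
  rw [connC, norm_mul, norm_mul, norm_mul, norm_mul, Complex.norm_exp, Complex.norm_exp, e1, e2,
    norm_inv, Complex.norm_real, Complex.norm_two, Real.norm_of_nonneg (Real.sqrt_nonneg _),
    ← Real.rpow_def_of_pos two_pos]
  have e3 : ((2 : ℝ) ^ (-((2 * m + 1) / 4) : ℝ)) ^ 2 = (2 : ℝ) ^ (-((2 * m + 1) / 2) : ℝ) := by
    rw [← Real.rpow_natCast, ← Real.rpow_mul two_pos.le]
    congr 1; push_cast; ring
  have e4 : exp (π * b / 4) ^ 2 = exp (π * b / 2) := by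
    rw [← Real.exp_nat_mul]; congr 1; push_cast; ring
  have e5 : √(π / 2) ^ 2 = π / 2 := Real.sq_sqrt (by positivity)
  rw [mul_pow, mul_pow, mul_pow, mul_pow, e3, e4, e5, inv_pow]
  ring

theorem norm_Gamma_connP_zero (b : ℝ) : ‖Complex.Gamma (connP 0 b)‖ = weberG1 b := by
  rw [weberG1, ← RCLike.norm_conj (Complex.Gamma _), ← Complex.Gamma_conj]
  congr 2
  simp [connP, Complex.conj_ofNat]
  ring

theorem norm_Gamma_connP_one (b : ℝ) : ‖Complex.Gamma (connP 1 b)‖ = weberG3 b := by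
  rw [weberG3, ← RCLike.norm_conj (Complex.Gamma _), ← Complex.Gamma_conj]
  congr 2
  simp [connP, Complex.conj_ofNat]
  ring

theorem weberG1_pos (b : ℝ) : 0 < weberG1 b := by
  rw [← norm_Gamma_connP_zero]; exact norm_pos_iff.2 (Gamma_connP_ne_zero 0 b)

theorem weberG3_pos (b : ℝ) : 0 < weberG3 b := by
  rw [← norm_Gamma_connP_one]; exact norm_pos_iff.2 (Gamma_connP_ne_zero 1 b)

/-- The reflection formula at `1/4 + i b / 2`, whose partner `3/4 - i b / 2` is conjugate to the
argument in `weberG3`, together with `|sin (π/4 + i π b / 2)|² = cosh (π b) / 2`. -/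
theorem weberG1_mul_weberG3_sq (b : ℝ) : (weberG1 b * weberG3 b) ^ 2 = 2 * π ^ 2 / cosh (π * b) := by
  have h1 := Complex.Gamma_mul_Gamma_one_sub (1 / 4 + Complex.I * (b : ℂ) / 2)
  have e1 : (1 : ℂ) - (1 / 4 + Complex.I * (b : ℂ) / 2) = connP 1 b := by
    rw [connP]; push_cast; ring
  have e2 : (π : ℂ) * (1 / 4 + Complex.I * (b : ℂ) / 2) =
      ((π / 4 : ℝ) : ℂ) + ((π * b / 2 : ℝ) : ℂ) * Complex.I := by push_cast; ring
  rw [e1, e2] at h1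
  have h2 := congrArg (fun z => ‖z‖ ^ 2) h1
  simp only [norm_mul, norm_div] at h2
  rw [norm_Gamma_connP_one, ← weberG1, div_pow, Complex.norm_real, Real.norm_of_nonneg pi_pos.le]
    at h2
  have h3 : ‖Complex.sin (((π / 4 : ℝ) : ℂ) + ((π * b / 2 : ℝ) : ℂ) * Complex.I)‖ ^ 2
      = cosh (π * b) / 2 := by
    rw [Complex.sin_add, Complex.cos_mul_I, Complex.sin_mul_I, ← Complex.normSq_eq_norm_sq,
      ← Complex.ofReal_sin, ← Complex.ofReal_cos, ← Complex.ofReal_cosh, ← Complex.ofReal_sinh,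
      ← mul_assoc, ← Complex.ofReal_mul, ← Complex.ofReal_mul, Complex.normSq_add_mul_I,
      Real.sin_pi_div_four, Real.cos_pi_div_four, show π * b = 2 * (π * b / 2) by ring,
      Real.cosh_two_mul, mul_pow, mul_pow, div_pow, Real.sq_sqrt (by norm_num)]
    rw [show 2 * (π * b / 2) / 2 = π * b / 2 by ring]
    ring
  rw [h2, h3]
  field_simp

theorem half_pi_exp_div (b : ℝ) :
    π / 2 * exp (π * b / 2) / (weberG1 b * weberG3 b) = √(1 + exp (2 * π * b)) / 4 := by
  have hp : 0 < weberG1 b * weberG3 b := mul_pos (weberG1_pos b) (weberG3_pos b)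
  rw [← sq_eq_sq₀ (by positivity) (by positivity), div_pow, weberG1_mul_weberG3_sq, div_pow,
    Real.sq_sqrt (by positivity), mul_pow]
  have e1 : exp (π * b / 2) ^ 2 = exp (π * b) := by
    rw [← Real.exp_nat_mul]; congr 1; push_cast; ring
  have e2 : exp (2 * π * b) = exp (π * b) * exp (π * b) := by
    rw [← Real.exp_add]; congr 1; ring
  have e3 : exp (π * b) * cosh (π * b) = (exp (π * b) * exp (π * b) + 1) / 2 := by
    rw [Real.cosh_eq, Real.exp_neg]
    have := exp_pos (π * b)
    field_simp
  rw [e1, e2]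
  have := cosh_pos (π * b)
  field_simp
  linear_combination 16 * e3

/-- The coefficients of the even and the odd solution in `weberW`. -/
def weberWeight (m : ℕ) (b : ℝ) : ℝ :=
  if m = 0 then (2 : ℝ) ^ (-(3 / 4) : ℝ) * √(weberG1 b / weberG3 b)
  else -((2 : ℝ) ^ (-(1 / 4) : ℝ) * √(weberG3 b / weberG1 b))

/-- The Gamma quotient in the weight turns `|Γ(P)|⁻²` into `1 / (weberG1 b * weberG3 b)`, which is
the same for both parities; the powers of two also agree. This is the effect of the normalization of
`W`. -/
theorem weberWeight_sq_mul_norm_connC_sq {m : ℕ} (hm : m = 0 ∨ m = 1) (b : ℝ) :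
    weberWeight m b ^ 2 * ‖connC m b‖ ^ 2 = √(1 + exp (2 * π * b)) / 4 := by
  have h1 := weberG1_pos b
  have h3 := weberG3_pos b
  have hpow : ∀ s t : ℝ, s * 2 + t = -2 → ((2 : ℝ) ^ s) ^ 2 * (2 : ℝ) ^ t = 1 / 4 := by
    intro s t hst
    rw [← Real.rpow_natCast, ← Real.rpow_mul two_pos.le, ← Real.rpow_add two_pos]
    push_cast
    rw [hst, Real.rpow_neg two_pos.le]
    norm_num
  rw [← half_pi_exp_div, norm_connC_sq]
  rcases hm with rfl | rfl
  · have h := hpow (-(3 / 4)) (-((2 * (0 : ℕ) + 1) / 2)) (by norm_num)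
    rw [weberWeight, if_pos rfl, mul_pow, Real.sq_sqrt (by positivity), norm_Gamma_connP_zero]
    calc _ = (((2 : ℝ) ^ (-(3 / 4) : ℝ)) ^ 2 * (2 : ℝ) ^ (-((2 * (0 : ℕ) + 1) / 2) : ℝ)) *
          (2 * π * exp (π * b / 2) / (weberG1 b * weberG3 b)) := by field_simp
      _ = _ := by rw [h]; ring
  · have h := hpow (-(1 / 4)) (-((2 * (1 : ℕ) + 1) / 2)) (by norm_num)
    rw [weberWeight, if_neg one_ne_zero, neg_sq, mul_pow, Real.sq_sqrt (by positivity),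
      norm_Gamma_connP_one]
    calc _ = (((2 : ℝ) ^ (-(1 / 4) : ℝ)) ^ 2 * (2 : ℝ) ^ (-((2 * (1 : ℕ) + 1) / 2) : ℝ)) *
          (2 * π * exp (π * b / 2) / (weberG1 b * weberG3 b)) := by field_simp
      _ = _ := by rw [h]; ring

theorem differentiable_norm_Gamma {c : ℂ} (hc : 0 < c.re) :
    Differentiable ℝ fun b : ℝ => ‖Complex.Gamma (c + Complex.I * (b : ℂ) / 2)‖ := by
  intro b
  have hre : (c + Complex.I * (b : ℂ) / 2).re = c.re := by
    have : Complex.I * (b : ℂ) / 2 = ((b / 2 : ℝ) : ℂ) * Complex.I := by push_cast; ring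
    rw [this, Complex.add_re, Complex.re_ofReal_mul, Complex.I_re]
    ring
  refine DifferentiableAt.norm ℝ ?_ (Complex.Gamma_ne_zero_of_re_pos (by rwa [hre]))
  refine DifferentiableAt.comp b (g := Complex.Gamma) (DifferentiableAt.restrictScalars ℝ
    (Complex.differentiableAt_Gamma _ fun k hk => ?_)) ?_
  · have h1 := congrArg Complex.re hk
    rw [hre] at h1
    simp at h1
    have : (0 : ℝ) ≤ k := Nat.cast_nonneg k
    linarith
  · exact ((differentiableAt_const _).add
      ((Complex.ofRealCLM.differentiableAt.const_mul _).div_const _))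

theorem differentiable_weberWeight (m : ℕ) : Differentiable ℝ (weberWeight m) := by
  have h1 : Differentiable ℝ weberG1 := differentiable_norm_Gamma (by norm_num)
  have h3 : Differentiable ℝ weberG3 := differentiable_norm_Gamma (by norm_num)
  have p1 := weberG1_pos
  have p3 := weberG3_pos
  unfold weberWeight
  split_ifs
  · exact fun b => (((h1 b).div (h3 b) (p3 b).ne').sqrt (div_pos (p1 b) (p3 b)).ne').const_mul _
  · exact fun b =>
      ((((h3 b).div (h1 b) (p1 b).ne').sqrt (div_pos (p3 b) (p1 b)).ne').const_mul _).neg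

theorem norm_betaIntegral_le (u v : ℂ) : ‖Complex.betaIntegral u v‖ ≤
    ∫ x in Ioo (0 : ℝ) 1, x ^ (u.re - 1) * (1 - x) ^ (v.re - 1) := by
  rw [Complex.betaIntegral, intervalIntegral.integral_of_le zero_le_one,
    integral_Ioc_eq_integral_Ioo]
  refine (norm_integral_le_integral_norm _).trans (le_of_eq ?_)
  refine setIntegral_congr_fun measurableSet_Ioo fun x hx => ?_
  have h1 : (1 : ℂ) - x = ((1 - x : ℝ) : ℂ) := by push_cast; ring
  rw [norm_mul, h1, Complex.norm_cpow_eq_rpow_re_of_pos hx.1,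
    Complex.norm_cpow_eq_rpow_re_of_pos (by linarith [hx.2])]
  simp

/-- From `Γ(s) Γ(1/2) = Γ(s + 1/2) B(s, 1/2)` and the bound of the Beta integral by its value at `Re
s` one gets `|Γ(s)| ≤ L |Γ(s + 1/2)|` on vertical lines. At `Re s = 1/4` this bounds `weberG1 /
weberG3`. At `Re s = 3/4` it bounds `weberG3` by `|Γ(5/4 + i b / 2)| = |1/4 + i b / 2| · weberG1`,
hence the linear factor. -/
theorem exists_weberWeight_le (m : ℕ) : ∃ K, ∀ b, |weberWeight m b| ≤ K * (1 + |b|) := by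
  have hre : ∀ (c b : ℝ), ((c : ℂ) + Complex.I * (b : ℂ) / 2).re = c := by
    intro c b
    have : Complex.I * (b : ℂ) / 2 = ((b / 2 : ℝ) : ℂ) * Complex.I := by push_cast; ring
    rw [this, Complex.add_re, Complex.re_ofReal_mul, Complex.I_re]
    simp
  have hsqrt : ∀ t : ℝ, 0 ≤ t → √t ≤ 1 + t := fun t ht => by
    rw [Real.sqrt_le_left (by linarith)]; nlinarith
  have hpi : ‖Complex.Gamma (1 / 2)‖ = √π := by
    have h := Complex.Gamma_ofReal (1 / 2)
    rw [Real.Gamma_one_half_eq] at h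
    push_cast at h
    rw [h, Complex.norm_real, Real.norm_of_nonneg (Real.sqrt_nonneg _)]
  have hsp : 0 < √π := Real.sqrt_pos.2 pi_pos
  have key : ∀ c : ℝ, 0 < c → ∃ L, 0 ≤ L ∧ ∀ b : ℝ,
      ‖Complex.Gamma ((c : ℂ) + Complex.I * (b : ℂ) / 2)‖ ≤
      L * ‖Complex.Gamma ((c : ℂ) + Complex.I * (b : ℂ) / 2 + 1 / 2)‖ := by
    intro c hc
    refine ⟨(∫ x in Ioo (0 : ℝ) 1, x ^ (c - 1) * (1 - x) ^ ((1 / 2 : ℂ).re - 1)) / √π, ?_,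
      fun b => ?_⟩
    · refine div_nonneg (setIntegral_nonneg measurableSet_Ioo fun x hx => ?_) hsp.le
      have := hx.1
      have : 0 ≤ 1 - x := by linarith [hx.2]
      positivity
    · have h1 := Complex.Gamma_mul_Gamma_eq_betaIntegral
        (s := (c : ℂ) + Complex.I * (b : ℂ) / 2) (t := 1 / 2) (by rwa [hre]) (by norm_num)
      have h2 := congrArg norm h1
      rw [norm_mul, norm_mul, hpi] at h2
      have h3 := norm_betaIntegral_le ((c : ℂ) + Complex.I * (b : ℂ) / 2) (1 / 2)
      rw [hre] at h3
      rw [div_mul_eq_mul_div, le_div_iff₀ hsp, h2, mul_comm]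
      gcongr
  obtain ⟨L1, hL1, h1⟩ := key (1 / 4) (by norm_num)
  obtain ⟨L3, hL3, h3⟩ := key (3 / 4) (by norm_num)
  have g1 : ∀ b, weberG1 b / weberG3 b ≤ L1 := fun b => by
    have h := h1 b
    rw [show ((1 / 4 : ℝ) : ℂ) + Complex.I * (b : ℂ) / 2 + 1 / 2 =
      3 / 4 + Complex.I * (b : ℂ) / 2 by push_cast; ring] at h
    rw [div_le_iff₀ (weberG3_pos b), weberG1, weberG3]
    push_cast at h
    exact h
  have g3 : ∀ b, weberG3 b / weberG1 b ≤ L3 * (1 + |b|) := fun b => by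
    rw [div_le_iff₀ (weberG1_pos b)]
    have h4 := h3 b
    have e1 : ((3 / 4 : ℝ) : ℂ) + Complex.I * (b : ℂ) / 2 + 1 / 2 =
        (1 / 4 + Complex.I * (b : ℂ) / 2) + 1 := by push_cast; ring
    have hne : (1 / 4 + Complex.I * (b : ℂ) / 2) ≠ 0 := fun h => by
      have := hre (1 / 4) b
      push_cast at this
      rw [h] at this
      norm_num at this
    rw [e1, Complex.Gamma_add_one _ hne, norm_mul] at h4
    have e2 : ‖(1 / 4 + Complex.I * (b : ℂ) / 2)‖ ≤ 1 + |b| := by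
      refine (norm_add_le _ _).trans ?_
      rw [norm_div (Complex.I * (b : ℂ)), norm_mul, Complex.norm_I, Complex.norm_real,
        Real.norm_eq_abs]
      norm_num
      linarith [abs_nonneg b]
    have e3 : weberG3 b = ‖Complex.Gamma (((3 / 4 : ℝ) : ℂ) + Complex.I * (b : ℂ) / 2)‖ := by
      rw [weberG3]; push_cast; ring_nf
    rw [e3]
    refine h4.trans ?_
    rw [← weberG1, ← mul_assoc]
    have := (weberG1_pos b).le
    gcongr
  have two1 : ∀ s : ℝ, s ≤ 0 → (2 : ℝ) ^ s ≤ 1 := fun s hs =>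
    Real.rpow_le_one_of_one_le_of_nonpos one_le_two hs
  refine ⟨1 + L1 + L3, fun b => ?_⟩
  have hb := abs_nonneg b
  have p1 := weberG1_pos b
  have p3 := weberG3_pos b
  unfold weberWeight
  split_ifs
  · rw [abs_of_nonneg (by positivity)]
    calc _ ≤ 1 * (1 + L1) := by
          gcongr
          · exact two1 _ (by norm_num)
          · exact (hsqrt _ (by positivity)).trans (by linarith [g1 b])
      _ ≤ _ := by nlinarith [mul_nonneg hL1 hb, mul_nonneg hL3 hb]
  · rw [abs_neg, abs_of_nonneg (by positivity)]
    calc _ ≤ 1 * (1 + L3 * (1 + |b|)) := by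
          gcongr
          · exact two1 _ (by norm_num)
          · exact (hsqrt _ (by positivity)).trans (by linarith [g3 b])
      _ ≤ _ := by nlinarith [mul_nonneg hL1 hb, mul_nonneg hL3 hb]


/-! ### Integrability against the growth bound -/

/-- One term of the exponential series; `384 = 4³ · 3!`. -/
theorem cube_le_exp {t : ℝ} (ht : 0 ≤ t) : t ^ 3 ≤ 384 * exp (t / 4) := by
  have h := Real.pow_div_factorial_le_exp (t / 4) (by positivity) 3
  norm_num [Nat.factorial] at h
  rw [div_pow, div_div, div_le_iff₀ (by norm_num)] at h
  linarith

theorem growth_le (b : ℝ) : (1 + |b|) * √(weberGrowth b) ≤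
    2 * (1 + |b|) ^ 2 * exp ((3 * (b + (1 + |b|)) + 3 / 8 * (1 + |b|) + 9 / 4) / 2) := by
  have hb := abs_nonneg b
  have h : √(weberGrowth b) ≤
      2 * (1 + |b|) * exp ((3 * (b + (1 + |b|)) + 3 / 8 * (1 + |b|) + 9 / 4) / 2) := by
    rw [Real.sqrt_le_left (by positivity), weberGrowth]
    set T := 3 * (b + (1 + |b|)) + 3 / 8 * (1 + |b|) + 9 / 4
    have : exp (T / 2) ^ 2 = exp T := by rw [← Real.exp_nat_mul]; congr 1; push_cast; ring
    rw [mul_pow, this]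
    gcongr
    nlinarith
  calc _ ≤ (1 + |b|) *
        (2 * (1 + |b|) * exp ((3 * (b + (1 + |b|)) + 3 / 8 * (1 + |b|) + 9 / 4) / 2)) := by gcongr
    _ = _ := by ring

/-- Here `b + |b| = 0`. The rate left in `|b|` is `3/16` from the square root of the growth bound
plus `1/4` from absorbing the cubic polynomial, and `7/16 < π / 4`. -/
theorem growth_le_neg {b : ℝ} (hb : b ≤ -1) : (1 + |b|) * √(weberGrowth b) ≤
    768 * exp 4 * (exp (π * |b| / 4) / |b|) := by
  have hpos : 0 < |b| := abs_pos.2 (by linarith)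
  have hab : |b| = -b := abs_of_neg (by linarith)
  rw [mul_div_assoc', le_div_iff₀ hpos]
  have hc := cube_le_exp (t := 1 + |b|) (by positivity)
  have hpi := pi_gt_three
  calc (1 + |b|) * √(weberGrowth b) * |b| ≤ 2 * (1 + |b|) ^ 2 *
        exp ((3 * (b + (1 + |b|)) + 3 / 8 * (1 + |b|) + 9 / 4) / 2) * (1 + |b|) := by
        exact mul_le_mul (growth_le b) (by linarith) hpos.le (by positivity)
    _ = 2 * (1 + |b|) ^ 3 * exp ((3 * (b + (1 + |b|)) + 3 / 8 * (1 + |b|) + 9 / 4) / 2) := by ring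
    _ ≤ 2 * (384 * exp ((1 + |b|) / 4)) *
        exp ((3 * (b + (1 + |b|)) + 3 / 8 * (1 + |b|) + 9 / 4) / 2) := by gcongr
    _ = 768 * exp ((1 + |b|) / 4 + (3 * (b + (1 + |b|)) + 3 / 8 * (1 + |b|) + 9 / 4) / 2) := by
        rw [Real.exp_add]; ring
    _ ≤ 768 * exp (4 + π * |b| / 4) := by
        rw [hab]
        refine mul_le_mul_of_nonneg_left (Real.exp_le_exp.2 ?_) (by norm_num)
        nlinarith
    _ = _ := by rw [Real.exp_add]; ring

/-- Here `b + |b| = 2b`, and the rate is `3 + 3/16 + 1/4 = 55/16 < 5π / 4`. -/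
theorem growth_le_pos {b : ℝ} (hb : 1 ≤ b) : (1 + |b|) * √(weberGrowth b) ≤
    768 * exp 4 * (exp (5 * π * b / 4) / b) := by
  have hpos : 0 < b := by linarith
  have hab : |b| = b := abs_of_pos hpos
  rw [mul_div_assoc', le_div_iff₀ hpos]
  have hc := cube_le_exp (t := 1 + |b|) (by positivity)
  have hpi := pi_gt_three
  calc (1 + |b|) * √(weberGrowth b) * b ≤ 2 * (1 + |b|) ^ 2 *
        exp ((3 * (b + (1 + |b|)) + 3 / 8 * (1 + |b|) + 9 / 4) / 2) * (1 + |b|) := by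
        exact mul_le_mul (growth_le b) (by linarith) hpos.le (by positivity)
    _ = 2 * (1 + |b|) ^ 3 * exp ((3 * (b + (1 + |b|)) + 3 / 8 * (1 + |b|) + 9 / 4) / 2) := by ring
    _ ≤ 2 * (384 * exp ((1 + |b|) / 4)) *
        exp ((3 * (b + (1 + |b|)) + 3 / 8 * (1 + |b|) + 9 / 4) / 2) := by gcongr
    _ = 768 * exp ((1 + |b|) / 4 + (3 * (b + (1 + |b|)) + 3 / 8 * (1 + |b|) + 9 / 4) / 2) := by
        rw [Real.exp_add]; ring
    _ ≤ 768 * exp (4 + 5 * π * b / 4) := by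
        rw [hab]
        refine mul_le_mul_of_nonneg_left (Real.exp_le_exp.2 ?_) (by norm_num)
        nlinarith
    _ = _ := by rw [Real.exp_add]; ring

theorem PiecewiseC1.integrable_mul_growth {φ : ℝ → ℝ} (hφ : PiecewiseC1 φ)
    (hneg : IntegrableOn (fun x : ℝ => |φ x| * exp (π * |x| / 4) / |x|) (Iic (-1)) volume)
    (hpos : IntegrableOn (fun x : ℝ => |φ x| * exp (5 * π * x / 4) / x) (Ici 1) volume) :
    Integrable fun b => |φ b| * ((1 + |b|) * √(weberGrowth b)) := by
  have hc : Continuous fun b => (1 + |b|) * √(weberGrowth b) := by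
    have := continuous_weberGrowth
    fun_prop
  have hm : AEStronglyMeasurable (fun b => |φ b| * ((1 + |b|) * √(weberGrowth b))) volume :=
    (continuous_abs.comp_aestronglyMeasurable hφ.aestronglyMeasurable).mul hc.aestronglyMeasurable
  have hnn : ∀ b, 0 ≤ |φ b| * ((1 + |b|) * √(weberGrowth b)) := fun b => by positivity
  have h1 : IntegrableOn (fun b => |φ b| * ((1 + |b|) * √(weberGrowth b))) (Iic (-1)) := by
    refine (hneg.const_mul (768 * exp 4)).mono' hm.restrict
      ((ae_restrict_iff' measurableSet_Iic).2 (ae_of_all _ fun b hb => ?_))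
    rw [Real.norm_of_nonneg (hnn b)]
    calc _ ≤ |φ b| * (768 * exp 4 * (exp (π * |b| / 4) / |b|)) := by
          exact mul_le_mul_of_nonneg_left (growth_le_neg hb) (abs_nonneg _)
      _ = _ := by ring
  have h2 : IntegrableOn (fun b => |φ b| * ((1 + |b|) * √(weberGrowth b))) (Ici 1) := by
    refine (hpos.const_mul (768 * exp 4)).mono' hm.restrict
      ((ae_restrict_iff' measurableSet_Ici).2 (ae_of_all _ fun b hb => ?_))
    rw [Real.norm_of_nonneg (hnn b)]
    calc _ ≤ |φ b| * (768 * exp 4 * (exp (5 * π * b / 4) / b)) := by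
          exact mul_le_mul_of_nonneg_left (growth_le_pos hb) (abs_nonneg _)
      _ = _ := by ring
  have h3 : IntegrableOn (fun b => |φ b| * ((1 + |b|) * √(weberGrowth b))) (Icc (-1) 1) := by
    obtain ⟨K, hK⟩ := hφ.exists_bound (-1) 1
    obtain ⟨L, hL⟩ := isCompact_Icc.exists_bound_of_continuousOn
      (hc.continuousOn (s := Icc (-1 : ℝ) 1))
    refine Measure.integrableOn_of_bounded (M := K * L) (by simp) hm
      ((ae_restrict_iff' measurableSet_Icc).2 (ae_of_all _ fun b hb => ?_))
    rw [norm_mul, Real.norm_of_nonneg (abs_nonneg _)]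
    have := (abs_nonneg _).trans (hK b hb)
    gcongr
    · exact hK b hb
    · exact hL b hb
  rw [← integrableOn_univ]
  refine ((h1.union h3).union h2).mono_set fun b _ => ?_
  rcases le_total b (-1) with h | h
  · exact Or.inl (Or.inl h)
  · rcases le_total b 1 with h' | h'
    · exact Or.inl (Or.inr ⟨h, h'⟩)
    · exact Or.inr h'

/-! ### The truncated inner product of two solutions -/

/-- The asymptotic form of the amplitude. -/
def asympAmp (m : ℕ) (b x : ℝ) : ℂ := connC m b * Complex.exp (Complex.I * (weberPhase b x : ℂ))

theorem norm_asympAmp (m : ℕ) (b x : ℝ) : ‖asympAmp m b x‖ = ‖connC m b‖ := by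
  rw [asympAmp, norm_mul, mul_comm Complex.I, Complex.norm_exp_ofReal_mul_I, mul_one]

theorem star_asympAmp_mul (m : ℕ) (a b x : ℝ) : star (asympAmp m a x) * asympAmp m b x =
    star (connC m a) * connC m b * Complex.exp (Complex.I * ((log x * (a - b) : ℝ) : ℂ)) := by
  have h : star (Complex.exp (Complex.I * (weberPhase a x : ℂ))) =
      Complex.exp (-(Complex.I * (weberPhase a x : ℂ))) := by
    rw [Complex.star_def, ← Complex.exp_conj]; simp
  have e : Complex.exp (-(Complex.I * (weberPhase a x : ℂ))) *
      Complex.exp (Complex.I * (weberPhase b x : ℂ)) =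
      Complex.exp (Complex.I * ((log x * (a - b) : ℝ) : ℂ)) := by
    rw [← Complex.exp_add, weberPhase, weberPhase]; congr 1; push_cast; ring
  rw [asympAmp, asympAmp, star_mul', h, ← e]
  ring

namespace WeberSol

variable {a b : ℝ} {y y' z z' : ℝ → ℝ}

/-- Lagrange identity: the Wronskian `y' z - y z'` has derivative `(a - b) y z`. -/
theorem sub_mul_integral_eq (hy : WeberSol a y y') (hz : WeberSol b z z')
    (h0 : y' 0 * z 0 - y 0 * z' 0 = 0) (R : ℝ) :
    (a - b) * ∫ x in (0 : ℝ)..R, y x * z x = y' R * z R - y R * z' R := by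
  have hd : ∀ x, HasDerivAt (fun x => y' x * z x - y x * z' x) ((a - b) * (y x * z x)) x := by
    intro x
    refine (((hy.2 x).mul (hz.1 x)).sub ((hy.1 x).mul (hz.2 x))).congr_deriv ?_
    ring
  have h1 := intervalIntegral.integral_eq_sub_of_hasDerivAt (fun x _ => hd x)
    (a := 0) (b := R) (Continuous.intervalIntegrable (by
      have := hy.continuous; have := hz.continuous; fun_prop) _ _)
  rw [intervalIntegral.integral_const_mul] at h1
  rw [h1, h0, sub_zero]

theorem wronskian_eq_im {x : ℝ} (hx : 0 < x) (y y' z z' : ℝ → ℝ) :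
    y' x * z x - y x * z' x = 2 * (star (weberAmp y y' x) * weberAmp z z' x).im := by
  have hs : √x ≠ 0 := (Real.sqrt_pos.2 hx).ne'
  simp only [weberAmp, Complex.star_def, Complex.mul_im, Complex.conj_re, Complex.conj_im]
  field_simp
  ring

theorem mul_eq_re {x : ℝ} (hx : 0 < x) (y y' z z' : ℝ → ℝ) :
    y x * z x / 4 + y' x * z' x / x ^ 2 =
      (star (weberAmp y y' x) * weberAmp z z' x).re / x := by
  simp only [weberAmp, Complex.star_def, Complex.mul_re, Complex.conj_re, Complex.conj_im]
  generalize y x = Y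
  generalize y' x = Y'
  generalize z x = Z
  generalize z' x = Z'
  obtain ⟨s, hs, rfl⟩ : ∃ s : ℝ, 0 < s ∧ x = s ^ 2 :=
    ⟨√x, Real.sqrt_pos.2 hx, (Real.sq_sqrt hx.le).symm⟩
  rw [Real.sqrt_sq hs.le]
  field_simp
  ring

/-- The bound for `weberAmp` passes to the limit `x → ∞`. -/
theorem norm_connC_le (h : WeberSol b y y') {m : ℕ} (hm : IsBasic m y y') :
    ‖connC m b‖ ≤ √(weberGrowth b) := by
  have h1 : Tendsto (fun x : ℝ => √(weberGrowth b) +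
      3 * (1 + |b|) ^ 2 * √(weberGrowth b) / x ^ 2) atTop (𝓝 (√(weberGrowth b) + 0)) :=
    tendsto_const_nhds.add (tendsto_const_nhds.div_atTop (tendsto_pow_atTop two_ne_zero))
  rw [add_zero] at h1
  refine ge_of_tendsto h1 ?_
  filter_upwards [eventually_ge_atTop 1] with x hx
  have h2 := h.norm_amp_sub_connC_le hm hx
  have h3 := h.norm_amp_le hm.le_one hx
  rw [← norm_asympAmp m b x]
  have h4 := norm_sub_norm_le (asympAmp m b x) (weberAmp y y' x)
  rw [norm_sub_rev] at h4
  have h5 : ‖weberAmp y y' x - asympAmp m b x‖ ≤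
    3 * (1 + |b|) ^ 2 * √(weberGrowth b) / x ^ 2 := h2
  linarith

end WeberSol

theorem norm_star_mul_sub_le (g G k K : ℂ) :
    ‖star g * k - star G * K‖ ≤ ‖g - G‖ * ‖k‖ + ‖G‖ * ‖k - K‖ := by
  have e : star g * k - star G * K = star (g - G) * k + star G * (k - K) := by
    rw [star_sub]; ring
  rw [e]
  refine (norm_add_le _ _).trans ?_
  rw [norm_mul, norm_mul, norm_star, norm_star]


theorem one_le_weberGrowth (b : ℝ) : 1 ≤ weberGrowth b := by
  have hb := abs_nonneg b
  have hb' := neg_abs_le b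
  have h : (1 : ℝ) ≤ exp (3 * (b + (1 + |b|)) + 3 / 8 * (1 + |b|) + 9 / 4) :=
    Real.one_le_exp (by linarith)
  rw [weberGrowth]
  nlinarith

namespace WeberSol

variable {a b : ℝ} {y y' z z' : ℝ → ℝ} {m : ℕ}

theorem IsBasic.wronskian_zero (hy : IsBasic m y y') (hz : IsBasic m z z') :
    y' 0 * z 0 - y 0 * z' 0 = 0 := by
  rcases hy with ⟨rfl, h1, h2⟩ | ⟨rfl, h1, h2⟩ <;> rcases hz with ⟨h, h3, h4⟩ | ⟨h, h3, h4⟩ <;>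
    simp_all

theorem abs_le_div_sqrt (h : WeberSol b y y') (hm : IsBasic m y y') {x : ℝ} (hx : 1 ≤ x) :
    |y x| * √x ≤ 2 * √(weberGrowth b) := by
  have h1 := (Complex.abs_re_le_norm _).trans (h.norm_amp_le hm.le_one hx)
  have h2 : |√x * y x / 2| = |y x| * √x / 2 := by
    rw [abs_div, abs_mul, abs_of_nonneg (Real.sqrt_nonneg x), abs_two, mul_comm]
  have h3 : (weberAmp y y' x).re = √x * y x / 2 := rfl
  rw [h3, h2] at h1
  linarith

/-- The difference between the truncated inner product of two solutions and its main term. -/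
def remainder (m : ℕ) (a b : ℝ) (y z : ℝ → ℝ) (R : ℝ) : ℝ :=
  (∫ x in (0 : ℝ)..R, y x * z x) -
    (2 * (star (connC m a) * connC m b) *
      Complex.exp (Complex.I * ((log R * (a - b) : ℝ) : ℂ))).im / (a - b)

theorem remainder_eq (hy : WeberSol a y y') (hz : WeberSol b z z') (hym : IsBasic m y y')
    (hzm : IsBasic m z z') (hab : a ≠ b) {R : ℝ} (hR : 0 < R) :
    remainder m a b y z R = 2 * (star (weberAmp y y' R) * weberAmp z z' R -
      star (asympAmp m a R) * asympAmp m b R).im / (a - b) := by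
  have h := hy.sub_mul_integral_eq hz (hym.wronskian_zero hzm) R
  rw [wronskian_eq_im hR] at h
  have hne : a - b ≠ 0 := sub_ne_zero.2 hab
  rw [remainder, mul_assoc 2 _ (Complex.exp _), ← star_asympAmp_mul]
  have e : (2 * (star (asympAmp m a R) * asympAmp m b R)).im =
      2 * (star (asympAmp m a R) * asympAmp m b R).im := by
    rw [Complex.mul_im]; simp
  rw [e, Complex.sub_im, eq_div_iff hne, sub_mul, div_mul_cancel₀ _ hne]
  linarith

/-- Products of amplitudes approach products of their asymptotic forms at the rate `1 / R ^ 2`. -/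
theorem norm_amp_mul_sub_le (hy : WeberSol a y y') (hz : WeberSol b z z') (hym : IsBasic m y y')
    (hzm : IsBasic m z z') {R : ℝ} (hR : 1 ≤ R) :
    ‖star (weberAmp y y' R) * weberAmp z z' R - star (asympAmp m a R) * asympAmp m b R‖ ≤
      3 * ((1 + |a|) ^ 2 + (1 + |b|) ^ 2) * (√(weberGrowth a) * √(weberGrowth b)) / R ^ 2 := by
  refine (norm_star_mul_sub_le _ _ _ _).trans ?_
  have h1 : ‖weberAmp y y' R - asympAmp m a R‖ ≤ 3 * (1 + |a|) ^ 2 * √(weberGrowth a) / R ^ 2 :=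
    hy.norm_amp_sub_connC_le hym hR
  have h2 : ‖weberAmp z z' R - asympAmp m b R‖ ≤ 3 * (1 + |b|) ^ 2 * √(weberGrowth b) / R ^ 2 :=
    hz.norm_amp_sub_connC_le hzm hR
  have h3 := hz.norm_amp_le hzm.le_one hR
  have h4 : ‖asympAmp m a R‖ ≤ √(weberGrowth a) := by
    rw [norm_asympAmp]; exact hy.norm_connC_le hym
  calc _ ≤ 3 * (1 + |a|) ^ 2 * √(weberGrowth a) / R ^ 2 * √(weberGrowth b) +
        √(weberGrowth a) * (3 * (1 + |b|) ^ 2 * √(weberGrowth b) / R ^ 2) := by gcongr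
    _ = _ := by ring

theorem abs_remainder_le_far (hy : WeberSol a y y') (hz : WeberSol b z z')
    (hym : IsBasic m y y') (hzm : IsBasic m z z') (hab : 1 ≤ |a - b|) {R : ℝ} (hR : 1 ≤ R) :
    |remainder m a b y z R| ≤ 4 * (√(weberGrowth a) * √(weberGrowth b)) := by
  have hne : a ≠ b := by rintro rfl; norm_num at hab
  rw [hy.remainder_eq hz hym hzm hne (by linarith), abs_div, div_le_iff₀ (by linarith), abs_mul,
    abs_two]
  have h1 := Complex.abs_im_le_norm (star (weberAmp y y' R) * weberAmp z z' R -
      star (asympAmp m a R) * asympAmp m b R)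
  have h2 := norm_sub_le (star (weberAmp y y' R) * weberAmp z z' R)
    (star (asympAmp m a R) * asympAmp m b R)
  rw [norm_mul, norm_mul, norm_star, norm_star, norm_asympAmp, norm_asympAmp] at h2
  have h3 := mul_le_mul (hy.norm_amp_le hym.le_one hR) (hz.norm_amp_le hzm.le_one hR)
    (norm_nonneg _) (Real.sqrt_nonneg _)
  have h4 := mul_le_mul (hy.norm_connC_le hym) (hz.norm_connC_le hzm)
    (norm_nonneg _) (Real.sqrt_nonneg _)
  have h5 : 0 ≤ √(weberGrowth a) * √(weberGrowth b) := by positivity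
  nlinarith

theorem tendsto_remainder (hy : WeberSol a y y') (hz : WeberSol b z z')
    (hym : IsBasic m y y') (hzm : IsBasic m z z') (hab : a ≠ b) :
    Tendsto (remainder m a b y z) atTop (𝓝 0) := by
  have h1 : Tendsto (fun R : ℝ => 2 * (3 * ((1 + |a|) ^ 2 + (1 + |b|) ^ 2) *
      (√(weberGrowth a) * √(weberGrowth b)) / R ^ 2) / |a - b|) atTop
      (𝓝 (2 * 0 / |a - b|)) :=
    ((tendsto_const_nhds.div_atTop (tendsto_pow_atTop two_ne_zero)).const_mul 2).div_const _
  rw [mul_zero, zero_div] at h1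
  refine squeeze_zero_norm' ?_ h1
  filter_upwards [eventually_ge_atTop 1] with R hR
  rw [hy.remainder_eq hz hym hzm hab (by linarith), Real.norm_eq_abs, abs_div, abs_mul, abs_two]
  gcongr
  exact (Complex.abs_im_le_norm _).trans (hy.norm_amp_mul_sub_le hz hym hzm hR)

/-- Differentiating the main term in `R` produces a factor `a - b` that cancels the denominator and
leaves `2 Re (conj G_a · G_b) / x`, where `G` is the asymptotic form of the amplitude. The matching
expression for the solutions is `y z / 2 + 2 y' z' / x²`, whereas the inner product contributes `y
z`; the derivative of `2 y z' / x²` converts one into the other up to terms of order `x⁻³`. -/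
theorem hasDerivAt_remainder_add (hy : WeberSol a y y') (hz : WeberSol b z z') (hab : a ≠ b)
    {x : ℝ} (hx : 0 < x) :
    HasDerivAt (fun x => remainder m a b y z x + 2 * (y x * z' x) / x ^ 2)
      (2 * (star (weberAmp y y' x) * weberAmp z z' x -
        star (asympAmp m a x) * asympAmp m b x).re / x + 2 * b * (y x * z x) / x ^ 2 -
        4 * (y x * z' x) / x ^ 3) x := by
  have hne : a - b ≠ 0 := sub_ne_zero.2 hab
  have hx0 := hx.ne'
  have hJ : HasDerivAt (fun R => ∫ x in (0 : ℝ)..R, y x * z x) (y x * z x) x := by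
    have hc : Continuous fun x => y x * z x := hy.continuous.mul hz.continuous
    exact intervalIntegral.integral_hasDerivAt_right (hc.intervalIntegrable _ _)
      hc.aestronglyMeasurable.stronglyMeasurableAtFilter hc.continuousAt
  have hE : HasDerivAt (fun R : ℝ => 2 * (star (connC m a) * connC m b) *
      Complex.exp (Complex.I * ((log R * (a - b) : ℝ) : ℂ)))
      (2 * (star (connC m a) * connC m b) *
        (Complex.exp (Complex.I * ((log x * (a - b) : ℝ) : ℂ)) *
          (Complex.I * ((x⁻¹ * (a - b) : ℝ) : ℂ)))) x :=
    ((((Real.hasDerivAt_log hx0).mul_const (a - b)).ofReal_comp.const_mul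
      Complex.I).cexp).const_mul _
  have hI := (Complex.imCLM.hasFDerivAt.comp_hasDerivAt x hE).div_const (a - b)
  have hT := ((hJ.sub hI).add ((((hy.1 x).mul (hz.2 x)).const_mul 2).div (hasDerivAt_pow 2 x)
    (pow_ne_zero 2 hx0)))
  refine hT.congr_deriv ?_
  have e1 : (Complex.imCLM (2 * (star (connC m a) * connC m b) *
        (Complex.exp (Complex.I * ((log x * (a - b) : ℝ) : ℂ)) *
          (Complex.I * ((x⁻¹ * (a - b) : ℝ) : ℂ))))) =
      2 * (star (asympAmp m a x) * asympAmp m b x).re * (x⁻¹ * (a - b)) := by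
    rw [star_asympAmp_mul]
    generalize star (connC m a) * connC m b = P
    generalize Complex.exp (Complex.I * ((log x * (a - b) : ℝ) : ℂ)) = E
    generalize x⁻¹ * (a - b) = s
    simp only [Complex.imCLM_apply, Complex.mul_im, Complex.mul_re, Complex.I_re, Complex.I_im,
      Complex.ofReal_re, Complex.ofReal_im, Complex.re_ofNat, Complex.im_ofNat]
    ring
  have e2 := mul_eq_re hx y y' z z'
  rw [e1, Complex.sub_re, Pi.mul_apply]
  have e3 : (star (weberAmp y y' x) * weberAmp z z' x).re =
      x * (y x * z x / 4 + y' x * z' x / x ^ 2) := by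
    rw [e2]; field_simp
  rw [e3]
  field_simp
  ring

/-- The corrected remainder has a derivative bounded by a multiple of `x⁻³`, uniformly in `b` near
`a`, so it moves by a bounded amount on `[1, ∞)`. The correction itself is at most `4 Q` at either
end, with `Q` as in the proof. -/
theorem abs_remainder_le_near (hy : WeberSol a y y') (hz : WeberSol b z z')
    (hym : IsBasic m y y') (hzm : IsBasic m z z') (hab : a ≠ b) {R : ℝ} (hR : 1 ≤ R) :
    |remainder m a b y z R| ≤ |remainder m a b y z 1| +
      (3 * ((1 + |a|) ^ 2 + (1 + |b|) ^ 2) + 4 * (1 + |b|) + 8) *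
      (√(weberGrowth a) * √(weberGrowth b)) := by
  set Q := √(weberGrowth a) * √(weberGrowth b)
  have hQ : 0 ≤ Q := by positivity
  set T : ℝ → ℝ := fun x => remainder m a b y z x + 2 * (y x * z' x) / x ^ 2
  have hyz : ∀ x : ℝ, 1 ≤ x → |y x * z x| * x ≤ 4 * Q := fun x hx => by
    have h := mul_le_mul (hy.abs_le_div_sqrt hym hx) (hz.abs_le_div_sqrt hzm hx)
      (by positivity) (by positivity)
    calc |y x * z x| * x = |y x| * √x * (|z x| * √x) := by
          rw [abs_mul]; nth_rw 3 [← Real.mul_self_sqrt (zero_le_one.trans hx)]; ring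
      _ ≤ _ := h
      _ = _ := by ring
  have hyz' : ∀ x : ℝ, 1 ≤ x → |y x * z' x| ≤ 2 * Q := fun x hx => by
    have hs : 0 < √x := Real.sqrt_pos.2 (by linarith)
    have h := mul_le_mul (hy.abs_le_div_sqrt hym hx) (hz.abs_deriv_le hzm.le_one hx)
      (by positivity) (by positivity)
    refine le_of_mul_le_mul_right ?_ hs
    calc |y x * z' x| * √x = |y x| * √x * |z' x| := by rw [abs_mul]; ring
      _ ≤ _ := h
      _ = _ := by ring
  set M := 3 * ((1 + |a|) ^ 2 + (1 + |b|) ^ 2) * Q + 4 * (1 + |b|) * Q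
  have hM : 0 ≤ M := by positivity
  have key := norm_sub_le_of_deriv_le_inv_cube (H := fun x => (T x : ℂ)) (M := M)
    (fun x hx => (hy.hasDerivAt_remainder_add (m := m) hz hab (zero_lt_one.trans_le hx)).ofReal_comp)
    (fun x hx => ?_) le_rfl hR
  · rw [← Complex.ofReal_sub, Complex.norm_real, Real.norm_eq_abs] at key
    have h1 : |T R - T 1| ≤ M := by
      have : 0 ≤ M / R ^ 2 := by positivity
      norm_num at key
      linarith
    have h2 : |2 * (y R * z' R) / R ^ 2| ≤ 4 * Q := by
      rw [abs_div, abs_mul, abs_two, abs_of_nonneg (sq_nonneg R)]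
      refine (div_le_self (by positivity) (one_le_pow₀ hR)).trans ?_
      linarith [hyz' R hR]
    have h3 : |2 * (y 1 * z' 1) / 1 ^ 2| ≤ 4 * Q := by
      rw [one_pow, div_one, abs_mul, abs_two]
      linarith [hyz' 1 le_rfl]
    have e : remainder m a b y z R = remainder m a b y z 1 + (T R - T 1) -
        2 * (y R * z' R) / R ^ 2 + 2 * (y 1 * z' 1) / 1 ^ 2 := by
      simp only [T]; ring
    have h4 := abs_add_le (remainder m a b y z 1 + (T R - T 1) -
        2 * (y R * z' R) / R ^ 2) (2 * (y 1 * z' 1) / 1 ^ 2)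
    have h5 := abs_sub (remainder m a b y z 1 + (T R - T 1)) (2 * (y R * z' R) / R ^ 2)
    have h6 := abs_add_le (remainder m a b y z 1) (T R - T 1)
    rw [← e] at h4
    have hMe : M = 3 * ((1 + |a|) ^ 2 + (1 + |b|) ^ 2) * Q + 4 * (1 + |b|) * Q := rfl
    linarith
  · have hx0 : 0 < x := zero_lt_one.trans_le hx
    rw [Complex.norm_real, Real.norm_eq_abs]
    have h1 : |2 * (star (weberAmp y y' x) * weberAmp z z' x -
        star (asympAmp m a x) * asympAmp m b x).re / x| ≤
        2 * (3 * ((1 + |a|) ^ 2 + (1 + |b|) ^ 2) * Q) / x ^ 3 := by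
      rw [abs_div, abs_mul, abs_two, abs_of_pos hx0]
      calc _ ≤ 2 * (3 * ((1 + |a|) ^ 2 + (1 + |b|) ^ 2) * Q / x ^ 2) / x := by
            gcongr
            exact (Complex.abs_re_le_norm _).trans (hy.norm_amp_mul_sub_le hz hym hzm hx)
        _ = _ := by field_simp
    have h2 : |2 * b * (y x * z x) / x ^ 2| ≤ 8 * |b| * Q / x ^ 3 := by
      rw [abs_div, abs_mul, abs_mul, abs_two, abs_of_nonneg (sq_nonneg x),
        div_le_div_iff₀ (by positivity) (by positivity)]
      calc 2 * |b| * |y x * z x| * x ^ 3 = 2 * |b| * (|y x * z x| * x) * x ^ 2 := by ring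
        _ ≤ 2 * |b| * (4 * Q) * x ^ 2 := by have := hyz x hx; gcongr
        _ = _ := by ring
    have h3 : |4 * (y x * z' x) / x ^ 3| ≤ 8 * Q / x ^ 3 := by
      rw [abs_div, abs_mul, abs_of_pos (by norm_num : (0 : ℝ) < 4),
        abs_of_nonneg (by positivity : 0 ≤ x ^ 3)]
      refine div_le_div_of_nonneg_right ?_ (by positivity)
      linarith [hyz' x hx]
    refine (abs_sub _ _).trans ((add_le_add (abs_add_le _ _) le_rfl).trans
      ((add_le_add (add_le_add h1 h2) h3).trans (le_of_eq ?_)))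
    simp only [M]
    ring

theorem abs_integral_mul_le (hy : WeberSol a y y') (hz : WeberSol b z z')
    (hym : IsBasic m y y') (hzm : IsBasic m z z') {R : ℝ} (hR : 0 ≤ R) :
    |∫ x in (0 : ℝ)..R, y x * z x| ≤ 4 * (√(weberGrowth a) * √(weberGrowth b)) * R := by
  have h := intervalIntegral.norm_integral_le_of_norm_le_const (a := 0) (b := R)
    (f := fun x => y x * z x) (C := 4 * (√(weberGrowth a) * √(weberGrowth b))) fun x hx => ?_
  · rwa [sub_zero, abs_of_nonneg hR] at h
  · rw [uIoc_of_le hR] at hx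
    have h1 := mul_le_mul (hy.abs_le hym.le_one hx.1.le) (hz.abs_le hzm.le_one hx.1.le)
      (abs_nonneg _) (by positivity)
    rw [norm_mul]
    refine h1.trans (le_of_eq ?_)
    ring

/-- At `R = 1` the exponential is `1`, so the main term is `2 Im (conj C_a · C_b) / (a - b)`. Since
`conj C_a · C_a` is real, `C_b` may be replaced by `C_b - C_a`, and the Lipschitz bound cancels the
denominator. -/
theorem abs_remainder_one_le (hy : WeberSol a y y') (hz : WeberSol b z z')
    (hym : IsBasic m y y') (hzm : IsBasic m z z') (hab : a ≠ b) {M : ℝ}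
    (hM : ‖connC m b - connC m a‖ ≤ M * |b - a|) :
    |remainder m a b y z 1| ≤ 4 * (√(weberGrowth a) * √(weberGrowth b)) +
      2 * (√(weberGrowth a) * M) := by
  have hpos : 0 < |a - b| := abs_pos.2 (sub_ne_zero.2 hab)
  have h1 := hy.abs_integral_mul_le hz hym hzm zero_le_one
  rw [mul_one] at h1
  rw [remainder]
  refine (abs_sub _ _).trans (add_le_add h1 ?_)
  rw [abs_div, div_le_iff₀ hpos]
  have e : (2 * (star (connC m a) * connC m b) *
      Complex.exp (Complex.I * ((log 1 * (a - b) : ℝ) : ℂ))).im =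
      2 * (star (connC m a) * (connC m b - connC m a)).im := by
    simp [Complex.mul_im, Complex.mul_re]
    ring
  rw [e, abs_mul, abs_two, abs_sub_comm]
  have h2 := Complex.abs_im_le_norm (star (connC m a) * (connC m b - connC m a))
  rw [norm_mul, norm_star] at h2
  have h3 := mul_le_mul (hy.norm_connC_le hym) hM (norm_nonneg _) (Real.sqrt_nonneg _)
  linarith

/-- A bound for the remainder that is uniform in `R` and integrable against the weights. -/
theorem abs_remainder_le (hy : WeberSol a y y') (hz : WeberSol b z z')
    (hym : IsBasic m y y') (hzm : IsBasic m z z') (hab : a ≠ b) {M : ℝ} (hM0 : 0 ≤ M)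
    (hM : b ∈ Icc (a - 1) (a + 1) → ‖connC m b - connC m a‖ ≤ M * |b - a|)
    {R : ℝ} (hR : 1 ≤ R) :
    |remainder m a b y z R| ≤ (√(weberGrowth a) * (35 * (1 + |a|) ^ 2 + 2 * M)) *
      √(weberGrowth b) := by
  have hgb : 1 ≤ √(weberGrowth b) := Real.one_le_sqrt.2 (one_le_weberGrowth b)
  have hga := Real.sqrt_nonneg (weberGrowth a)
  have hA : 1 ≤ 1 + |a| := by linarith [abs_nonneg a]
  have hA2 : 1 + |a| ≤ (1 + |a|) ^ 2 := by nlinarith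
  have hQ : 0 ≤ √(weberGrowth a) * √(weberGrowth b) := by positivity
  have hMM : √(weberGrowth a) * M ≤ √(weberGrowth a) * M * √(weberGrowth b) :=
    le_mul_of_one_le_right (by positivity) hgb
  rcases le_total 1 |a - b| with h | h
  · refine (hy.abs_remainder_le_far hz hym hzm h hR).trans ?_
    have h0 : 0 ≤ √(weberGrowth a) * M := by positivity
    nlinarith
  · have hb : |b| ≤ 1 + |a| := by
      have := abs_sub_abs_le_abs_sub b a
      rw [abs_sub_comm] at this
      linarith
    have hmem : b ∈ Icc (a - 1) (a + 1) := by
      rw [_root_.abs_le] at h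
      constructor <;> linarith
    have h1 := hy.abs_remainder_one_le hz hym hzm hab (hM hmem)
    refine (hy.abs_remainder_le_near hz hym hzm hab hR).trans ?_
    -- With `A = 1 + |a|` and `1 + |b| ≤ 2A`, the sum is at most `15 A² + 8 A + 8`. The bound at `R
    -- = 1` adds another `4`, which makes `35`.
    have h2 : 3 * ((1 + |a|) ^ 2 + (1 + |b|) ^ 2) + 4 * (1 + |b|) + 8 ≤ 31 * (1 + |a|) ^ 2 := by
      have : (1 + |b|) ^ 2 ≤ (2 * (1 + |a|)) ^ 2 := by gcongr; linarith
      nlinarith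
    have h3 := mul_le_mul_of_nonneg_right h2 hQ
    nlinarith

end WeberSol


/-! ### The limit for one parity -/

section Family

variable {φ : ℝ → ℝ} {m : ℕ} {Y Y' : ℝ → ℝ → ℝ}

theorem continuous_integral_mul (hc : Continuous fun p : ℝ × ℝ => Y p.1 p.2) (a R : ℝ) :
    Continuous fun b => ∫ x in (0 : ℝ)..R, Y a x * Y b x := by
  refine intervalIntegral.continuous_parametric_intervalIntegral_of_continuous' ?_ _ _
  exact (hc.comp (continuous_const.prodMk continuous_snd)).mul hc

theorem integrable_mul_weight_mul_integral (hφ : PiecewiseC1 φ)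
    (hg : Integrable fun b => |φ b| * ((1 + |b|) * √(weberGrowth b)))
    (hY : ∀ b, WeberSol b (Y b) (Y' b)) (hm : ∀ b, WeberSol.IsBasic m (Y b) (Y' b))
    (hc : Continuous fun p : ℝ × ℝ => Y p.1 p.2) (a : ℝ) {R : ℝ} (hR : 0 ≤ R) :
    Integrable fun b => φ b * (weberWeight m b * ∫ x in (0 : ℝ)..R, Y a x * Y b x) := by
  obtain ⟨K, hK⟩ := exists_weberWeight_le m
  have hcont : Continuous fun b => weberWeight m b * ∫ x in (0 : ℝ)..R, Y a x * Y b x :=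
    (differentiable_weberWeight m).continuous.mul (continuous_integral_mul hc a R)
  refine (hg.const_mul (K * (4 * √(weberGrowth a) * R))).mono'
    (hφ.aestronglyMeasurable.mul hcont.aestronglyMeasurable) (ae_of_all _ fun b => ?_)
  rw [norm_mul, norm_mul, Real.norm_eq_abs, Real.norm_eq_abs, Real.norm_eq_abs]
  have h2 := mul_le_mul (hK b) ((hY a).abs_integral_mul_le (hY b) (hm a) (hm b) hR)
    (abs_nonneg _) ((abs_nonneg _).trans (hK b))
  refine (mul_le_mul_of_nonneg_left h2 (abs_nonneg _)).trans (le_of_eq ?_)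
  ring

/-- Split the inner product into main term and remainder. The remainder tends to zero for every `b ≠
a` under a bound integrable in `b`, so dominated convergence removes it. The main term is the
Dirichlet kernel at frequency `log R`. -/
theorem tendsto_integral_mul_weight_mul_integral (hφ : PiecewiseC1 φ)
    (hg : Integrable fun b => |φ b| * ((1 + |b|) * √(weberGrowth b)))
    (hY : ∀ b, WeberSol b (Y b) (Y' b)) (hm : ∀ b, WeberSol.IsBasic m (Y b) (Y' b))
    (hc : Continuous fun p : ℝ × ℝ => Y p.1 p.2) (a : ℝ) :
    Tendsto (fun R => ∫ b, φ b * (weberWeight m b * ∫ x in (0 : ℝ)..R, Y a x * Y b x)) atTop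
      (𝓝 (π * (weberWeight m a * ‖connC m a‖ ^ 2) *
        (Function.leftLim φ a + Function.rightLim φ a))) := by
  obtain ⟨K, hK⟩ := exists_weberWeight_le m
  have hC := differentiable_connC m
  have hw := differentiable_weberWeight m
  obtain ⟨M, hM⟩ := exists_bound_sub_of_differentiableAt hC.continuous (hC a)
  -- At `b = a` this is real, as the localization requires, and it equals twice the weight times
  -- `|C_a|²`.
  set V : ℝ → ℂ := fun b => (weberWeight m b : ℂ) * (2 * (star (connC m a) * connC m b)) with hV
  have hVdiff : Differentiable ℝ V :=
    (Complex.ofRealCLM.differentiable.comp hw).mul ((hC.const_mul _).const_mul _)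
  have hVa : V a = ((2 * (weberWeight m a * ‖connC m a‖ ^ 2) : ℝ) : ℂ) := by
    simp only [hV]
    rw [Complex.star_def, ← Complex.normSq_eq_conj_mul_self, Complex.normSq_eq_norm_sq]
    push_cast
    ring
  have hVint : Integrable fun b => |φ b| * ‖V b‖ := by
    refine (hg.const_mul (K * (2 * ‖connC m a‖))).mono'
      ((continuous_abs.comp_aestronglyMeasurable hφ.aestronglyMeasurable).mul
        hVdiff.continuous.norm.aestronglyMeasurable) (ae_of_all _ fun b => ?_)
    rw [norm_mul, norm_norm, norm_mul, norm_mul, norm_mul, norm_star, Complex.norm_real,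
      Real.norm_eq_abs, Real.norm_eq_abs, abs_abs, Complex.norm_two]
    have h2 := mul_le_mul (hK b) (mul_le_mul_of_nonneg_left (mul_le_mul_of_nonneg_left
      ((hY b).norm_connC_le (hm b)) (norm_nonneg (connC m a))) zero_le_two)
      (by positivity) ((abs_nonneg _).trans (hK b))
    refine (mul_le_mul_of_nonneg_left h2 (abs_nonneg _)).trans (le_of_eq ?_)
    ring
  obtain ⟨hDint, hDlim⟩ := tendsto_integral_dirichlet hφ hVdiff.continuous (hVdiff a)
    (by rw [hVa, Complex.ofReal_im]) hVint
  have hlim := hDlim.comp Real.tendsto_log_atTop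
  have hsplit : ∀ R b, φ b * (weberWeight m b * WeberSol.remainder m a b (Y a) (Y b) R) =
      φ b * (weberWeight m b * ∫ x in (0 : ℝ)..R, Y a x * Y b x) -
      φ b * ((V b * Complex.exp (Complex.I * ((log R * (a - b) : ℝ) : ℂ))).im / (a - b)) := by
    intro R b
    rw [WeberSol.remainder, hV, mul_assoc (weberWeight m b : ℂ), Complex.im_ofReal_mul]
    ring
  have hrint : ∀ R, 0 ≤ R → Integrable fun b =>
      φ b * (weberWeight m b * WeberSol.remainder m a b (Y a) (Y b) R) := by
    intro R hR
    simp only [hsplit]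
    exact (integrable_mul_weight_mul_integral hφ hg hY hm hc a hR).sub (hDint _)
  have hne : ∀ᵐ b : ℝ, a ≠ b := by
    filter_upwards [compl_mem_ae_iff.2 (measure_singleton a)] with b hb
    exact fun h => hb h.symm
  have hrlim : Tendsto (fun R => ∫ b,
      φ b * (weberWeight m b * WeberSol.remainder m a b (Y a) (Y b) R)) atTop (𝓝 (∫ _ : ℝ, 0)) := by
    refine tendsto_integral_filter_of_dominated_convergence
      (fun b => K * (√(weberGrowth a) * (35 * (1 + |a|) ^ 2 + 2 * |M|)) *
        (|φ b| * ((1 + |b|) * √(weberGrowth b)))) ?_ ?_ (hg.const_mul _) ?_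
    · filter_upwards [eventually_ge_atTop 0] with R hR
      exact (hrint R hR).aestronglyMeasurable
    · filter_upwards [eventually_ge_atTop 1] with R hR
      filter_upwards [hne] with b hb
      rw [norm_mul, norm_mul, Real.norm_eq_abs, Real.norm_eq_abs, Real.norm_eq_abs]
      have h2 := mul_le_mul (hK b) ((hY a).abs_remainder_le (hY b) (hm a) (hm b) hb (abs_nonneg M)
        (fun h => (hM b h).trans (mul_le_mul_of_nonneg_right (le_abs_self M) (abs_nonneg _))) hR)
        (abs_nonneg _) ((abs_nonneg _).trans (hK b))
      refine (mul_le_mul_of_nonneg_left h2 (abs_nonneg _)).trans (le_of_eq ?_)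
      ring
    · filter_upwards [hne] with b hb
      have h := ((hY a).tendsto_remainder (hY b) (hm a) (hm b) hb).const_mul (weberWeight m b)
      simpa using h.const_mul (φ b)
  have hsum := hrlim.add hlim
  rw [integral_zero, zero_add, hVa, Complex.ofReal_re] at hsum
  refine Tendsto.congr' ?_ (hsum.trans_eq (by congr 1; ring))
  filter_upwards [eventually_ge_atTop 0] with R hR
  rw [Function.comp_apply, ← integral_add (hrint R hR) (hDint _)]
  refine integral_congr_ae (ae_of_all _ fun b => ?_)
  simp only [hsplit, sub_add_cancel]

end Family

/-! ### Weber's function -/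

theorem weberW_eq (a x : ℝ) : weberW a x =
    weberWeight 0 a * weberEven a x + weberWeight 1 a * weberOdd a x := by
  simp only [weberW, weberWeight]
  norm_num
  ring

theorem continuous_weberEven_right (a : ℝ) : Continuous (weberEven a) :=
  continuous_weberEven.comp (continuous_const.prodMk continuous_id)

theorem continuous_weberOdd_right (a : ℝ) : Continuous (weberOdd a) :=
  continuous_weberOdd.comp (continuous_const.prodMk continuous_id)

/-- Fold the integral at the origin; the products of an even and an odd solution cancel. -/
theorem integral_weberW_mul (a b R : ℝ) : ∫ x in (-R)..R, weberW a x * weberW b x =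
    2 * weberWeight 0 a * (weberWeight 0 b * ∫ x in (0 : ℝ)..R, weberEven a x * weberEven b x) +
    2 * weberWeight 1 a * (weberWeight 1 b * ∫ x in (0 : ℝ)..R, weberOdd a x * weberOdd b x) := by
  have he := continuous_weberEven_right
  have ho := continuous_weberOdd_right
  have hc : Continuous fun x => weberW a x * weberW b x := by
    simp only [weberW_eq]
    have := he a; have := he b; have := ho a; have := ho b
    fun_prop
  have h1 : ∫ x in (-R)..0, weberW a x * weberW b x =
      ∫ x in (0 : ℝ)..R, weberW a (-x) * weberW b (-x) := by
    rw [intervalIntegral.integral_comp_neg (fun x => weberW a x * weberW b x), neg_zero]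
  have hc' : Continuous fun x => weberW a (-x) * weberW b (-x) := hc.comp continuous_neg
  rw [← intervalIntegral.integral_add_adjacent_intervals (hc.intervalIntegrable (-R) 0)
    (hc.intervalIntegrable 0 R), h1, ← intervalIntegral.integral_add
    (hc'.intervalIntegrable _ _) (hc.intervalIntegrable _ _), ← mul_assoc, ← mul_assoc,
    ← intervalIntegral.integral_const_mul, ← intervalIntegral.integral_const_mul,
    ← intervalIntegral.integral_add
      (Continuous.intervalIntegrable (by have := he a; have := he b; fun_prop) _ _)
      (Continuous.intervalIntegrable (by have := ho a; have := ho b; fun_prop) _ _)]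
  refine intervalIntegral.integral_congr fun x _ => ?_
  simp only [weberW_eq, weberEven_neg, weberOdd_neg]
  ring

theorem theorem4 (a : ℝ) (φ : ℝ → ℝ) (hφ : PiecewiseC1 φ)
    (hneg : IntegrableOn (fun x : ℝ => |φ x| * Real.exp (π * |x| / 4) / |x|) (Set.Iic (-1)) volume)
    (hpos : IntegrableOn (fun x : ℝ => |φ x| * Real.exp (5 * π * x / 4) / x) (Set.Ici 1) volume) :
    (∀ R : ℝ, 0 < R →
      Integrable (fun b : ℝ => φ b * ∫ x in (-R)..R, weberW a x * weberW b x) volume) ∧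
    Tendsto (fun R : ℝ => ∫ b : ℝ, φ b * ∫ x in (-R)..R, weberW a x * weberW b x) atTop
      (𝓝 (π * √(1 + Real.exp (2 * π * a)) * (Function.leftLim φ a + Function.rightLim φ a))) := by
  have hg := hφ.integrable_mul_growth hneg hpos
  have hm0 : ∀ b, WeberSol.IsBasic 0 (weberEven b) (weberEvenDeriv b) := fun b =>
    Or.inl ⟨rfl, weberEven_zero b, weberEvenDeriv_zero b⟩
  have hm1 : ∀ b, WeberSol.IsBasic 1 (weberOdd b) (weberOddDeriv b) := fun b =>
    Or.inr ⟨rfl, weberOdd_zero b, weberOddDeriv_zero b⟩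
  have i0 := fun R hR => (integrable_mul_weight_mul_integral hφ hg weberSol_even hm0
    continuous_weberEven a (R := R) hR).const_mul (2 * weberWeight 0 a)
  have i1 := fun R hR => (integrable_mul_weight_mul_integral hφ hg weberSol_odd hm1
    continuous_weberOdd a (R := R) hR).const_mul (2 * weberWeight 1 a)
  have hsplit : ∀ R, (fun b => φ b * ∫ x in (-R)..R, weberW a x * weberW b x) = fun b =>
      2 * weberWeight 0 a * (φ b * (weberWeight 0 b *
        ∫ x in (0 : ℝ)..R, weberEven a x * weberEven b x)) +
      2 * weberWeight 1 a * (φ b * (weberWeight 1 b *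
        ∫ x in (0 : ℝ)..R, weberOdd a x * weberOdd b x)) := by
    intro R
    funext b
    rw [integral_weberW_mul]
    ring
  refine ⟨fun R hR => ?_, ?_⟩
  · rw [hsplit]
    exact (i0 R hR.le).add (i1 R hR.le)
  · have t0 := (tendsto_integral_mul_weight_mul_integral hφ hg weberSol_even hm0
      continuous_weberEven a).const_mul (2 * weberWeight 0 a)
    have t1 := (tendsto_integral_mul_weight_mul_integral hφ hg weberSol_odd hm1
      continuous_weberOdd a).const_mul (2 * weberWeight 1 a)
    have hval : 2 * weberWeight 0 a * (π * (weberWeight 0 a * ‖connC 0 a‖ ^ 2) *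
          (Function.leftLim φ a + Function.rightLim φ a)) +
        2 * weberWeight 1 a * (π * (weberWeight 1 a * ‖connC 1 a‖ ^ 2) *
          (Function.leftLim φ a + Function.rightLim φ a)) =
        π * √(1 + Real.exp (2 * π * a)) * (Function.leftLim φ a + Function.rightLim φ a) := by
      -- Each parity contributes `2π · √(1 + e^{2πa}) / 4`, which is half of the total.
      have e0 := weberWeight_sq_mul_norm_connC_sq (Or.inl rfl : (0 : ℕ) = 0 ∨ 0 = 1) a
      have e1 := weberWeight_sq_mul_norm_connC_sq (Or.inr rfl : (1 : ℕ) = 0 ∨ 1 = 1) a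
      linear_combination (2 * π * (Function.leftLim φ a + Function.rightLim φ a)) * (e0 + e1)
    rw [← hval]
    refine (t0.add t1).congr' ?_
    filter_upwards [eventually_ge_atTop 0] with R hR
    rw [hsplit, integral_add (i0 R hR) (i1 R hR), integral_const_mul, integral_const_mul]

end
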